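/- **Theorem (Entrywise guarantee for the refined estimator).** Fix an integer $r\ge 1$ and constants $c_\sigma>0$, $C_\sigma,C_A,C_\Theta,\alpha,C_0,C_{\mathrm{init}}$. There are constants $c,C_n,C,K>0$, depending only on $r$ and on these constants, such that the following holds for all integers $d\ge 2$ and $n\ge C_n\,d\log^K d$. *Signal.* Let $T^\star=\Theta^\star (A^\star)^\top\in\mathbb R^{d\times d}$ with $\Theta^\star,A^\star\in\mathbb R^{d\times r}$, $(A^\star)^\top A^\star=I_r$, $\mathbf 1^\top T^\star=0$, $c_\sigma d\le\sigma_r(T^\star)\le\sigma_1(T^\star)\le C_\sigma d$, $\|A^\star\|_{2\to\infty}\le C_A d^{-1/2}$, $\|\Theta^\star\|_{2\to\infty}\le C_\Theta d^{1/2}$ and $\|T^\star\|_\infty\le\alpha$, where $\|\cdot\|_{2\to\infty}$ is the largest Euclidean norm of a row and $\|\cdot\|_\infty$ the largest absolute value of an entry. *Data.* Let $(J_t,U_t,V_t,Y_t)$, $t=1,\dots,n$, be i.i.d., with $J_t$ uniform on $[d]$, independent of $J_t$ the pair $\{U_t,V_t\}$ uniform on the unordered pairs of distinct elements of $[d]$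 (written with $U_t<V_t$), and $Y_t\in\{0,1\}$ conditionally Bernoulli with parameter $\sigma(T^\star_{U_tJ_t}-T^\star_{V_tJ_t})$, where $\sigma(x)=1/(1+e^{-x})$. Let the sample be partitioned, independently of the data, into three folds $D_1,D_2,D_3$ of equal size (up to one observation). *Estimator.* Let $\widehat T^{(0)}\in\mathbb R^{d\times d}$ be a function of $D_1$. 1. Take $r$ leading right singular vectors of $\widehat T^{(0)}$ as the columns of a $d\times r$ matrix and project each of its rows onto the Euclidean ball of radius $C_A d^{-1/2}$; call the result $\widehat A$, with rows $\widehat a_j$. 2. For each $u\in[d]$ let $\widetilde\theta_u\in\mathbb R^r$ solve $\sum_\ell \widehat a_{j_\ell}\{z_\ell-\sigma(\widehat a_{j_\ell}^\top\theta-\widehat T^{(0)}_{w_\ell j_\ell})\}=0$. The sum is over the comparisons of $D_2$ that involve row $u$; $j_\ell$ is the column, $w_\ell$ the other row, and $z_\ell\in\{0,1\}$ indicates that $u$ is preferred to $w_\ell$. Let $\widetilde\Theta$ have the rows $\widetilde\theta_u$ and recenter: $\overline\Theta=(I_d-d^{-1}\mathbf 1\mathbf 1^\top)\widetilde\Theta$,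 with rows $\overline\theta_u$. 3. For each $j\in[d]$ let $\widetilde a_j\in\mathbb R^r$ solve $\sum_{t\in D_3,\,J_t=j}x_t\{Y_t-\sigma(x_t^\top a)\}=0$, where $x_t=\overline\theta_{U_t}-\overline\theta_{V_t}$. Let $\widetilde A$ have the rows $\widetilde a_j$, and put $\widetilde T=\overline\Theta\widetilde A^\top$. *Conclusion.* Let $\mathcal G$ be the event that $\|\widehat T^{(0)}\|_\infty\le C_0$ and $\|\widehat T^{(0)}-T^\star\|_F\le C_{\mathrm{init}}\sqrt{d^3/n}$. Given $\mathcal G$ (if it has positive probability), with conditional probability at least $1-d^{-c}$ the procedure has an output $\widetilde T$, and every such output (for every choice of singular vectors and of solutions of the score equations) satisfies $$\|\widetilde T-T^\star\|_\infty\le C\sqrt{\frac dn}\,\log^K d .$$ -/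

import Mathlib

open MeasureTheory ProbabilityTheory

noncomputable section

namespace PairwiseRefinement

/-! ### Norms of matrices -/

/-- The Frobenius norm. -/
def frobNorm {m k : ℕ} (M : Matrix (Fin m) (Fin k) ℝ) : ℝ :=
  Real.sqrt (∑ i, ∑ j, M i j ^ 2)

/-- The Euclidean norm of the row with index `i`. -/
def rowNorm {m k : ℕ} (M : Matrix (Fin m) (Fin k) ℝ) (i : Fin m) : ℝ :=
  Real.sqrt (∑ j, M i j ^ 2)

/-- `singVal M k` is the singular value of `M` with the one-based index `k`, in decreasing order:
`singVal M 1` is the largest one. Only used with `1 ≤ k`. -/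
def singVal {d : ℕ} (M : Matrix (Fin d) (Fin d) ℝ) (k : ℕ) : ℝ :=
  (Matrix.toEuclideanLin M).singularValues (k - 1)

/-! ### The pairwise logistic model -/

/-- One observed comparison: in the column `col`, the rows `left` and `right` are compared, and
`win = true` (that is, `Y = 1`) means that `left` is preferred. -/
abbrev Obs (d : ℕ) : Type := Fin d × Fin d × Fin d × Bool

/-- The column `J`. -/
def Obs.col {d : ℕ} (z : Obs d) : Fin d := z.1

/-- The row `U`. -/
def Obs.left {d : ℕ} (z : Obs d) : Fin d := z.2.1

/-- The row `V`. -/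
def Obs.right {d : ℕ} (z : Obs d) : Fin d := z.2.2.1

/-- The outcome `Y`, as a real number in `{0, 1}`. -/
def Obs.outcome {d : ℕ} (z : Obs d) : ℝ := if z.2.2.2 then 1 else 0

/-- The probability mass function of one comparison. The column is uniform on the `d` columns, the
unordered pair of rows is uniform on the `d.choose 2` pairs (recorded with the smaller index
first), and given those, `Y` is Bernoulli with parameter `σ (T U J - T V J)`. -/
def comparisonMass {d : ℕ} (T : Matrix (Fin d) (Fin d) ℝ) (z : Obs d) : ℝ :=
  if z.left < z.right then
    (1 / (d : ℝ)) * (1 / (d.choose 2 : ℝ)) *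
      (if z.2.2.2 then Real.sigmoid (T z.left z.col - T z.right z.col)
        else 1 - Real.sigmoid (T z.left z.col - T z.right z.col))
  else 0

/-- `Z` is a sample of `n` independent comparisons, each with the law of the model at `T`. -/
structure IsComparisonSample {Ω : Type*} [MeasurableSpace Ω] (P : Measure Ω) {d n : ℕ}
    (T : Matrix (Fin d) (Fin d) ℝ) (Z : Fin n → Ω → Obs d) : Prop where
  measurable : ∀ i, Measurable (Z i)
  indep : iIndepFun Z P
  law : ∀ i z, P.real {ω | Z i ω = z} = comparisonMass T z

/-! ### Data splitting -/

/-- A partition of the `n` sample indices into three folds, given by the label of every index, is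
balanced if the sizes of the folds differ by at most one (they are equal if `3 ∣ n`). -/
def IsBalanced {n : ℕ} (φ : Fin n → Fin 3) : Prop :=
  ∀ a b : Fin 3,
    (Finset.univ.filter fun i => φ i = a).card ≤ (Finset.univ.filter fun i => φ i = b).card + 1

/-- The part of the data `z` that belongs to the first fold. -/
def firstFold {d n : ℕ} (φ : Fin n → Fin 3) (z : Fin n → Obs d) : Fin n → Option (Obs d) :=
  fun i => if φ i = 0 then some (z i) else none

/-! ### The refinement procedure -/

/-- `A` consists of the leading `r` right singular vectors in some singular value decomposition
`T = W * diagonal s * Vᵀ` with orthogonal `W`, `V` and `s` nonnegative and decreasing. -/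
def IsRightFactor {d r : ℕ} (T : Matrix (Fin d) (Fin d) ℝ) (A : Matrix (Fin d) (Fin r) ℝ) : Prop :=
  ∃ W ∈ Matrix.orthogonalGroup (Fin d) ℝ, ∃ V ∈ Matrix.orthogonalGroup (Fin d) ℝ,
    ∃ s : Fin d → ℝ, Antitone s ∧ (∀ i, 0 ≤ s i) ∧ T = W * Matrix.diagonal s * V.transpose ∧
      ∃ h : r ≤ d, ∀ i k, A i k = V i (Fin.castLE h k)

/-- Row-norm projection: every row is projected onto the Euclidean ball of radius `ρ`. -/
def projRows {d r : ℕ} (ρ : ℝ) (A : Matrix (Fin d) (Fin r) ℝ) : Matrix (Fin d) (Fin r) ℝ :=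
  Matrix.of fun i k => if rowNorm A i ≤ ρ then A i k else ρ / rowNorm A i * A i k

/-- The row-wise logistic score `S_u(θ)`, a vector in `ℝ^r`: a sum over the comparisons of the
second fold that involve the row `u`, reoriented so that `u` stands on the left. The right factor
`A` is fixed, and the entry of the initializer `T₀` for the opponent of `u` is the offset. -/
def rowScore {d r n : ℕ} (A : Matrix (Fin d) (Fin r) ℝ) (T₀ : Matrix (Fin d) (Fin d) ℝ)
    (φ : Fin n → Fin 3) (z : Fin n → Obs d) (u : Fin d) (θ : Fin r → ℝ) : Fin r → ℝ :=
  ∑ i ∈ Finset.univ.filter fun i => φ i = 1,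
    ((if (z i).left = u then
        ((z i).outcome
          - Real.sigmoid (A (z i).col ⬝ᵥ θ - T₀ (z i).right (z i).col)) • A (z i).col
      else 0)
    + (if (z i).right = u then
        ((1 - (z i).outcome)
          - Real.sigmoid (A (z i).col ⬝ᵥ θ - T₀ (z i).left (z i).col)) • A (z i).col
      else 0))

/-- Recentering: the matrix `(I - d⁻¹ 1 1ᵀ) * Θ`. -/
def recenter {d r : ℕ} (Θ : Matrix (Fin d) (Fin r) ℝ) : Matrix (Fin d) (Fin r) ℝ :=
  ((1 : Matrix (Fin d) (Fin d) ℝ) - (d : ℝ)⁻¹ • Matrix.of fun _ _ => (1 : ℝ)) * Θ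

/-- The column-wise logistic score `S_j(a)`, a vector in `ℝ^r`: a sum over the comparisons of the
third fold in the column `j`, with covariates `Θ U - Θ V`. -/
def colScore {d r n : ℕ} (Θ : Matrix (Fin d) (Fin r) ℝ)
    (φ : Fin n → Fin 3) (z : Fin n → Obs d) (j : Fin d) (a : Fin r → ℝ) : Fin r → ℝ :=
  ∑ i ∈ Finset.univ.filter fun i => φ i = 2 ∧ (z i).col = j,
    ((z i).outcome - Real.sigmoid ((Θ (z i).left - Θ (z i).right) ⬝ᵥ a)) •
      (Θ (z i).left - Θ (z i).right)

/-- `T₁` is an output of the three-split refinement with rank `r` and row-norm radius `ρ`, started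
from the initializer `T₀`. Every choice that the procedure leaves open (the singular vectors, the
solutions of the score equations) is allowed here. -/
def IsRefinement {d n : ℕ} (r : ℕ) (ρ : ℝ) (T₀ : Matrix (Fin d) (Fin d) ℝ)
    (φ : Fin n → Fin 3) (z : Fin n → Obs d) (T₁ : Matrix (Fin d) (Fin d) ℝ) : Prop :=
  ∃ V Θ A : Matrix (Fin d) (Fin r) ℝ,
    IsRightFactor T₀ V ∧
    (∀ u, rowScore (projRows ρ V) T₀ φ z u (Θ u) = 0) ∧
    (∀ j, colScore (recenter Θ) φ z j (A j) = 0) ∧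
    T₁ = recenter Θ * A.transpose

/-! ### Standing assumptions -/

/-- The assumptions on the factors `Θ`, `A` of the signal matrix `T = Θ * Aᵀ`. -/
structure IsSignal {d r : ℕ} (cσ Cσ CA CΘ α : ℝ) (Θ A : Matrix (Fin d) (Fin r) ℝ) : Prop where
  orthonormal : A.transpose * A = 1
  centered : ∀ j, ∑ i, (Θ * A.transpose) i j = 0
  singVal_lower : cσ * d ≤ singVal (Θ * A.transpose) r
  singVal_upper : singVal (Θ * A.transpose) 1 ≤ Cσ * d
  incoherent_right : ∀ j, rowNorm A j ≤ CA / Real.sqrt d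
  incoherent_left : ∀ i, rowNorm Θ i ≤ CΘ * Real.sqrt d
  bounded : ∀ i j, |(Θ * A.transpose) i j| ≤ α

/-- The initializer `T₀` has entries bounded by `C₀` and Frobenius error at most
`Cinit * √(d ^ 3 / n)`. -/
def IsGoodInit {d : ℕ} (C₀ Cinit : ℝ) (n : ℕ) (T T₀ : Matrix (Fin d) (Fin d) ℝ) : Prop :=
  (∀ i j, |T₀ i j| ≤ C₀) ∧ frobNorm (T₀ - T) ≤ Cinit * Real.sqrt ((d : ℝ) ^ 3 / n)

end PairwiseRefinement

end

/-! All errors are measured against the noise level `η = √(d log d / n)`: the good event gives `‖T₀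
- T‖_F = O(d η)` for the initializer `T₀`, and the claim is an entrywise error `O(η)`. Sample
splitting turns the refinement into logistic regressions in dimension `r`: the row problems use
fresh data given the first fold, the column problems use fresh data given the first two.

Alignment. By a Wedin-type argument the leading right singular space of `T₀` is within `O(η)` of the
column space of `A`. Hence the signal has a second factorization `Θ' A'ᵀ`, as incoherent as the
first up to constants, whose right factor is within `O(η)` of the projected singular vectors in
Frobenius norm (`exists_aligned_factors`). All estimates compare with `Θ'` and `A'`. The singular
vectors are unique up to a rotation because of a spectral gap (`IsRightFactor.exists_rotation`), and
the score equations are rotation equivariant, so one choice of them represents all outputs.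

Roots. The logistic score is the gradient of a concave function. If it is small at a reference point
compared with its curvature there, it has exactly one root and that root is nearby
(`exists_score_root`). At the rows of `Θ'` the score is a bias plus a fluctuation. The bias averages
the initializer error over all opponents and columns, so Cauchy-Schwarz bounds it by the Frobenius
error (`abs_mean_rowTerm_le`); this is where a global error bound becomes a bound for each row.
Fluctuations of scores and Gram matrices follow from a Chernoff bound and a union bound
(`wprob_abs_deviation_le`). The result is a row error `O(√d η)` (`row_step`). The column covariates
are then uniformly accurate, and the same scheme gives a column error `O(η / √d)` (`col_step`).
Incoherence makes both contributions to an entry of the product `O(η)`.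

Probability. The sample space is finite, so conditioning on folds is a rearrangement of finite sums
(`wprob_inter_le_of_glue`), carried to the given probability space at the end by
`measureReal_folds_sample_eq`. -/

namespace PairwiseRefinement

/-! ### The Euclidean norm of a coordinate vector -/

/-- The Euclidean norm. -/
noncomputable def l2 {ι : Type*} [Fintype ι] (v : ι → ℝ) : ℝ := Real.sqrt (∑ i, v i ^ 2)

section l2
variable {ι κ : Type*} [Fintype ι] [Fintype κ]

theorem l2_eq_norm (v : ι → ℝ) : l2 v = ‖(WithLp.toLp 2 v : EuclideanSpace ℝ ι)‖ := by
  simp [l2, EuclideanSpace.norm_eq]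

theorem l2_nonneg (v : ι → ℝ) : 0 ≤ l2 v := Real.sqrt_nonneg _

theorem l2_sq (v : ι → ℝ) : l2 v ^ 2 = ∑ i, v i ^ 2 :=
  Real.sq_sqrt (Finset.sum_nonneg fun _ _ => sq_nonneg _)

theorem l2_sq_dot (v : ι → ℝ) : l2 v ^ 2 = v ⬝ᵥ v := by
  rw [l2_sq]; simp [dotProduct, sq]

theorem l2_add_le (v w : ι → ℝ) : l2 (v + w) ≤ l2 v + l2 w := by
  simp only [l2_eq_norm, WithLp.toLp_add]; exact norm_add_le _ _

theorem l2_neg (v : ι → ℝ) : l2 (-v) = l2 v := by simp [l2]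

theorem l2_sub_le (v w : ι → ℝ) : l2 (v - w) ≤ l2 v + l2 w := by
  rw [sub_eq_add_neg, ← l2_neg w]; exact l2_add_le _ _

theorem l2_smul (c : ℝ) (v : ι → ℝ) : l2 (c • v) = |c| * l2 v := by
  simp only [l2_eq_norm, WithLp.toLp_smul, norm_smul, Real.norm_eq_abs]

theorem l2_eq_zero {v : ι → ℝ} : l2 v = 0 ↔ v = 0 := by
  rw [l2_eq_norm, norm_eq_zero]; simp

theorem l2_zero : l2 (0 : ι → ℝ) = 0 := l2_eq_zero.2 rfl

theorem abs_le_l2 (v : ι → ℝ) (i : ι) : |v i| ≤ l2 v := by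
  rw [l2]
  refine Real.le_sqrt_of_sq_le ?_
  rw [sq_abs]
  exact Finset.single_le_sum (f := fun i => v i ^ 2) (fun _ _ => sq_nonneg _) (Finset.mem_univ i)

theorem abs_dotProduct_le (v w : ι → ℝ) : |v ⬝ᵥ w| ≤ l2 v * l2 w := by
  refine abs_le_of_sq_le_sq ?_ (mul_nonneg (l2_nonneg _) (l2_nonneg _)) |> fun h => h
  rw [mul_pow, l2_sq, l2_sq]
  exact Finset.sum_mul_sq_le_sq_mul_sq _ _ _

theorem l2_le_card_mul {v : ι → ℝ} {b : ℝ} (h : ∀ i, |v i| ≤ b) :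
    l2 v ≤ Fintype.card ι * b := by
  have h1 : l2 v ≤ ∑ i, |v i| := by
    refine Real.sqrt_le_iff.2 ⟨Finset.sum_nonneg fun _ _ => abs_nonneg _, ?_⟩
    calc ∑ i, v i ^ 2 = ∑ i, |v i| ^ 2 := by simp
      _ ≤ _ := Finset.sum_sq_le_sq_sum_of_nonneg fun _ _ => abs_nonneg _
  refine h1.trans ((Finset.sum_le_sum fun i _ => h i).trans (by simp))

theorem sum_abs_le_sqrt_card_mul (v : ι → ℝ) :
    ∑ i, |v i| ≤ Real.sqrt (Fintype.card ι) * l2 v := by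
  refine le_of_sq_le_sq ?_ (mul_nonneg (Real.sqrt_nonneg _) (l2_nonneg _))
  rw [mul_pow, Real.sq_sqrt (Nat.cast_nonneg _), l2_sq]
  have := sq_sum_le_card_mul_sum_sq (s := (Finset.univ : Finset ι)) (f := fun i => |v i|)
  simpa using this

/-- A matrix with orthonormal columns acts isometrically. -/
theorem l2_mulVec_of_orthonormal [DecidableEq κ] {B : Matrix ι κ ℝ} (hB : B.transpose * B = 1)
    (x : κ → ℝ) : l2 (B.mulVec x) = l2 x := by
  refine (sq_eq_sq₀ (l2_nonneg _) (l2_nonneg _)).1 ?_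
  rw [l2_sq_dot, l2_sq_dot, Matrix.dotProduct_mulVec, ← Matrix.mulVec_transpose,
    Matrix.mulVec_mulVec, hB, Matrix.one_mulVec]

/-- The squared distance to the span of orthonormal columns. -/
theorem l2_sub_proj_sq [DecidableEq κ] {B : Matrix ι κ ℝ} (hB : B.transpose * B = 1)
    (y : ι → ℝ) :
    l2 (y - B.mulVec (B.transpose.mulVec y)) ^ 2 = l2 y ^ 2 - l2 (B.transpose.mulVec y) ^ 2 := by
  have h1 : y ⬝ᵥ B.mulVec (B.transpose.mulVec y) = l2 (B.transpose.mulVec y) ^ 2 := by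
    rw [l2_sq_dot, Matrix.dotProduct_mulVec, ← Matrix.mulVec_transpose]
  have h2 := l2_sq_dot (B.mulVec (B.transpose.mulVec y))
  rw [l2_mulVec_of_orthonormal hB] at h2
  have h3 := dotProduct_comm (B.mulVec (B.transpose.mulVec y)) y
  rw [l2_sq_dot (y - _), sub_dotProduct, dotProduct_sub, dotProduct_sub, l2_sq_dot y]
  linarith

theorem l2_transpose_mulVec_le [DecidableEq κ] {B : Matrix ι κ ℝ} (hB : B.transpose * B = 1)
    (y : ι → ℝ) : l2 (B.transpose.mulVec y) ≤ l2 y := by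
  refine le_of_sq_le_sq ?_ (l2_nonneg _)
  have := l2_sub_proj_sq hB y
  nlinarith [sq_nonneg (l2 (y - B.mulVec (B.transpose.mulVec y)))]

end l2

/-! ### Frobenius norms through row norms. -/

theorem frobNorm_sq {m k : ℕ} (M : Matrix (Fin m) (Fin k) ℝ) :
    frobNorm M ^ 2 = ∑ i, l2 (M i) ^ 2 := by
  simp only [l2_sq]
  exact Real.sq_sqrt (Finset.sum_nonneg fun _ _ => Finset.sum_nonneg fun _ _ => sq_nonneg _)

theorem frobNorm_nonneg {m k : ℕ} (M : Matrix (Fin m) (Fin k) ℝ) : 0 ≤ frobNorm M :=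
  Real.sqrt_nonneg _

theorem l2_mulVec_le_frobNorm {m k : ℕ} (M : Matrix (Fin m) (Fin k) ℝ) (x : Fin k → ℝ) :
    l2 (M.mulVec x) ≤ frobNorm M * l2 x := by
  refine le_of_sq_le_sq ?_ (mul_nonneg (frobNorm_nonneg _) (l2_nonneg _))
  rw [mul_pow, frobNorm_sq, Finset.sum_mul, l2_sq]
  refine Finset.sum_le_sum fun i _ => ?_
  rw [← mul_pow, ← sq_abs]
  exact pow_le_pow_left₀ (abs_nonneg _) (abs_dotProduct_le _ _) 2

/-! ### The singular value decomposition -/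

/-- Diagonalize the Gram operator. The images of its eigenvectors are orthogonal; those with nonzero
singular value, normalized, extend to an orthonormal basis that supplies the left factor. The shift
`i + 1` converts zero-based indices to the one-based convention of `singVal`. -/
theorem exists_svd {d : ℕ} (M : Matrix (Fin d) (Fin d) ℝ) :
    ∃ W ∈ Matrix.orthogonalGroup (Fin d) ℝ, ∃ V ∈ Matrix.orthogonalGroup (Fin d) ℝ,
      M = W * Matrix.diagonal (fun i : Fin d => singVal M (i + 1)) * V.transpose := by
  set T := Matrix.toEuclideanLin M with hT
  have hn : Module.finrank ℝ (EuclideanSpace ℝ (Fin d)) = d := by simp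
  set b := T.isSymmetric_adjoint_comp_self.eigenvectorBasis hn with hb
  set s : Fin d → ℝ := fun i => singVal M (i + 1) with hs
  have hs' : ∀ i, s i = T.singularValues i := fun i => by simp [hs, singVal, hT]
  have hs2 : ∀ i, s i ^ 2 = T.isSymmetric_adjoint_comp_self.eigenvalues hn i := fun i => by
    rw [hs', T.sq_singularValues_fin hn]
  have hin : ∀ i j, inner ℝ (T (b i)) (T (b j)) = if i = j then s i ^ 2 else 0 := fun i j => by
    rw [← LinearMap.adjoint_inner_right]
    have := T.isSymmetric_adjoint_comp_self.apply_eigenvectorBasis hn j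
    rw [LinearMap.comp_apply] at this
    rw [this, ← hb, inner_smul_right, orthonormal_iff_ite.1 b.orthonormal]
    by_cases h : i = j
    · subst h; simp [hs2]
    · simp [h]
  let S : Set (Fin d) := {i | s i ≠ 0}
  let v : Fin d → EuclideanSpace ℝ (Fin d) := fun i => (s i)⁻¹ • T (b i)
  have hv : Orthonormal ℝ (S.domRestrict v) := by
    rw [orthonormal_iff_ite]
    rintro ⟨i, hi⟩ ⟨j, hj⟩
    have hi' : s i ≠ 0 := hi
    simp only [Set.domRestrict_apply, v, inner_smul_left, inner_smul_right, hin, Subtype.mk.injEq]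
    by_cases h : i = j
    · subst h; simp; field_simp
    · simp [h]
  obtain ⟨c, hc⟩ := hv.exists_orthonormalBasis_extension_of_card_eq (by simp)
  have key : ∀ i, T (b i) = s i • c i := fun i => by
    by_cases h : s i = 0
    · have : inner ℝ (T (b i)) (T (b i)) = 0 := by rw [hin]; simp [h]
      rw [inner_self_eq_zero.1 this, h, zero_smul]
    · rw [hc i h]; simp [v, smul_smul, h]
  let toM : OrthonormalBasis (Fin d) ℝ (EuclideanSpace ℝ (Fin d)) → Matrix (Fin d) (Fin d) ℝ :=
    fun e => Matrix.of fun i j => e j i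
  have hO : ∀ e, toM e ∈ Matrix.orthogonalGroup (Fin d) ℝ := fun e => by
    rw [Matrix.mem_orthogonalGroup_iff']
    ext i j
    have := orthonormal_iff_ite.1 e.orthonormal i j
    simp only [Matrix.mul_apply, toM, Matrix.of_apply, Matrix.one_apply]
    rw [← this]
    simp [PiLp.inner_apply, mul_comm]
  refine ⟨toM c, hO c, toM b, hO b, ?_⟩
  have h1 : M * toM b = toM c * Matrix.diagonal s := by
    ext i j
    have := congrArg (fun x : EuclideanSpace ℝ (Fin d) => x i) (key j)
    simp only [hT, Matrix.toLpLin_apply, PiLp.smul_apply, smul_eq_mul] at this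
    rw [Matrix.mul_diagonal]
    simp only [toM, Matrix.of_apply]
    rw [mul_comm, ← this]
    rfl
  have h2 := (Matrix.mem_orthogonalGroup_iff (Fin d) ℝ).1 (hO b)
  rw [← h1, Matrix.mul_assoc]
  rw [h2, Matrix.mul_one]

theorem singVal_antitone {d : ℕ} (M : Matrix (Fin d) (Fin d) ℝ) : Antitone (singVal M) :=
  fun _ _ h => LinearMap.singularValues_antitone _ (Nat.sub_le_sub_right h 1)

theorem singVal_nonneg {d : ℕ} (M : Matrix (Fin d) (Fin d) ℝ) (k : ℕ) : 0 ≤ singVal M k :=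
  LinearMap.singularValues_nonneg _ _

/-! ### Perturbation of the leading right singular vectors -/

theorem transpose_mul_self_of_mem_orthogonalGroup {d : ℕ} {V : Matrix (Fin d) (Fin d) ℝ}
    (hV : V ∈ Matrix.orthogonalGroup (Fin d) ℝ) : V.transpose * V = 1 :=
  (Matrix.mem_orthogonalGroup_iff' (Fin d) ℝ).1 hV

theorem mul_transpose_self_of_mem_orthogonalGroup {d : ℕ} {V : Matrix (Fin d) (Fin d) ℝ}
    (hV : V ∈ Matrix.orthogonalGroup (Fin d) ℝ) : V * V.transpose = 1 :=
  (Matrix.mem_orthogonalGroup_iff (Fin d) ℝ).1 hV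

theorem sum_l2_sq_transpose {m k : ℕ} (M : Matrix (Fin m) (Fin k) ℝ) :
    ∑ i, l2 (M.transpose i) ^ 2 = ∑ i, l2 (M i) ^ 2 := by
  simp only [l2_sq, Matrix.transpose_apply]
  exact Finset.sum_comm

theorem sum_l2_mulVec_orthogonal_sq {m d : ℕ} (M : Matrix (Fin m) (Fin d) ℝ)
    {V : Matrix (Fin d) (Fin d) ℝ} (hV : V ∈ Matrix.orthogonalGroup (Fin d) ℝ) :
    ∑ k, l2 (M.mulVec (V.transpose k)) ^ 2 = frobNorm M ^ 2 := by
  have h : V.transpose.transpose * V.transpose = 1 := by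
    rw [Matrix.transpose_transpose]; exact mul_transpose_self_of_mem_orthogonalGroup hV
  rw [frobNorm_sq]
  simp_rw [l2_sq (M.mulVec _)]
  rw [Finset.sum_comm]
  refine Finset.sum_congr rfl fun i _ => ?_
  rw [← l2_mulVec_of_orthonormal h (M i), l2_sq]
  refine Finset.sum_congr rfl fun k _ => ?_
  rw [Matrix.mulVec, Matrix.mulVec, dotProduct_comm]

theorem l2_transpose_apply_of_orthonormal {m k : ℕ} {B : Matrix (Fin m) (Fin k) ℝ}
    (hB : B.transpose * B = 1) (i : Fin k) : l2 (B.transpose i) = 1 := by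
  have h : l2 (B.transpose i) ^ 2 = 1 := by
    rw [l2_sq_dot]
    have := congrFun (congrFun hB i) i
    rw [Matrix.mul_apply, Matrix.one_apply_eq] at this
    exact this
  nlinarith [l2_nonneg (B.transpose i)]

section Svd
variable {d r : ℕ} {T₀ W V : Matrix (Fin d) (Fin d) ℝ} {s : Fin d → ℝ}

theorem l2_mulVec_svd_sq (hW : W ∈ Matrix.orthogonalGroup (Fin d) ℝ)
    (hT : T₀ = W * Matrix.diagonal s * V.transpose) (x : Fin d → ℝ) :
    l2 (T₀.mulVec x) ^ 2 = ∑ k, s k ^ 2 * (V.transpose k ⬝ᵥ x) ^ 2 := by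
  rw [hT, Matrix.mul_assoc, ← Matrix.mulVec_mulVec,
    l2_mulVec_of_orthonormal (transpose_mul_self_of_mem_orthogonalGroup hW),
    ← Matrix.mulVec_mulVec, l2_sq]
  refine Finset.sum_congr rfl fun k _ => ?_
  rw [Matrix.mulVec_diagonal, mul_pow]; rfl

theorem dot_columns_of_orthonormal {m k : ℕ} {B : Matrix (Fin m) (Fin k) ℝ}
    (hB : B.transpose * B = 1) (i j : Fin k) :
    B.transpose i ⬝ᵥ B.transpose j = if i = j then 1 else 0 := by
  have := congrFun (congrFun hB i) j
  rw [Matrix.mul_apply, Matrix.one_apply] at this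
  exact this

theorem l2_mulVec_column_svd (hW : W ∈ Matrix.orthogonalGroup (Fin d) ℝ)
    (hV : V ∈ Matrix.orthogonalGroup (Fin d) ℝ) 
    (hT : T₀ = W * Matrix.diagonal s * V.transpose) (k : Fin d) :
    l2 (T₀.mulVec (V.transpose k)) ^ 2 = s k ^ 2 := by
  rw [l2_mulVec_svd_sq hW hT]
  simp [dot_columns_of_orthonormal (transpose_mul_self_of_mem_orthogonalGroup hV)]

/-- The Gram matrix does not depend on the chosen decomposition, so its eigenvectors allow two
singular value decompositions of the same matrix to be compared. -/
theorem gram_mulVec_column_svd (hW : W ∈ Matrix.orthogonalGroup (Fin d) ℝ)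
    (hV : V ∈ Matrix.orthogonalGroup (Fin d) ℝ)
    (hT : T₀ = W * Matrix.diagonal s * V.transpose) (k : Fin d) :
    (T₀.transpose * T₀).mulVec (V.transpose k) = s k ^ 2 • V.transpose k := by
  have hW' := transpose_mul_self_of_mem_orthogonalGroup hW
  have hV' := transpose_mul_self_of_mem_orthogonalGroup hV
  have h : T₀.transpose * T₀ * V = V * Matrix.diagonal (fun k => s k ^ 2) := by
    have : T₀.transpose * T₀ * V = V * (Matrix.diagonal s * (W.transpose * W) *
        Matrix.diagonal s * (V.transpose * V)) := by
      rw [hT]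
      simp only [Matrix.transpose_mul, Matrix.transpose_transpose, Matrix.diagonal_transpose,
        Matrix.mul_assoc]
    rw [this, hW', hV', Matrix.mul_one, Matrix.mul_one, Matrix.diagonal_mul_diagonal]
    simp [sq]
  ext i
  have := congrFun (congrFun h i) k
  rw [Matrix.mul_diagonal, Matrix.mul_apply] at this
  simp only [Pi.smul_apply, smul_eq_mul, Matrix.transpose_apply]
  rw [mul_comm, ← this]; rfl

theorem sum_filter_lt_eq_sum_castLE (h : r ≤ d) (f : Fin d → ℝ) :
    ∑ k with k.val < r, f k = ∑ k : Fin r, f (Fin.castLE h k) := by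
  rw [show (Finset.univ.filter fun k : Fin d => k.val < r) =
    Finset.univ.map (Fin.castLEEmb h) from ?_, Finset.sum_map]
  · rfl
  · ext k
    simp only [Finset.mem_filter, Finset.mem_univ, true_and, Finset.mem_map]
    exact ⟨fun hk => ⟨⟨k, hk⟩, rfl⟩, by rintro ⟨i, rfl⟩; exact i.2⟩

theorem sum_eq_sum_castLE_add (h : r ≤ d) (f : Fin d → ℝ) :
    ∑ k, f k = ∑ k : Fin r, f (Fin.castLE h k) + ∑ k with ¬ k.val < r, f k := by
  rw [← sum_filter_lt_eq_sum_castLE h]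
  exact (Finset.sum_filter_add_sum_filter_not _ _ _).symm

variable {Θ A : Matrix (Fin d) (Fin r) ℝ}

/-- The weights of the right singular vectors in the span of `A` add up to the rank. -/
theorem sum_l2_transpose_mulVec_sq (hA : A.transpose * A = 1)
    (hV : V ∈ Matrix.orthogonalGroup (Fin d) ℝ) :
    ∑ k, l2 (A.transpose.mulVec (V.transpose k)) ^ 2 = r := by
  rw [sum_l2_mulVec_orthogonal_sq _ hV, frobNorm_sq]
  simp [l2_transpose_apply_of_orthonormal hA]

theorem l2_transpose_mulVec_column_le (hA : A.transpose * A = 1)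
    (hV : V ∈ Matrix.orthogonalGroup (Fin d) ℝ) (k : Fin d) :
    l2 (A.transpose.mulVec (V.transpose k)) ^ 2 ≤ 1 := by
  have := l2_transpose_mulVec_le hA (V.transpose k)
  rw [l2_transpose_apply_of_orthonormal (transpose_mul_self_of_mem_orthogonalGroup hV)] at this
  exact pow_le_one₀ (l2_nonneg _) this

/-- The tail of the squared singular values is at most the squared distance to any matrix of
rank at most `r`. -/
theorem sum_tail_sq_le (hr : 1 ≤ r) (h : r ≤ d) (hA : A.transpose * A = 1)
    (hW : W ∈ Matrix.orthogonalGroup (Fin d) ℝ) (hV : V ∈ Matrix.orthogonalGroup (Fin d) ℝ)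
    (hs : Antitone s) (hs0 : ∀ i, 0 ≤ s i) (hT : T₀ = W * Matrix.diagonal s * V.transpose) :
    ∑ k with ¬ k.val < r, s k ^ 2 ≤ frobNorm (T₀ - Θ * A.transpose) ^ 2 := by
  set w : Fin d → ℝ := fun k => l2 (A.transpose.mulVec (V.transpose k)) ^ 2 with hw
  have hw1 : ∀ k, w k ≤ 1 := l2_transpose_mulVec_column_le hA hV
  have hw0 : ∀ k, 0 ≤ w k := fun k => sq_nonneg _
  have hwr : ∑ k, w k = r := sum_l2_transpose_mulVec_sq hA hV
  have h1 : frobNorm T₀ ^ 2 = ∑ k, s k ^ 2 := by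
    rw [← sum_l2_mulVec_orthogonal_sq _ hV]
    exact Finset.sum_congr rfl fun k _ => l2_mulVec_column_svd hW hV hT k
  have h2 : ∑ i, l2 (A.transpose.mulVec (T₀ i)) ^ 2 = ∑ k, s k ^ 2 * w k := by
    calc ∑ i, l2 (A.transpose.mulVec (T₀ i)) ^ 2
        = ∑ l, l2 (T₀.mulVec (A.transpose l)) ^ 2 := by
          simp_rw [l2_sq (Matrix.mulVec _ _)]
          rw [Finset.sum_comm]
          refine Finset.sum_congr rfl fun k _ => Finset.sum_congr rfl fun i _ => ?_
          rw [Matrix.mulVec, Matrix.mulVec, dotProduct_comm]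
      _ = ∑ l, ∑ k, s k ^ 2 * (V.transpose k ⬝ᵥ A.transpose l) ^ 2 :=
          Finset.sum_congr rfl fun l _ => l2_mulVec_svd_sq hW hT _
      _ = _ := by
          rw [Finset.sum_comm]
          refine Finset.sum_congr rfl fun k _ => ?_
          rw [← Finset.mul_sum, hw]
          simp only [l2_sq]
          congr 1
          refine Finset.sum_congr rfl fun l _ => ?_
          rw [Matrix.mulVec, dotProduct_comm]
  -- The left side is the squared Frobenius norm of `T₀ (I - A Aᵀ)`; the projection annihilates `Θ
  -- Aᵀ` and does not increase the norm of the remaining error.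
  have h3 : ∑ k, s k ^ 2 - ∑ k, s k ^ 2 * w k ≤ frobNorm (T₀ - Θ * A.transpose) ^ 2 := by
    rw [← h1, ← h2, frobNorm_sq, frobNorm_sq, ← Finset.sum_sub_distrib]
    refine Finset.sum_le_sum fun i _ => ?_
    have e1 : T₀ i = (T₀ - Θ * A.transpose) i + A.mulVec (Θ i) := by
      have : (Θ * A.transpose) i = A.mulVec (Θ i) := by
        ext j; simp [Matrix.mul_apply, Matrix.mulVec, dotProduct, mul_comm]
      rw [← this]; ext j; simp
    set E := (T₀ - Θ * A.transpose) i
    have e2 : T₀ i - A.mulVec (A.transpose.mulVec (T₀ i)) =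
        E - A.mulVec (A.transpose.mulVec E) := by
      rw [e1, Matrix.mulVec_add, Matrix.mulVec_mulVec _ A.transpose A, hA, Matrix.one_mulVec,
        Matrix.mulVec_add]
      abel
    have e3 := l2_sub_proj_sq hA (T₀ i)
    rw [e2, l2_sub_proj_sq hA] at e3
    nlinarith [sq_nonneg (l2 (A.transpose.mulVec E))]
  -- Bathtub argument: among weights in `[0, 1]` with sum `r`, the weighted sum of the decreasing `s
  -- k ^ 2` is largest when the first `r` weights are one. The threshold is the `r`-th singular
  -- value, with zero-based index `r - 1`.
  let m : Fin d := ⟨r - 1, by omega⟩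
  have h4 : ∑ k with ¬ k.val < r, s k ^ 2 ≤ ∑ k, s k ^ 2 - ∑ k, s k ^ 2 * w k := by
    have e1 : ∑ k : Fin d, (if k.val < r then (1 : ℝ) else 0) = r := by
      rw [← Finset.sum_filter, sum_filter_lt_eq_sum_castLE h]; simp
    have e2 : ∑ k with ¬ k.val < r, s k ^ 2 =
        ∑ k, s k ^ 2 - ∑ k : Fin d, s k ^ 2 * (if k.val < r then (1 : ℝ) else 0) := by
      rw [← Finset.sum_filter_add_sum_filter_not Finset.univ (fun k : Fin d => k.val < r)
        (fun k => s k ^ 2)]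
      simp [Finset.sum_filter]
    have e3 : 0 ≤ ∑ k : Fin d, (s k ^ 2 - s m ^ 2) * ((if k.val < r then (1 : ℝ) else 0) - w k) := by
      refine Finset.sum_nonneg fun k _ => ?_
      by_cases hk : k.val < r
      · rw [if_pos hk]
        have : s m ≤ s k := hs (by rw [Fin.le_def]; simp only [m]; omega)
        exact mul_nonneg (by nlinarith [hs0 m]) (by linarith [hw1 k])
      · rw [if_neg hk]
        have : s k ≤ s m := hs (by rw [Fin.le_def]; simp only [m]; omega)
        exact mul_nonneg_of_nonpos_of_nonpos (by nlinarith [hs0 k]) (by linarith [hw0 k])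
    have e4 : ∑ k : Fin d, (s k ^ 2 - s m ^ 2) * ((if k.val < r then (1 : ℝ) else 0) - w k) =
        (∑ k : Fin d, s k ^ 2 * (if k.val < r then (1 : ℝ) else 0) - ∑ k, s k ^ 2 * w k)
        - s m ^ 2 * (∑ k : Fin d, (if k.val < r then (1 : ℝ) else 0) - ∑ k, w k) := by
      rw [← Finset.sum_sub_distrib, ← Finset.sum_sub_distrib, Finset.mul_sum,
        ← Finset.sum_sub_distrib]
      exact Finset.sum_congr rfl fun k _ => by ring
    rw [e4, e1, hwr] at e3
    rw [e2]; linarith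
  exact h4.trans h3

/-- The singular vectors beyond the rank are nearly orthogonal to the span of `A`. -/
theorem sum_tail_weight_le (hr : 1 ≤ r) (h : r ≤ d) (hA : A.transpose * A = 1)
    (hW : W ∈ Matrix.orthogonalGroup (Fin d) ℝ) (hV : V ∈ Matrix.orthogonalGroup (Fin d) ℝ)
    (hs : Antitone s) (hs0 : ∀ i, 0 ≤ s i) (hT : T₀ = W * Matrix.diagonal s * V.transpose)
    {c ε : ℝ} (hc : 0 < c) (hΘ : ∀ x, c * l2 x ≤ l2 (Θ.mulVec x))
    (hε : 2 * frobNorm (T₀ - Θ * A.transpose) ≤ ε * c) :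
    ∑ k with ¬ k.val < r, l2 (A.transpose.mulVec (V.transpose k)) ^ 2 ≤ ε ^ 2 := by
  set E := T₀ - Θ * A.transpose with hE
  have h1 := sum_tail_sq_le (Θ := Θ) hr h hA hW hV hs hs0 hT
  have h2 : ∑ k with ¬ k.val < r, l2 (E.mulVec (V.transpose k)) ^ 2 ≤ frobNorm E ^ 2 := by
    rw [← sum_l2_mulVec_orthogonal_sq E hV]
    exact Finset.sum_le_sum_of_subset_of_nonneg (Finset.filter_subset _ _)
      fun _ _ _ => sq_nonneg _
  -- Since `Θ Aᵀ v = T₀ v - E v`, the part of a singular vector in the span of `A` costs at least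
  -- `c` times its length, while `T₀ v` and `E v` are both small for the tail vectors. Each of the
  -- two sums over the tail is at most `‖E‖_F ^ 2`.
  have h3 : ∀ k, c ^ 2 * l2 (A.transpose.mulVec (V.transpose k)) ^ 2 ≤
      2 * (s k ^ 2 + l2 (E.mulVec (V.transpose k)) ^ 2) := fun k => by
    have e1 : Θ.mulVec (A.transpose.mulVec (V.transpose k)) =
        T₀.mulVec (V.transpose k) - E.mulVec (V.transpose k) := by
      rw [hE, Matrix.sub_mulVec, ← Matrix.mulVec_mulVec, sub_sub_cancel]
    have e2 := hΘ (A.transpose.mulVec (V.transpose k))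
    rw [e1] at e2
    have e3 := e2.trans (l2_sub_le _ _)
    have e4 := l2_mulVec_column_svd hW hV hT k
    rw [← e4, ← mul_pow]
    calc _ ≤ (l2 (T₀.mulVec (V.transpose k)) + l2 (E.mulVec (V.transpose k))) ^ 2 :=
          pow_le_pow_left₀ (mul_nonneg hc.le (l2_nonneg _)) e3 2
      _ ≤ _ := by nlinarith [sq_nonneg (l2 (T₀.mulVec (V.transpose k)) -
          l2 (E.mulVec (V.transpose k)))]
  have h4 := Finset.sum_le_sum (s := Finset.univ.filter fun k : Fin d => ¬ k.val < r)
    fun k _ => h3 k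
  rw [← Finset.mul_sum, ← Finset.mul_sum, Finset.sum_add_distrib] at h4
  have h5 : (2 * frobNorm E) ^ 2 ≤ (ε * c) ^ 2 :=
    pow_le_pow_left₀ (by linarith [frobNorm_nonneg E]) hε 2
  have h6 : c ^ 2 * ∑ k with ¬ k.val < r, l2 (A.transpose.mulVec (V.transpose k)) ^ 2 ≤
      c ^ 2 * ε ^ 2 := by nlinarith
  exact le_of_mul_le_mul_left h6 (by positivity)

/-- The leading weights are close to one. -/
theorem sum_one_sub_weight_le (hr : 1 ≤ r) (h : r ≤ d) (hA : A.transpose * A = 1)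
    (hW : W ∈ Matrix.orthogonalGroup (Fin d) ℝ) (hV : V ∈ Matrix.orthogonalGroup (Fin d) ℝ)
    (hs : Antitone s) (hs0 : ∀ i, 0 ≤ s i) (hT : T₀ = W * Matrix.diagonal s * V.transpose)
    {c ε : ℝ} (hc : 0 < c) (hΘ : ∀ x, c * l2 x ≤ l2 (Θ.mulVec x))
    (hε : 2 * frobNorm (T₀ - Θ * A.transpose) ≤ ε * c) :
    ∑ k : Fin r, (1 - l2 (A.transpose.mulVec (V.transpose (Fin.castLE h k))) ^ 2) ≤ ε ^ 2 := by
  have h1 := sum_tail_weight_le hr h hA hW hV hs hs0 hT hc hΘ hε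
  have h2 := sum_l2_transpose_mulVec_sq hA hV
  rw [sum_eq_sum_castLE_add h] at h2
  rw [Finset.sum_sub_distrib]
  simp only [Finset.sum_const, Finset.card_univ, Fintype.card_fin, nsmul_eq_mul, mul_one]
  linarith

/-- A leading singular vector has most of its mass in the span of `A`, where `Θ Aᵀ` is bounded
below; subtracting the error `c / 8` leaves at least `c / 4`. A tail singular value is at most the
Frobenius error, since the signal has rank at most `r`. -/
theorem svd_gap (hr : 1 ≤ r) (h : r ≤ d) (hA : A.transpose * A = 1)
    (hW : W ∈ Matrix.orthogonalGroup (Fin d) ℝ) (hV : V ∈ Matrix.orthogonalGroup (Fin d) ℝ)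
    (hs : Antitone s) (hs0 : ∀ i, 0 ≤ s i) (hT : T₀ = W * Matrix.diagonal s * V.transpose)
    {c ε : ℝ} (hc : 0 < c) (hΘ : ∀ x, c * l2 x ≤ l2 (Θ.mulVec x))
    (hε : 2 * frobNorm (T₀ - Θ * A.transpose) ≤ ε * c) (hε4 : ε ≤ 1 / 4) (k : Fin d) :
    (k.val < r → c / 4 ≤ s k) ∧ (¬ k.val < r → s k ≤ c / 8) := by
  set E := T₀ - Θ * A.transpose with hE
  have hE0 : frobNorm E ≤ c / 8 := by nlinarith
  constructor
  · intro hk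
    have h1 := sum_one_sub_weight_le hr h hA hW hV hs hs0 hT hc hΘ hε
    have hw1 := l2_transpose_mulVec_column_le hA hV
    have h2 : 1 - l2 (A.transpose.mulVec (V.transpose k)) ^ 2 ≤ ε ^ 2 :=
      (Finset.single_le_sum
        (f := fun k : Fin r => 1 - l2 (A.transpose.mulVec (V.transpose (Fin.castLE h k))) ^ 2)
        (fun k _ => by linarith [hw1 (Fin.castLE h k)])
        (Finset.mem_univ (⟨k, hk⟩ : Fin r))).trans h1
    have hε0 : 0 ≤ ε := by
      by_contra hneg
      have := frobNorm_nonneg E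
      nlinarith
    have h3 : (1 / 2 : ℝ) ≤ l2 (A.transpose.mulVec (V.transpose k)) := by
      by_contra hneg
      nlinarith [l2_nonneg (A.transpose.mulVec (V.transpose k))]
    have e1 : Θ.mulVec (A.transpose.mulVec (V.transpose k)) =
        T₀.mulVec (V.transpose k) - E.mulVec (V.transpose k) := by
      rw [hE, Matrix.sub_mulVec, ← Matrix.mulVec_mulVec, sub_sub_cancel]
    have e2 := hΘ (A.transpose.mulVec (V.transpose k))
    rw [e1] at e2
    have e3 := e2.trans (l2_sub_le _ _)
    have e4 : l2 (T₀.mulVec (V.transpose k)) = s k :=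
      (sq_eq_sq₀ (l2_nonneg _) (hs0 k)).1 (l2_mulVec_column_svd hW hV hT k)
    have e5 := l2_mulVec_le_frobNorm E (V.transpose k)
    rw [l2_transpose_apply_of_orthonormal (transpose_mul_self_of_mem_orthogonalGroup hV)] at e5
    nlinarith
  · intro hk
    have h1 := sum_tail_sq_le (Θ := Θ) hr h hA hW hV hs hs0 hT
    have h2 : s k ^ 2 ≤ frobNorm E ^ 2 :=
      (Finset.single_le_sum (f := fun k => s k ^ 2) (fun _ _ => sq_nonneg _)
        (Finset.mem_filter.2 ⟨Finset.mem_univ k, hk⟩)).trans h1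
    exact (le_of_sq_le_sq h2 (frobNorm_nonneg _)).trans hE0

end Svd

/-! ### Existence of right factors and their uniqueness up to rotation. -/

theorem exists_isRightFactor {d r : ℕ} (h : r ≤ d) (T₀ : Matrix (Fin d) (Fin d) ℝ) :
    ∃ V : Matrix (Fin d) (Fin r) ℝ, IsRightFactor T₀ V := by
  obtain ⟨W, hW, V, hV, hT⟩ := exists_svd T₀
  refine ⟨Matrix.of fun i k => V i (Fin.castLE h k), W, hW, V, hV, _, ?_, ?_, hT, h,
    fun _ _ => rfl⟩
  · exact fun i j hij => singVal_antitone T₀ (by simpa using hij)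
  · exact fun i => singVal_nonneg _ _

theorem le_of_orthonormal_columns {d r : ℕ} {A : Matrix (Fin d) (Fin r) ℝ}
    (hA : A.transpose * A = 1) : r ≤ d := by
  have hinj : Function.Injective A.mulVecLin := by
    intro x y hxy
    have := congrArg A.transpose.mulVec hxy
    simpa [Matrix.mulVec_mulVec, hA] using this
  simpa using LinearMap.finrank_le_finrank_of_injective hinj

theorem IsRightFactor.orthonormal {d r : ℕ} {T₀ : Matrix (Fin d) (Fin d) ℝ}
    {V : Matrix (Fin d) (Fin r) ℝ} (hV : IsRightFactor T₀ V) : V.transpose * V = 1 := by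
  obtain ⟨W, hW, U, hU, s, hs, hs0, hT, h, hVU⟩ := hV
  ext i j
  have := dot_columns_of_orthonormal (transpose_mul_self_of_mem_orthogonalGroup hU)
    (Fin.castLE h i) (Fin.castLE h j)
  rw [Matrix.mul_apply, Matrix.one_apply]
  simp only [Matrix.transpose_apply, hVU]
  simpa [dotProduct] using this

/-- In the presence of a spectral gap the leading right singular vectors are unique up to a
rotation. -/
theorem IsRightFactor.exists_rotation {d r : ℕ} {T₀ : Matrix (Fin d) (Fin d) ℝ}
    {Θ A V V' : Matrix (Fin d) (Fin r) ℝ} (hr : 1 ≤ r) (hA : A.transpose * A = 1)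
    {c ε : ℝ} (hc : 0 < c) (hΘ : ∀ x, c * l2 x ≤ l2 (Θ.mulVec x))
    (hε : 2 * frobNorm (T₀ - Θ * A.transpose) ≤ ε * c) (hε4 : ε ≤ 1 / 4)
    (hV : IsRightFactor T₀ V) (hV' : IsRightFactor T₀ V') :
    ∃ Q : Matrix (Fin r) (Fin r) ℝ, Q.transpose * Q = 1 ∧ Q * Q.transpose = 1 ∧ V' = V * Q := by
  have ho' := hV'.orthonormal
  obtain ⟨W, hW, U, hU, s, hs, hs0, hT, h, hVU⟩ := hV
  obtain ⟨W', hW', U', hU', s', hs', hs0', hT', h', hVU'⟩ := hV'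
  -- A tail vector of one decomposition and a leading vector of the other are eigenvectors of the
  -- same symmetric Gram matrix. The gap separates their eigenvalues, so they are orthogonal.
  have key : ∀ a b : Fin d, ¬ a.val < r → b.val < r → U.transpose a ⬝ᵥ U'.transpose b = 0 := by
    intro a b ha hb
    have h1 := (svd_gap hr h hA hW hU hs hs0 hT hc hΘ hε hε4 a).2 ha
    have h2 := (svd_gap hr h hA hW' hU' hs' hs0' hT' hc hΘ hε hε4 b).1 hb
    have e1 := gram_mulVec_column_svd hW hU hT a
    have e2 := gram_mulVec_column_svd hW' hU' hT' b
    have e3 : U.transpose a ⬝ᵥ (T₀.transpose * T₀).mulVec (U'.transpose b) =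
        (T₀.transpose * T₀).mulVec (U.transpose a) ⬝ᵥ U'.transpose b := by
      rw [Matrix.dotProduct_mulVec, ← Matrix.mulVec_transpose]
      simp
    rw [e1, e2, dotProduct_smul, smul_dotProduct, smul_eq_mul, smul_eq_mul] at e3
    have h3 : s a ^ 2 < s' b ^ 2 := by nlinarith [hs0 a]
    have h4 : (s' b ^ 2 - s a ^ 2) * (U.transpose a ⬝ᵥ U'.transpose b) = 0 := by linarith
    exact (mul_eq_zero.1 h4).resolve_left (by linarith)
  have hmain : V' = V * (V.transpose * V') := by
    ext i k
    have e1 : V' i k = ∑ a, U i a * (U.transpose a ⬝ᵥ U'.transpose (Fin.castLE h k)) := by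
      have : U' = U * (U.transpose * U') := by
        rw [← Matrix.mul_assoc, mul_transpose_self_of_mem_orthogonalGroup hU, Matrix.one_mul]
      rw [hVU']
      conv_lhs => rw [this]
      rfl
    rw [e1, sum_eq_sum_castLE_add h, Finset.sum_eq_zero (s := Finset.filter _ _), add_zero]
    · rw [Matrix.mul_apply]
      refine Finset.sum_congr rfl fun a _ => ?_
      rw [hVU, Matrix.mul_apply]
      simp [dotProduct, hVU, hVU']
    · intro a ha
      rw [key a _ (Finset.mem_filter.1 ha).2 k.2, mul_zero]
  have hQ : (V.transpose * V').transpose * (V.transpose * V') = 1 := by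
    rw [Matrix.transpose_mul, Matrix.transpose_transpose, Matrix.mul_assoc, ← hmain, ho']
  exact ⟨_, hQ, mul_eq_one_comm.1 hQ, hmain⟩

/-! ### Aligned factors of the signal -/

/-- With `B` the leading right singular vectors, `Θ (Aᵀ B) y = T B y` has length at least `c` times
that of `y`. As `Aᵀ B` is a contraction and is injective by this very bound, hence bijective, every
`x` equals `Aᵀ B y` for some `y` at least as long. -/
theorem mul_l2_le_of_singVal {d r : ℕ} {Θ A : Matrix (Fin d) (Fin r) ℝ} {c : ℝ}
    (hA : A.transpose * A = 1) (hc : 0 < c) (hs : c ≤ singVal (Θ * A.transpose) r)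
    (x : Fin r → ℝ) : c * l2 x ≤ l2 (Θ.mulVec x) := by
  have h : r ≤ d := le_of_orthonormal_columns hA
  obtain ⟨W, hW, V, hV, hT⟩ := exists_svd (Θ * A.transpose)
  set T := Θ * A.transpose
  set s : Fin d → ℝ := fun i => singVal T (i + 1)
  set B : Matrix (Fin d) (Fin r) ℝ := Matrix.of fun i k => V i (Fin.castLE h k) with hB
  have hV' := transpose_mul_self_of_mem_orthogonalGroup hV
  have hBo : B.transpose * B = 1 := by
    ext i j
    have := dot_columns_of_orthonormal hV' (Fin.castLE h i) (Fin.castLE h j)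
    rw [Matrix.mul_apply, Matrix.one_apply]
    simpa [dotProduct, hB] using this
  have hcol : ∀ (k : Fin d) (y : Fin r → ℝ), V.transpose k ⬝ᵥ B.mulVec y =
      ∑ j, (if k = Fin.castLE h j then 1 else 0) * y j := by
    intro k y
    rw [Matrix.dotProduct_mulVec]
    refine Finset.sum_congr rfl fun j _ => ?_
    rw [← dot_columns_of_orthonormal hV' k (Fin.castLE h j)]
    rfl
  have hlow : ∀ y, c * l2 y ≤ l2 (T.mulVec (B.mulVec y)) := by
    intro y
    refine le_of_sq_le_sq ?_ (l2_nonneg _)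
    rw [mul_pow, l2_mulVec_svd_sq hW hT, l2_sq, Finset.mul_sum, sum_eq_sum_castLE_add h]
    refine le_add_of_le_of_nonneg (Finset.sum_le_sum fun k _ => ?_)
      (Finset.sum_nonneg fun _ _ => by positivity)
    have : V.transpose (Fin.castLE h k) ⬝ᵥ B.mulVec y = y k := by
      rw [hcol]; simp [(Fin.castLE_injective h).eq_iff]
    rw [this]
    have h1 : c ≤ s (Fin.castLE h k) := hs.trans (singVal_antitone T (by simp))
    gcongr
  have hG : ∀ y, T.mulVec (B.mulVec y) = Θ.mulVec ((A.transpose * B).mulVec y) := by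
    intro y; simp [T, Matrix.mulVec_mulVec, Matrix.mul_assoc]
  have hle : ∀ y, l2 ((A.transpose * B).mulVec y) ≤ l2 y := by
    intro y
    rw [← Matrix.mulVec_mulVec, ← l2_mulVec_of_orthonormal hBo y]
    exact l2_transpose_mulVec_le hA _
  have hinj : Function.Injective (A.transpose * B).mulVec := by
    intro y z hyz
    have h1 : (A.transpose * B).mulVec (y - z) = 0 := by rw [Matrix.mulVec_sub, hyz, sub_self]
    have h2 := hlow (y - z)
    rw [hG, h1, Matrix.mulVec_zero, l2_zero] at h2
    have h3 : l2 (y - z) = 0 := le_antisymm (by nlinarith) (l2_nonneg _)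
    exact sub_eq_zero.1 (l2_eq_zero.1 h3)
  obtain ⟨y, rfl⟩ := (Matrix.mulVec_surjective_iff_isUnit.2
    (Matrix.mulVec_injective_iff_isUnit.1 hinj)) x
  rw [← hG]
  exact (mul_le_mul_of_nonneg_left (hle y) hc.le).trans (hlow y)

theorem sum_col_eq_zero_of_centered {d r : ℕ} {Θ A : Matrix (Fin d) (Fin r) ℝ}
    (hA : A.transpose * A = 1) (h : ∀ j, ∑ i, (Θ * A.transpose) i j = 0) (k : Fin r) :
    ∑ i, Θ i k = 0 := by
  have e : Θ = Θ * A.transpose * A := by rw [Matrix.mul_assoc, hA, Matrix.mul_one]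
  rw [e]
  simp_rw [Matrix.mul_apply (M := Θ * A.transpose)]
  rw [Finset.sum_comm]
  simp_rw [← Finset.sum_mul, h, zero_mul, Finset.sum_const_zero]

theorem projRows_row {d r : ℕ} (ρ : ℝ) (A : Matrix (Fin d) (Fin r) ℝ) (i : Fin d) :
    projRows ρ A i = (if l2 (A i) ≤ ρ then 1 else ρ / l2 (A i)) • A i := by
  ext k
  change (if l2 (A i) ≤ ρ then A i k else ρ / l2 (A i) * A i k) = _
  rw [Pi.smul_apply, smul_eq_mul]
  split_ifs <;> simp

theorem l2_projRows_le {d r : ℕ} {ρ : ℝ} (hρ : 0 ≤ ρ) (A : Matrix (Fin d) (Fin r) ℝ)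
    (i : Fin d) : l2 (projRows ρ A i) ≤ ρ := by
  rw [projRows_row, l2_smul]
  split_ifs with h
  · simpa using h
  · have h1 : 0 < l2 (A i) := hρ.trans_lt (not_le.1 h)
    rw [abs_of_nonneg (by positivity)]
    field_simp; rfl

/-- The projection onto a ball does not increase the distance to the points of the ball. -/
theorem l2_projRows_sub_le {d r : ℕ} {ρ : ℝ} (A : Matrix (Fin d) (Fin r) ℝ)
    (i : Fin d) (b : Fin r → ℝ) (hb : l2 b ≤ ρ) : l2 (projRows ρ A i - b) ≤ l2 (A i - b) := by
  rw [projRows_row]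
  split_ifs with h
  · simp
  · have hρ : 0 ≤ ρ := (l2_nonneg b).trans hb
    have h1 : ρ < l2 (A i) := not_le.1 h
    have h0 : 0 < l2 (A i) := hρ.trans_lt h1
    set v := A i
    set t := ρ / l2 v with ht
    have ht0 : 0 ≤ t := by positivity
    have ht1 : t < 1 := (div_lt_one h0).2 h1
    have htv : t * l2 v = ρ := by rw [ht]; field_simp
    refine le_of_sq_le_sq ?_ (l2_nonneg _)
    have e1 : l2 (t • v - b) ^ 2 = t ^ 2 * l2 v ^ 2 - 2 * t * (v ⬝ᵥ b) + l2 b ^ 2 := by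
      rw [l2_sq_dot, l2_sq_dot, l2_sq_dot]
      simp only [sub_dotProduct, dotProduct_sub, smul_dotProduct, dotProduct_smul, smul_eq_mul]
      rw [dotProduct_comm b v]; ring
    have e2 : l2 (v - b) ^ 2 = l2 v ^ 2 - 2 * (v ⬝ᵥ b) + l2 b ^ 2 := by
      rw [l2_sq_dot, l2_sq_dot, l2_sq_dot]
      simp only [sub_dotProduct, dotProduct_sub]
      rw [dotProduct_comm b v]; ring
    rw [e1, e2]
    -- The difference of the two squared distances is `(1 - t) ((1 + t) ‖v‖² - 2 ⟨v, b⟩)`. Here `⟨v,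
    -- b⟩ ≤ ρ ‖v‖ = t ‖v‖²` and `2 t ≤ 1 + t`.
    have h2 : v ⬝ᵥ b ≤ l2 v * ρ := (le_abs_self _).trans
      ((abs_dotProduct_le _ _).trans (mul_le_mul_of_nonneg_left hb h0.le))
    have h3 : 2 * (v ⬝ᵥ b) ≤ (1 + t) * l2 v ^ 2 := by nlinarith
    nlinarith

theorem l2_vecMul_rotation {r : ℕ} {Q : Matrix (Fin r) (Fin r) ℝ} (hQ : Q * Q.transpose = 1)
    (v : Fin r → ℝ) : l2 (Q.transpose.mulVec v) = l2 v :=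
  l2_mulVec_of_orthonormal (by rw [Matrix.transpose_transpose, hQ]) v

theorem mul_row {d r k : ℕ} (V : Matrix (Fin d) (Fin r) ℝ) (Q : Matrix (Fin r) (Fin k) ℝ)
    (i : Fin d) : (V * Q) i = Q.transpose.mulVec (V i) := by
  ext j; simp [Matrix.mul_apply, Matrix.mulVec, dotProduct, mul_comm]

theorem projRows_mul_rotation {d r : ℕ} (ρ : ℝ) {Q : Matrix (Fin r) (Fin r) ℝ}
    (hQ : Q * Q.transpose = 1) (V : Matrix (Fin d) (Fin r) ℝ) :
    projRows ρ (V * Q) = projRows ρ V * Q := by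
  ext i k
  have := congrFun (projRows_row ρ (V * Q) i) k
  rw [this, mul_row, l2_vecMul_rotation hQ, mul_row, projRows_row, Matrix.mulVec_smul]

/-- The signal has factors that are close to the projected leading right singular vectors of any
matrix near the signal. -/
theorem exists_aligned_factors {d r : ℕ} {T₀ : Matrix (Fin d) (Fin d) ℝ}
    {Θ A V : Matrix (Fin d) (Fin r) ℝ} (hr : 1 ≤ r) (hA : A.transpose * A = 1)
    {c ε ρ γ : ℝ} (hc : 0 < c) (hΘ : ∀ x, c * l2 x ≤ l2 (Θ.mulVec x))
    (hε : 2 * frobNorm (T₀ - Θ * A.transpose) ≤ ε * c) (hε4 : ε ≤ 1 / 4)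
    (hV : IsRightFactor T₀ V) (hAρ : ∀ j, l2 (A j) ≤ ρ) (hγ : ∀ i, l2 (Θ i) ≤ γ)
    (hcent : ∀ k, ∑ i, Θ i k = 0) :
    ∃ Θ' A' : Matrix (Fin d) (Fin r) ℝ, Θ' * A'.transpose = Θ * A.transpose ∧
      (∀ j, l2 (A' j) ≤ ρ) ∧ (∀ i, l2 (Θ' i) ≤ 2 * γ) ∧
      (∀ x, c * l2 x ≤ l2 (Θ'.mulVec x)) ∧ (∀ k, ∑ i, Θ' i k = 0) ∧
      ∑ j, l2 (projRows ρ V j - A' j) ^ 2 ≤ ε ^ 2 ∧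
      ∀ x, 1 / 2 * l2 x ≤ l2 ((projRows ρ V).mulVec x) := by
  have hVo := hV.orthonormal
  have hε0 : 0 ≤ ε := by
    by_contra hneg
    have := frobNorm_nonneg (T₀ - Θ * A.transpose)
    nlinarith
  set H := A.transpose * V with hH
  have hdist : ∑ j, l2 ((V - A * H) j) ^ 2 ≤ ε ^ 2 := by
    obtain ⟨W, hW, U, hU, s, hs, hs0, hT, h, hVU⟩ := hV
    refine le_trans (le_of_eq ?_) (sum_one_sub_weight_le hr h hA hW hU hs hs0 hT hc hΘ hε)
    rw [← sum_l2_sq_transpose]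
    refine Finset.sum_congr rfl fun k _ => ?_
    have e1 : V.transpose k = U.transpose (Fin.castLE h k) := by
      ext i; simp [hVU]
    have e2 : (V - A * H).transpose k =
        V.transpose k - A.mulVec (A.transpose.mulVec (V.transpose k)) := by
      rw [Matrix.mulVec_mulVec]
      ext i
      simp only [Matrix.transpose_apply, Matrix.sub_apply, Pi.sub_apply, hH, ← Matrix.mul_assoc]
      rfl
    rw [e2, l2_sub_proj_sq hA, e1,
      l2_transpose_apply_of_orthonormal (transpose_mul_self_of_mem_orthogonalGroup hU)]
    simp
  have hop : ∀ (M : Matrix (Fin d) (Fin r) ℝ), ∑ j, l2 (M j) ^ 2 ≤ ε ^ 2 →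
      ∀ x, l2 (M.mulVec x) ≤ ε * l2 x := by
    intro M hM x
    refine (l2_mulVec_le_frobNorm M x).trans (mul_le_mul_of_nonneg_right ?_ (l2_nonneg _))
    rw [← frobNorm_sq] at hM
    exact le_of_sq_le_sq hM hε0
  have hHlow : ∀ x, (1 - ε) * l2 x ≤ l2 (H.mulVec x) := by
    intro x
    have e1 := hop _ hdist x
    rw [Matrix.sub_mulVec] at e1
    have e2 := l2_add_le (V.mulVec x - (A * H).mulVec x) ((A * H).mulVec x)
    rw [sub_add_cancel, l2_mulVec_of_orthonormal hVo, ← Matrix.mulVec_mulVec,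
      l2_mulVec_of_orthonormal hA, Matrix.mulVec_mulVec] at e2
    linarith
  have hHT : ∀ y, l2 (H.transpose.mulVec y) ≤ l2 y := by
    intro y
    rw [hH, Matrix.transpose_mul, Matrix.transpose_transpose, ← Matrix.mulVec_mulVec]
    exact (l2_transpose_mulVec_le hVo _).trans (l2_mulVec_of_orthonormal hA y).le
  have hinj : Function.Injective H.mulVec := by
    intro y z hyz
    have h1 : H.mulVec (y - z) = 0 := by rw [Matrix.mulVec_sub, hyz, sub_self]
    have h2 := hHlow (y - z)
    rw [h1, l2_zero] at h2
    have h3 : l2 (y - z) = 0 := le_antisymm (by nlinarith [l2_nonneg (y - z)]) (l2_nonneg _)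
    exact sub_eq_zero.1 (l2_eq_zero.1 h3)
  have hu : IsUnit H.det := (Matrix.isUnit_iff_isUnit_det _).1
    (Matrix.mulVec_injective_iff_isUnit.1 hinj)
  have hHH : H * H⁻¹ = 1 := Matrix.mul_nonsing_inv _ hu
  have hHH' : H⁻¹ * H = 1 := Matrix.nonsing_inv_mul _ hu
  have hproj : ∑ j, l2 ((projRows ρ V - A * H) j) ^ 2 ≤ ε ^ 2 := by
    refine le_trans (Finset.sum_le_sum fun j _ => ?_) hdist
    refine pow_le_pow_left₀ (l2_nonneg _) ?_ 2
    refine l2_projRows_sub_le V j _ ?_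
    rw [mul_row]
    exact (hHT _).trans (hAρ j)
  refine ⟨Θ * H⁻¹.transpose, A * H, ?_, ?_, ?_, ?_, ?_, hproj, ?_⟩
  · rw [Matrix.transpose_mul, Matrix.mul_assoc, ← Matrix.mul_assoc H⁻¹.transpose,
      ← Matrix.transpose_mul, hHH, Matrix.transpose_one, Matrix.one_mul]
  · intro j
    rw [mul_row]
    exact (hHT _).trans (hAρ j)
  · intro i
    rw [mul_row, Matrix.transpose_transpose]
    have e1 := hHlow (H⁻¹.mulVec (Θ i))
    rw [Matrix.mulVec_mulVec, hHH, Matrix.one_mulVec] at e1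
    nlinarith [hγ i, l2_nonneg (H⁻¹.mulVec (Θ i))]
  · intro x
    rw [← Matrix.mulVec_mulVec]
    refine le_trans ?_ (hΘ _)
    have e1 := hHT (H⁻¹.transpose.mulVec x)
    rw [Matrix.mulVec_mulVec, ← Matrix.transpose_mul, hHH', Matrix.transpose_one,
      Matrix.one_mulVec] at e1
    exact mul_le_mul_of_nonneg_left e1 hc.le
  · intro k
    simp_rw [Matrix.mul_apply]
    rw [Finset.sum_comm]
    simp_rw [← Finset.sum_mul, hcent, zero_mul, Finset.sum_const_zero]
  · intro x
    have e1 := hop _ hproj x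
    rw [Matrix.sub_mulVec] at e1
    have e2 := l2_sub_le ((projRows ρ V).mulVec x)
      ((projRows ρ V).mulVec x - (A * H).mulVec x)
    rw [sub_sub_cancel, ← Matrix.mulVec_mulVec, l2_mulVec_of_orthonormal hA,
      Matrix.mulVec_mulVec] at e2
    have e3 := hHlow x
    nlinarith [l2_nonneg x]

/-! ### Rotation equivariance of the procedure -/

/-- Scores see their arguments only through inner products, which a simultaneous rotation preserves;
only the outer covariate is rotated. Roots for one choice of singular vectors thus correspond to
roots for another. -/
theorem rowScore_mul_rotation {d r n : ℕ} {Q : Matrix (Fin r) (Fin r) ℝ}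
    (hQ : Q * Q.transpose = 1) (A : Matrix (Fin d) (Fin r) ℝ) (T₀ : Matrix (Fin d) (Fin d) ℝ)
    (φ : Fin n → Fin 3) (z : Fin n → Obs d) (u : Fin d) (θ : Fin r → ℝ) :
    rowScore (A * Q) T₀ φ z u (Q.transpose.mulVec θ) =
      Q.transpose.mulVec (rowScore A T₀ φ z u θ) := by
  have hdot : ∀ j, (A * Q) j ⬝ᵥ Q.transpose.mulVec θ = A j ⬝ᵥ θ := by
    intro j
    rw [mul_row, Matrix.dotProduct_mulVec, ← Matrix.mulVec_transpose, Matrix.mulVec_mulVec,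
      Matrix.transpose_transpose, hQ, Matrix.one_mulVec]
  simp only [rowScore, Matrix.mulVec_sum, hdot]
  refine Finset.sum_congr rfl fun i _ => ?_
  rw [Matrix.mulVec_add]
  congr 1 <;> split_ifs <;> simp [mul_row, Matrix.mulVec_smul]

theorem recenter_mul {d r k : ℕ} (Θ : Matrix (Fin d) (Fin r) ℝ) (Q : Matrix (Fin r) (Fin k) ℝ) :
    recenter (Θ * Q) = recenter Θ * Q := by
  simp only [recenter, Matrix.mul_assoc]

theorem colScore_mul_rotation {d r n : ℕ} {Q : Matrix (Fin r) (Fin r) ℝ}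
    (hQ : Q * Q.transpose = 1) (Θ : Matrix (Fin d) (Fin r) ℝ)
    (φ : Fin n → Fin 3) (z : Fin n → Obs d) (j : Fin d) (a : Fin r → ℝ) :
    colScore (Θ * Q) φ z j (Q.transpose.mulVec a) =
      Q.transpose.mulVec (colScore Θ φ z j a) := by
  have hsub : ∀ i k, (Θ * Q) i - (Θ * Q) k = Q.transpose.mulVec (Θ i - Θ k) := by
    intro i k; rw [mul_row, mul_row, Matrix.mulVec_sub]
  have hdot : ∀ v, Q.transpose.mulVec v ⬝ᵥ Q.transpose.mulVec a = v ⬝ᵥ a := by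
    intro v
    rw [Matrix.dotProduct_mulVec, ← Matrix.mulVec_transpose, Matrix.mulVec_mulVec,
      Matrix.transpose_transpose, hQ, Matrix.one_mulVec]
  simp only [colScore, Matrix.mulVec_sum, hsub, hdot, Matrix.mulVec_smul]

/-- An output of the procedure can be computed from any other choice of singular vectors that
spans the same space. -/
theorem IsRefinement.exists_of_rotation {d n r : ℕ} {ρ : ℝ} {T₀ : Matrix (Fin d) (Fin d) ℝ}
    {φ : Fin n → Fin 3} {z : Fin n → Obs d} {T₁ : Matrix (Fin d) (Fin d) ℝ}
    {V : Matrix (Fin d) (Fin r) ℝ}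
    (hV : ∀ V' : Matrix (Fin d) (Fin r) ℝ, IsRightFactor T₀ V' → ∃ Q : Matrix (Fin r) (Fin r) ℝ,
      Q.transpose * Q = 1 ∧ Q * Q.transpose = 1 ∧ V = V' * Q)
    (h : IsRefinement r ρ T₀ φ z T₁) :
    ∃ Θ A : Matrix (Fin d) (Fin r) ℝ,
      (∀ u, rowScore (projRows ρ V) T₀ φ z u (Θ u) = 0) ∧
      (∀ j, colScore (recenter Θ) φ z j (A j) = 0) ∧ T₁ = recenter Θ * A.transpose := by
  obtain ⟨V', Θ, A, hV', hΘ, hA, hT⟩ := h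
  obtain ⟨Q, -, hQ, rfl⟩ := hV V' hV'
  refine ⟨Θ * Q, A * Q, fun u => ?_, fun j => ?_, ?_⟩
  · rw [projRows_mul_rotation ρ hQ, mul_row, rowScore_mul_rotation hQ, hΘ, Matrix.mulVec_zero]
  · rw [recenter_mul, mul_row A, colScore_mul_rotation hQ, hA, Matrix.mulVec_zero]
  · rw [recenter_mul, Matrix.transpose_mul, Matrix.mul_assoc, ← Matrix.mul_assoc Q, hQ,
      Matrix.one_mul, hT]

/-! ### Roots of logistic score equations -/

theorem abs_sigmoid_sub_le (a b : ℝ) : |Real.sigmoid a - Real.sigmoid b| ≤ |a - b| := by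
  have h := Convex.norm_image_sub_le_of_norm_deriv_le (f := Real.sigmoid) (C := 1)
    (s := Set.univ) (x := b) (y := a) (fun x _ => differentiableAt_sigmoid)
    (fun x _ => by
      rw [Real.deriv_sigmoid, Real.norm_eq_abs, abs_le]
      have h1 := Real.sigmoid_pos x
      have h2 := Real.sigmoid_lt_one x
      constructor <;> nlinarith) convex_univ (Set.mem_univ _) (Set.mem_univ _)
  simpa using h

/-- A lower bound for the slopes of the logistic function on a bounded interval. -/
theorem sigmoid_slope_lower {R a b : ℝ} (ha : |a| ≤ R) (hb : |b| ≤ R) :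
    Real.sigmoid (-R) ^ 2 * (b - a) ^ 2 ≤ (Real.sigmoid b - Real.sigmoid a) * (b - a) := by
  wlog hab : a < b generalizing a b
  · rcases eq_or_lt_of_le (not_lt.1 hab) with h | h
    · subst h; simp
    · have := this hb ha h
      nlinarith
  obtain ⟨ξ, hξ, he⟩ := exists_deriv_eq_slope Real.sigmoid hab
    (continuous_sigmoid.continuousOn) (differentiable_sigmoid.differentiableOn)
  rw [Real.deriv_sigmoid] at he
  have hba : 0 < b - a := sub_pos.2 hab
  rw [eq_div_iff hba.ne'] at he
  have h1 : Real.sigmoid (-R) ≤ Real.sigmoid ξ :=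
    Real.sigmoid_le (by linarith [(abs_le.1 ha).1, hξ.1])
  have h2 : Real.sigmoid (-R) ≤ 1 - Real.sigmoid ξ := by
    rw [← Real.sigmoid_neg]
    exact Real.sigmoid_le (by linarith [(abs_le.1 hb).2, hξ.2])
  have h0 := Real.sigmoid_pos (-R)
  have h3 : Real.sigmoid (-R) ^ 2 ≤ Real.sigmoid ξ * (1 - Real.sigmoid ξ) := by nlinarith
  rw [← he]
  nlinarith [mul_le_mul_of_nonneg_right h3 (sq_nonneg (b - a))]

theorem hasDerivAt_log_one_add_exp (x : ℝ) :
    HasDerivAt (fun x => Real.log (1 + Real.exp x)) (Real.sigmoid x) x := by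
  have h := ((Real.hasDerivAt_exp x).const_add 1).log (by positivity)
  convert h using 1
  rw [Real.sigmoid_def, Real.exp_neg]
  have := Real.exp_pos x
  field_simp
  ring

theorem nonpos_of_hasDerivAt_of_eventually_le {f : ℝ → ℝ} {c : ℝ} (hf : HasDerivAt f c 0)
    (h : ∀ᶠ t in nhdsWithin (0 : ℝ) (Set.Ioi 0), f t ≤ f 0) : c ≤ 0 := by
  have h1 := (hasDerivAt_iff_tendsto_slope.1 hf).mono_left
    (nhdsWithin_mono 0 (fun t (ht : 0 < t) => ht.ne') : nhdsWithin (0:ℝ) (Set.Ioi 0) ≤ _)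
  refine le_of_tendsto h1 ?_
  filter_upwards [h, self_mem_nhdsWithin] with t ht ht0
  have ht0 : 0 < t := ht0
  rw [slope_def_field, sub_zero]
  exact div_nonpos_of_nonpos_of_nonneg (by linarith) ht0.le

theorem continuous_l2 {ι : Type*} [Fintype ι] : Continuous (l2 : (ι → ℝ) → ℝ) := by
  unfold l2; fun_prop

theorem isCompact_l2_ball {ι : Type*} [Fintype ι] (c : ι → ℝ) (δ : ℝ) :
    IsCompact {θ : ι → ℝ | l2 (θ - c) ≤ δ} := by
  refine Metric.isCompact_of_isClosed_isBounded
    (isClosed_le (continuous_l2.comp (continuous_id.sub continuous_const)) continuous_const) ?_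
  refine (Metric.isBounded_closedBall (x := c) (r := δ)).subset fun θ hθ => ?_
  have hθ : l2 (θ - c) ≤ δ := hθ
  rw [Metric.mem_closedBall, dist_pi_le_iff ((l2_nonneg _).trans hθ)]
  exact fun i => (abs_le_l2 (θ - c) i).trans hθ

/-- The logistic score with covariates `x`, outcomes `y` and offsets `o`. -/
noncomputable def score {ι : Type*} [Fintype ι] {r : ℕ} (x : ι → Fin r → ℝ) (y o : ι → ℝ)
    (θ : Fin r → ℝ) : Fin r → ℝ :=
  ∑ i, (y i - Real.sigmoid (x i ⬝ᵥ θ - o i)) • x i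

section Score
variable {ι : Type*} [Fintype ι] {r : ℕ} (x : ι → Fin r → ℝ) (y o : ι → ℝ)

theorem score_dotProduct (θ v : Fin r → ℝ) :
    score x y o θ ⬝ᵥ v = ∑ i, (y i - Real.sigmoid (x i ⬝ᵥ θ - o i)) * (x i ⬝ᵥ v) := by
  simp [score, sum_dotProduct, smul_dotProduct]

/-- The function is the log-likelihood up to the terms `- y i * o i`, which do not depend on `θ`.
Directional derivatives suffice for the argument with a constrained maximizer. -/
theorem hasDerivAt_logLikelihood (θ v : Fin r → ℝ) :
    HasDerivAt (fun t : ℝ => ∑ i, (y i * (x i ⬝ᵥ (θ + t • v)) -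
      Real.log (1 + Real.exp (x i ⬝ᵥ (θ + t • v) - o i)))) (score x y o θ ⬝ᵥ v) 0 := by
  rw [score_dotProduct]
  refine HasDerivAt.fun_sum fun i _ => ?_
  have h1 : HasDerivAt (fun t : ℝ => x i ⬝ᵥ (θ + t • v)) (x i ⬝ᵥ v) 0 := by
    simp only [dotProduct_add, dotProduct_smul, smul_eq_mul]
    simpa using ((hasDerivAt_id (0 : ℝ)).mul_const (x i ⬝ᵥ v)).const_add (x i ⬝ᵥ θ)
  have h2 := hasDerivAt_log_one_add_exp (x i ⬝ᵥ (θ + (0 : ℝ) • v) - o i)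
  have h3 := HasDerivAt.comp (0 : ℝ) h2 (h1.sub_const (o i))
  have h4 := (h1.const_mul (y i)).sub h3
  rw [zero_smul, add_zero] at h4
  exact h4.congr_deriv (sub_mul _ _ _).symm

/-- In the ball of radius `δ` the linear predictors stay within `M + 1`, so the logistic slopes are
at least `σ(-(M + 1))²` and the score decreases along a vector `v` by at least this constant times
`κ ‖v‖²`. On the sphere this beats the initial score, which points the score inward and forces the
maximizer of the likelihood on the ball to be interior. -/
theorem exists_score_root {θ₀ : Fin r → ℝ} {M κ δ : ℝ} (hδ : 0 < δ)
    (hM : ∀ i, |x i ⬝ᵥ θ₀ - o i| ≤ M) (hx : ∀ i, l2 (x i) * δ ≤ 1) (hκ : 0 < κ)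
    (hgram : ∀ v, κ * l2 v ^ 2 ≤ ∑ i, (x i ⬝ᵥ v) ^ 2)
    (hs : l2 (score x y o θ₀) < Real.sigmoid (-(M + 1)) ^ 2 * κ * δ) :
    ∃ θ, score x y o θ = 0 ∧ (∀ θ', score x y o θ' = 0 → θ' = θ) ∧ l2 (θ - θ₀) ≤ δ := by
  set m := Real.sigmoid (-(M + 1)) ^ 2 with hm
  have hbd : ∀ v, l2 v = δ → score x y o (θ₀ + v) ⬝ᵥ v < 0 := by
    intro v hv
    have h1 : score x y o (θ₀ + v) ⬝ᵥ v ≤ score x y o θ₀ ⬝ᵥ v - m * ∑ i, (x i ⬝ᵥ v) ^ 2 := by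
      rw [score_dotProduct, score_dotProduct, Finset.mul_sum, ← Finset.sum_sub_distrib]
      refine Finset.sum_le_sum fun i _ => ?_
      have hv1 : |x i ⬝ᵥ v| ≤ 1 := (abs_dotProduct_le _ _).trans (by rw [hv]; exact hx i)
      have h2 := sigmoid_slope_lower (R := M + 1) (a := x i ⬝ᵥ θ₀ - o i)
        (b := x i ⬝ᵥ (θ₀ + v) - o i) (by linarith [hM i]) (by
          rw [dotProduct_add, show x i ⬝ᵥ θ₀ + x i ⬝ᵥ v - o i =
            (x i ⬝ᵥ θ₀ - o i) + x i ⬝ᵥ v by ring]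
          exact (abs_add_le _ _).trans (by linarith [hM i]))
      have h3 : x i ⬝ᵥ (θ₀ + v) - o i - (x i ⬝ᵥ θ₀ - o i) = x i ⬝ᵥ v := by
        rw [dotProduct_add]; ring
      rw [h3] at h2
      linarith
    have h4 : score x y o θ₀ ⬝ᵥ v ≤ l2 (score x y o θ₀) * δ := by
      rw [← hv]; exact (le_abs_self _).trans (abs_dotProduct_le _ _)
    have h5 := hgram v
    rw [hv] at h5
    have h6 := mul_le_mul_of_nonneg_left h5 (sq_nonneg (Real.sigmoid (-(M + 1))))
    have h7 := mul_lt_mul_of_pos_right hs hδ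
    nlinarith
  -- Uniqueness is global, not only in the ball. For two roots the monotonicity terms sum to zero,
  -- so each vanishes; slopes are positive at any predictors, so all covariates are orthogonal to
  -- `θ' - θ`, and the Gram bound makes it zero.
  have huniq : ∀ θ θ', score x y o θ = 0 → score x y o θ' = 0 → θ' = θ := by
    intro θ θ' h h'
    have h1 : (score x y o θ' - score x y o θ) ⬝ᵥ (θ' - θ) = 0 := by rw [h, h']; simp
    rw [sub_dotProduct, score_dotProduct, score_dotProduct, ← Finset.sum_sub_distrib] at h1
    have h2 : ∀ i, 0 ≤ -((y i - Real.sigmoid (x i ⬝ᵥ θ' - o i)) * (x i ⬝ᵥ (θ' - θ)) -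
        (y i - Real.sigmoid (x i ⬝ᵥ θ - o i)) * (x i ⬝ᵥ (θ' - θ))) ∧
        (-((y i - Real.sigmoid (x i ⬝ᵥ θ' - o i)) * (x i ⬝ᵥ (θ' - θ)) -
        (y i - Real.sigmoid (x i ⬝ᵥ θ - o i)) * (x i ⬝ᵥ (θ' - θ))) = 0 → x i ⬝ᵥ (θ' - θ) = 0) := by
      intro i
      have e : x i ⬝ᵥ (θ' - θ) = (x i ⬝ᵥ θ' - o i) - (x i ⬝ᵥ θ - o i) := by
        rw [dotProduct_sub]; ring
      have h3 := sigmoid_slope_lower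
        (R := max |x i ⬝ᵥ θ' - o i| |x i ⬝ᵥ θ - o i|) (le_max_right _ _) (le_max_left _ _)
      rw [← e] at h3
      have hp : 0 < Real.sigmoid (-max |x i ⬝ᵥ θ' - o i| |x i ⬝ᵥ θ - o i|) ^ 2 :=
        pow_pos (Real.sigmoid_pos _) 2
      have h4 := mul_nonneg hp.le (sq_nonneg (x i ⬝ᵥ (θ' - θ)))
      refine ⟨by linarith, fun h0 => ?_⟩
      have h5 : Real.sigmoid (-max |x i ⬝ᵥ θ' - o i| |x i ⬝ᵥ θ - o i|) ^ 2 *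
          (x i ⬝ᵥ (θ' - θ)) ^ 2 = 0 := by linarith
      exact pow_eq_zero_iff two_ne_zero |>.1 ((mul_eq_zero.1 h5).resolve_left hp.ne')
    have h3 := (Finset.sum_eq_zero_iff_of_nonneg (s := Finset.univ) fun i _ => (h2 i).1).1
      (by rw [Finset.sum_neg_distrib, h1, neg_zero])
    have h4 := hgram (θ' - θ)
    rw [Finset.sum_eq_zero fun i hi => by rw [(h2 i).2 (h3 i hi), zero_pow two_ne_zero]] at h4
    have h5 : l2 (θ' - θ) ^ 2 = 0 :=
      le_antisymm (nonpos_of_mul_nonpos_right h4 hκ) (sq_nonneg _)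
    exact sub_eq_zero.1 (l2_eq_zero.1 (pow_eq_zero_iff two_ne_zero |>.1 h5))
  obtain ⟨θ, hθ, hmax⟩ := (isCompact_l2_ball θ₀ δ).exists_isMaxOn
    ⟨θ₀, by simp [l2_zero, hδ.le]⟩
    (f := fun θ => ∑ i, (y i * (x i ⬝ᵥ θ) - Real.log (1 + Real.exp (x i ⬝ᵥ θ - o i))))
    (Continuous.continuousOn (by
      refine continuous_finsetSum _ fun i _ => ?_
      have : Continuous fun θ : Fin r → ℝ => x i ⬝ᵥ θ := by
        simp only [dotProduct]; fun_prop
      refine (continuous_const.mul this).sub (Continuous.log (by fun_prop) fun θ => ?_)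
      positivity))
  have hθ : l2 (θ - θ₀) ≤ δ := hθ
  have hdir : ∀ w, (∀ᶠ t in nhdsWithin (0 : ℝ) (Set.Ioi 0), l2 (θ + t • w - θ₀) ≤ δ) →
      score x y o θ ⬝ᵥ w ≤ 0 := by
    intro w hw
    refine nonpos_of_hasDerivAt_of_eventually_le (hasDerivAt_logLikelihood x y o θ w) ?_
    filter_upwards [hw] with t ht
    have := hmax (show θ + t • w ∈ {θ | l2 (θ - θ₀) ≤ δ} from ht)
    simpa using this
  have h0 : score x y o θ = 0 := by
    rcases eq_or_lt_of_le hθ with h | h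
    · exfalso
      have h1 := hbd (θ - θ₀) h
      rw [add_sub_cancel] at h1
      -- Moving from a boundary maximizer towards the center stays in the ball, so the likelihood
      -- cannot increase in that direction, contrary to `hbd`.
      have h2 := hdir (-(θ - θ₀)) (by
        filter_upwards [Ioo_mem_nhdsGT (show (0 : ℝ) < 1 by norm_num)] with t ht
        rw [show θ + t • -(θ - θ₀) - θ₀ = (1 - t) • (θ - θ₀) by
          rw [sub_smul, one_smul, smul_neg]; abel]
        rw [l2_smul, abs_of_nonneg (by linarith [ht.2]), h]
        nlinarith [ht.1])
      rw [dotProduct_neg] at h2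
      linarith
    -- From an interior maximizer one may move along the score itself, which gives `‖score‖² ≤ 0`.
    · have h1 := hdir (score x y o θ) (by
        have hc : Continuous fun t : ℝ => l2 (θ + t • score x y o θ - θ₀) :=
          continuous_l2.comp (by fun_prop)
        have h2 := hc.tendsto 0
        have h3 : l2 (θ + (0 : ℝ) • score x y o θ - θ₀) < δ := by simpa using h
        exact ((h2.eventually_lt_const h3).mono fun t ht => ht.le).filter_mono
          nhdsWithin_le_nhds)
      rw [← l2_sq_dot] at h1
      exact l2_eq_zero.1 (pow_eq_zero_iff two_ne_zero |>.1 (le_antisymm h1 (sq_nonneg _)))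
  exact ⟨θ, h0, fun θ' h' => huniq _ _ h0 h', hθ⟩

end Score

/-! ### Probabilities on finite spaces -/

/-- The probability of the event `S` for the probability mass function `w`. -/
noncomputable def wprob {α : Type*} [Fintype α] (w : α → ℝ) (S : Set α) : ℝ :=
  ∑ a, S.indicator w a

/-- The probability mass function of independent draws from `w`. -/
def prodWeight {α : Type*} (w : α → ℝ) {ι : Type*} [Fintype ι] (y : ι → α) : ℝ := ∏ i, w (y i)

theorem prodWeight_nonneg {α ι : Type*} [Fintype ι] {w : α → ℝ} (hw : ∀ a, 0 ≤ w a)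
    (y : ι → α) : 0 ≤ prodWeight w y :=
  Finset.prod_nonneg fun _ _ => hw _

section Finite
variable {α : Type*} [Fintype α] {w : α → ℝ}

theorem wprob_mono (hw : ∀ a, 0 ≤ w a) {S T : Set α} (h : S ⊆ T) : wprob w S ≤ wprob w T :=
  Finset.sum_le_sum fun a _ => Set.indicator_le_indicator_of_subset h hw a

theorem wprob_union_le (hw : ∀ a, 0 ≤ w a) (S T : Set α) :
    wprob w (S ∪ T) ≤ wprob w S + wprob w T := by
  rw [wprob, wprob, wprob, ← Finset.sum_add_distrib]
  refine Finset.sum_le_sum fun a _ => ?_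
  have h := Set.indicator_union_add_inter_apply w S T a
  have h2 : 0 ≤ (S ∩ T).indicator w a := Set.indicator_nonneg (fun a _ => hw a) a
  linarith

theorem wprob_iUnion_le (hw : ∀ a, 0 ≤ w a) {κ : Type*} [Fintype κ] (S : κ → Set α) {ε : ℝ}
    (h : ∀ k, wprob w (S k) ≤ ε) : wprob w (⋃ k, S k) ≤ Fintype.card κ * ε := by
  have h1 : wprob w (⋃ k, S k) ≤ ∑ k, wprob w (S k) := by
    simp only [wprob]
    rw [Finset.sum_comm]
    refine Finset.sum_le_sum fun a _ => ?_
    have h0 : ∀ k ∈ Finset.univ, 0 ≤ (S k).indicator w a :=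
      fun k _ => Set.indicator_nonneg (fun a _ => hw a) a
    by_cases ha : a ∈ ⋃ k, S k
    · obtain ⟨k, hk⟩ := Set.mem_iUnion.1 ha
      rw [Set.indicator_of_mem ha]
      have := Finset.single_le_sum h0 (Finset.mem_univ k)
      rwa [Set.indicator_of_mem hk] at this
    · rw [Set.indicator_of_notMem ha]
      exact Finset.sum_nonneg h0
  exact h1.trans ((Finset.sum_le_sum fun k _ => h k).trans (by simp))

variable {ι : Type*} [Fintype ι]

theorem sum_prod_eq_pow [DecidableEq ι] (f : α → ℝ) :
    ∑ y : ι → α, ∏ i, f (y i) = (∑ a, f a) ^ Fintype.card ι := by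
  have := Finset.prod_univ_sum (fun _ : ι => (Finset.univ : Finset α)) fun _ a => f a
  rw [Fintype.piFinset_univ] at this
  rw [← this]; simp

theorem sum_prodWeight [DecidableEq ι] (h : ∑ a, w a = 1) : ∑ y : ι → α, prodWeight w y = 1 := by
  simp only [prodWeight]
  rw [sum_prod_eq_pow, h, one_pow]

/-- A Chernoff bound of Bernstein type. -/
theorem wprob_upper_tail [DecidableEq ι] (hw : ∀ a, 0 ≤ w a) (h1 : ∑ a, w a = 1) (X : α → ℝ)
    {l v τ : ℝ} (hl : 0 ≤ l) (hX : ∀ a, w a ≠ 0 → |l * X a| ≤ 1)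
    (hv : ∑ a, w a * X a ^ 2 ≤ v) :
    wprob (prodWeight w) {y : ι → α | Fintype.card ι * ∑ a, w a * X a + τ ≤ ∑ i, X (y i)} ≤
      Real.exp (l ^ 2 * Fintype.card ι * v - l * τ) := by
  set m := Fintype.card ι with hm
  set E := ∑ a, w a * X a with hE
  -- The bound `exp x ≤ 1 + x + x²` for `|x| ≤ 1` gives the exponential moment in terms of the mean
  -- and the second moment.
  have e1 : ∑ a, w a * Real.exp (l * X a) ≤ Real.exp (l * E + l ^ 2 * v) := by
    have : ∀ a, w a * Real.exp (l * X a) ≤ w a + l * (w a * X a) + l ^ 2 * (w a * X a ^ 2) := by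
      intro a
      by_cases ha : w a = 0
      · simp [ha]
      · have h2 := (abs_le.1 (Real.abs_exp_sub_one_sub_id_le (hX a ha))).2
        nlinarith [hw a, mul_le_mul_of_nonneg_left h2 (hw a)]
    refine (Finset.sum_le_sum fun a _ => this a).trans ?_
    rw [Finset.sum_add_distrib, Finset.sum_add_distrib, ← Finset.mul_sum, ← Finset.mul_sum, h1]
    have h3 := Real.add_one_le_exp (l * E + l ^ 2 * v)
    have h4 := mul_le_mul_of_nonneg_left hv (sq_nonneg l)
    linarith
  calc wprob (prodWeight w) {y : ι → α | m * E + τ ≤ ∑ i, X (y i)}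
      ≤ ∑ y : ι → α, Real.exp (-(l * (m * E + τ))) * ∏ i, (w (y i) * Real.exp (l * X (y i))) := by
        refine Finset.sum_le_sum fun y _ => ?_
        rw [Finset.prod_mul_distrib, ← Real.exp_sum, ← Finset.mul_sum]
        have h2 := prodWeight_nonneg hw y
        by_cases hy : m * E + τ ≤ ∑ i, X (y i)
        · rw [Set.indicator_of_mem (show y ∈ {y : ι → α | m * E + τ ≤ ∑ i, X (y i)} from hy)]
          have h3 : 1 ≤ Real.exp (-(l * (m * E + τ))) * Real.exp (l * ∑ i, X (y i)) := by
            rw [← Real.exp_add]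
            exact Real.one_le_exp (by nlinarith)
          change prodWeight w y ≤ _ * (prodWeight w y * _)
          nlinarith
        · rw [Set.indicator_of_notMem (show y ∉ {y : ι → α | m * E + τ ≤ ∑ i, X (y i)} from hy)]
          change 0 ≤ _ * (prodWeight w y * _)
          positivity
    _ = Real.exp (-(l * (m * E + τ))) * (∑ a, w a * Real.exp (l * X a)) ^ m := by
        rw [← Finset.mul_sum, sum_prod_eq_pow (ι := ι) fun a => w a * Real.exp (l * X a)]
    _ ≤ Real.exp (-(l * (m * E + τ))) * Real.exp (l * E + l ^ 2 * v) ^ m := by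
        refine mul_le_mul_of_nonneg_left (pow_le_pow_left₀ ?_ e1 m) (Real.exp_nonneg _)
        exact Finset.sum_nonneg fun a _ => mul_nonneg (hw a) (Real.exp_nonneg _)
    _ = _ := by
        rw [← Real.exp_nat_mul, ← Real.exp_add]
        congr 1; ring

/-- The Chernoff parameter is `η / b`. Second moments carry the factor `2 / d` because a row takes
part in a comparison with probability `2 / d` and a column with probability `1 / d`. Then the
quadratic term is at most `2 L` and the linear gain is `q L`. -/
theorem wprob_abs_deviation_le [DecidableEq ι] (hw : ∀ a, 0 ≤ w a) (h1 : ∑ a, w a = 1)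
    (X : α → ℝ) {b d n η L q : ℝ} (hb : 0 < b) (hd : 0 < d) (hη : 0 ≤ η) (hη1 : η ≤ 1)
    (hL : n * η ^ 2 = d * L) (hn : (Fintype.card ι : ℝ) ≤ n) (hX : ∀ a, w a ≠ 0 → |X a| ≤ b)
    (hv : ∑ a, w a * X a ^ 2 ≤ b ^ 2 * (2 / d)) :
    wprob (prodWeight w) {y : ι → α |
        b * (q * (n / d) * η) < |∑ i, X (y i) - Fintype.card ι * ∑ a, w a * X a|} ≤
      2 * Real.exp (-((q - 2) * L)) := by
  have key : ∀ Y : α → ℝ, (∀ a, w a ≠ 0 → |Y a| ≤ b) →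
      (∑ a, w a * Y a ^ 2 ≤ b ^ 2 * (2 / d)) →
      wprob (prodWeight w) {y : ι → α | Fintype.card ι * ∑ a, w a * Y a + b * (q * (n / d) * η) ≤
        ∑ i, Y (y i)} ≤ Real.exp (-((q - 2) * L)) := by
    intro Y hY hYv
    have h := wprob_upper_tail (ι := ι) hw h1 Y (l := η / b) (τ := b * (q * (n / d) * η))
      (by positivity) (fun a ha => by
        rw [abs_mul, abs_of_nonneg (by positivity : 0 ≤ η / b)]
        have := hY a ha
        calc η / b * |Y a| ≤ η / b * b := by gcongr
          _ = η := by field_simp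
          _ ≤ 1 := hη1) hYv
    refine h.trans (Real.exp_le_exp.2 ?_)
    have e1 : (η / b) ^ 2 * Fintype.card ι * (b ^ 2 * (2 / d)) =
        2 * η ^ 2 * Fintype.card ι / d := by field_simp
    have e2 : η / b * (b * (q * (n / d) * η)) = q * (n * η ^ 2) / d := by field_simp
    have e3 : 2 * η ^ 2 * Fintype.card ι / d ≤ 2 * L := by
      rw [div_le_iff₀ hd]
      nlinarith [sq_nonneg η]
    have e4 : q * (d * L) / d = q * L := by field_simp
    rw [e1, e2, hL, e4]
    linarith
  have k1 := key X hX hv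
  have k2 := key (fun a => -X a) (by simpa using hX) (by simpa using hv)
  refine (wprob_mono (prodWeight_nonneg hw) ?_).trans ((wprob_union_le (prodWeight_nonneg hw)
    _ _).trans (by rw [two_mul]; exact add_le_add k1 k2))
  intro y hy
  have hy : b * (q * (n / d) * η) < |∑ i, X (y i) - Fintype.card ι * ∑ a, w a * X a| := hy
  simp only [Set.mem_union, Set.mem_ofPred_eq, mul_neg, Finset.sum_neg_distrib]
  rcases lt_abs.1 hy with h | h
  · left; linarith
  · right; linarith

/-- Replace the coordinates of `z` that satisfy `p` by those of `y`. -/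
def glue {ι α : Type*} (p : ι → Prop) [DecidablePred p] (z : ι → α) (y : {i // p i} → α) :
    ι → α := fun i => if h : p i then y ⟨i, h⟩ else z i

/-- If, given the coordinates outside of `p`, the event `B` has conditional probability at most
`ε` on the event `G`, then `G ∩ B` has at most `ε` times the probability of `G`. -/
theorem wprob_inter_le_of_glue [DecidableEq ι] (hw : ∀ a, 0 ≤ w a) (h1 : ∑ a, w a = 1)
    (p : ι → Prop) [DecidablePred p] (G B : Set (ι → α)) {ε : ℝ}
    (hG : ∀ z z', (∀ i, ¬ p i → z i = z' i) → z ∈ G → z' ∈ G)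
    (hB : ∀ z ∈ G, wprob (prodWeight w) {y | glue p z y ∈ B} ≤ ε) :
    wprob (prodWeight w) (G ∩ B) ≤ ε * wprob (prodWeight w) G := by
  classical
  set e := (Equiv.piEquivPiSubtypeProd p fun _ : ι => α).symm with he
  have hsplit : ∀ f : (ι → α) → ℝ, ∑ z, f z = ∑ c, ∑ y, f (e (y, c)) := by
    intro f
    rw [← Equiv.sum_comp e, Fintype.sum_prod_type, Finset.sum_comm]
  have hweight : ∀ y c, prodWeight w (e (y, c)) = prodWeight w y * prodWeight w c := by
    intro y c
    rw [prodWeight, ← Fintype.prod_subtype_mul_prod_subtype p]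
    congr 1
    · refine Finset.prod_congr rfl fun i _ => ?_
      simp [he, Equiv.piEquivPiSubtypeProd, i.2]
    · refine Finset.prod_congr rfl fun i _ => ?_
      simp [he, Equiv.piEquivPiSubtypeProd, i.2]
  have hglue : ∀ y y' c, glue p (e (y, c)) y' = e (y', c) := by
    intro y y' c
    ext i
    by_cases hi : p i <;> simp [glue, he, Equiv.piEquivPiSubtypeProd, hi]
  rw [wprob, wprob, hsplit, hsplit, Finset.mul_sum]
  refine Finset.sum_le_sum fun c _ => ?_
  have hc := prodWeight_nonneg (ι := {i // ¬ p i}) hw c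
  -- As `G` ignores the coordinates in `p`, the fiber over `c` lies entirely inside `G` or entirely
  -- outside.
  by_cases hex : ∃ y, e (y, c) ∈ G
  · obtain ⟨y₀, hy₀⟩ := hex
    have hall : ∀ y, e (y, c) ∈ G := by
      intro y
      refine hG _ _ (fun i hi => ?_) hy₀
      simp [he, Equiv.piEquivPiSubtypeProd, hi]
    have e1 : ∑ y, G.indicator (prodWeight w) (e (y, c)) = prodWeight w c := by
      simp_rw [Set.indicator_of_mem (hall _), hweight]
      rw [← Finset.sum_mul, sum_prodWeight h1, one_mul]
    have e2 : ∑ y, (G ∩ B).indicator (prodWeight w) (e (y, c)) =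
        wprob (prodWeight w) {y | glue p (e (y₀, c)) y ∈ B} * prodWeight w c := by
      rw [wprob, Finset.sum_mul]
      refine Finset.sum_congr rfl fun y _ => ?_
      by_cases hy : e (y, c) ∈ B
      · rw [Set.indicator_of_mem (Set.mem_inter (hall y) hy), hweight, Set.indicator_of_mem]
        simpa [hglue] using hy
      · rw [Set.indicator_of_notMem fun h => hy h.2, Set.indicator_of_notMem, zero_mul]
        simpa [hglue] using hy
    rw [e1, e2]
    exact mul_le_mul_of_nonneg_right (hB _ hy₀) hc
  · push Not at hex
    rw [Finset.sum_eq_zero fun y _ => Set.indicator_of_notMem (fun h => hex y h.1) _,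
      Finset.sum_eq_zero fun y _ => Set.indicator_of_notMem (hex y) _, mul_zero]

end Finite

/-! ### Expectations under the comparison model -/

section Mass
variable {d : ℕ} (T : Matrix (Fin d) (Fin d) ℝ)

theorem comparisonMass_nonneg (z : Obs d) : 0 ≤ comparisonMass T z := by
  rw [comparisonMass]
  have h0 := Real.sigmoid_pos (T z.left z.col - T z.right z.col)
  have h1 := Real.sigmoid_lt_one (T z.left z.col - T z.right z.col)
  split_ifs
  · positivity
  · exact mul_nonneg (by positivity) (by linarith)
  · exact le_rfl

theorem left_lt_right_of_comparisonMass_ne_zero {T : Matrix (Fin d) (Fin d) ℝ} {z : Obs d}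
    (h : comparisonMass T z ≠ 0) : z.left < z.right := by
  by_contra hlt
  exact h (if_neg hlt)

theorem sum_comparisonMass_mul (X : Obs d → ℝ) :
    ∑ z, comparisonMass T z * X z = (1 / (d : ℝ)) * (1 / (d.choose 2 : ℝ)) *
      ∑ j, ∑ a, ∑ b, if a < b then
        Real.sigmoid (T a j - T b j) * X (j, a, b, true) +
        (1 - Real.sigmoid (T a j - T b j)) * X (j, a, b, false) else 0 := by
  rw [Fintype.sum_prod_type, Finset.mul_sum]
  refine Finset.sum_congr rfl fun j _ => ?_
  rw [Fintype.sum_prod_type, Finset.mul_sum]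
  refine Finset.sum_congr rfl fun a _ => ?_
  rw [Fintype.sum_prod_type, Finset.mul_sum]
  refine Finset.sum_congr rfl fun b _ => ?_
  rw [Fintype.sum_bool]
  simp only [comparisonMass, Obs.left, Obs.right, Obs.col]
  by_cases hab : a < b
  · simp only [if_pos hab, if_true, Bool.false_eq_true, if_false]
    ring
  · simp [if_neg hab]

theorem two_mul_sum_lt (g : Fin d → Fin d → ℝ) (hg : ∀ a b, g a b = g b a) :
    2 * ∑ a, ∑ b, (if a < b then g a b else 0) = ∑ a, ∑ b, g a b - ∑ a, g a a := by
  have e1 : ∑ a, ∑ b, (if a < b then g a b else 0) = ∑ a, ∑ b, (if b < a then g a b else 0) := by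
    rw [Finset.sum_comm]
    simp_rw [fun a b => hg a b]
  have e2 : ∑ a, g a a = ∑ a, ∑ b, (if a = b then g a b else 0) := by simp
  rw [two_mul]
  nth_rewrite 2 [e1]
  rw [e2, ← Finset.sum_add_distrib, ← Finset.sum_sub_distrib]
  refine Finset.sum_congr rfl fun a _ => ?_
  rw [← Finset.sum_add_distrib, ← Finset.sum_sub_distrib]
  refine Finset.sum_congr rfl fun b _ => ?_
  rcases lt_trichotomy a b with h | h | h
  · simp [h, h.not_gt, h.ne]
  · subst h; simp
  · simp [h, h.not_gt, h.ne']

theorem sum_lt_involving (u : Fin d) (F : Fin d → ℝ) :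
    ∑ a, ∑ b, (if a < b then (if a = u then F b else 0) + (if b = u then F a else 0) else 0) =
      ∑ w, F w - F u := by
  have e0 : ∀ a b : Fin d,
      (if a < b then (if a = u then F b else 0) + (if b = u then F a else 0) else 0) =
      (if a = u then (if u < b then F b else 0) else 0) +
      (if b = u then (if a < u then F a else 0) else 0) := by
    intro a b
    by_cases ha : a = u <;> by_cases hb : b = u <;> simp [ha, hb]
  simp_rw [e0, Finset.sum_add_distrib]
  rw [Finset.sum_comm]
  have e1 : ∑ b, ∑ a, (if a = u then (if u < b then F b else 0) else 0) =
      ∑ b, if u < b then F b else 0 := by simp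
  have e2 : ∑ a, ∑ b, (if b = u then (if a < u then F a else 0) else 0) =
      ∑ a, if a < u then F a else 0 := by simp
  rw [e1, e2, ← Finset.sum_add_distrib, eq_sub_iff_add_eq,
    show F u = ∑ w, if w = u then F w else 0 by simp, ← Finset.sum_add_distrib]
  refine Finset.sum_congr rfl fun w _ => ?_
  rcases lt_trichotomy w u with h | h | h
  · simp [h, h.not_gt, h.ne]
  · subst h; simp
  · simp [h, h.not_gt, h.ne']

theorem pair_weight (hd : 2 ≤ d) :
    (1 / (d : ℝ)) * (1 / (d.choose 2 : ℝ)) = 2 / ((d : ℝ) ^ 2 * (d - 1)) := by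
  have h2 : (2 : ℝ) ≤ d := by exact_mod_cast hd
  have h3 : (0 : ℝ) < d - 1 := by linarith
  rw [Nat.cast_choose_two]
  field_simp

theorem sum_comparisonMass (hd : 2 ≤ d) : ∑ z, comparisonMass T z = 1 := by
  have h := sum_comparisonMass_mul T fun _ => 1
  simp only [mul_one, add_sub_cancel] at h
  have h2 := two_mul_sum_lt (d := d) (fun _ _ => 1) fun _ _ => rfl
  have h3 : (2 : ℝ) ≤ d := by exact_mod_cast hd
  have h4 : (0 : ℝ) < d - 1 := by linarith
  simp only [Finset.sum_const, Finset.card_univ, Fintype.card_fin, nsmul_eq_mul, mul_one] at h2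
  rw [h, pair_weight hd, Finset.sum_const, Finset.card_univ, Fintype.card_fin, nsmul_eq_mul,
    show ∑ a : Fin d, ∑ b : Fin d, (if a < b then (1 : ℝ) else 0) = (d * d - d) / 2 by linarith]
  field_simp

theorem sum_comparisonMass_mul_mono {X Y : Obs d → ℝ}
    (h : ∀ z : Obs d, z.left < z.right → X z ≤ Y z) :
    ∑ z, comparisonMass T z * X z ≤ ∑ z, comparisonMass T z * Y z := by
  refine Finset.sum_le_sum fun z _ => ?_
  by_cases hz : comparisonMass T z = 0
  · simp [hz]
  · exact mul_le_mul_of_nonneg_left (h z (left_lt_right_of_comparisonMass_ne_zero hz))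
      (comparisonMass_nonneg T z)

/-- The expectation of a function of the comparisons that involve the row `u`. -/
theorem sum_comparisonMass_mul_row (hd : 2 ≤ d) (u : Fin d) (f : Fin d → Fin d → ℝ → ℝ) :
    ∑ z : Obs d, comparisonMass T z * ((if z.left = u then f z.right z.col z.outcome else 0) +
      (if z.right = u then f z.left z.col (1 - z.outcome) else 0)) =
    2 / ((d : ℝ) ^ 2 * (d - 1)) * ∑ j, (∑ w, (Real.sigmoid (T u j - T w j) * f w j 1 +
      (1 - Real.sigmoid (T u j - T w j)) * f w j 0) -
      (Real.sigmoid (T u j - T u j) * f u j 1 +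
      (1 - Real.sigmoid (T u j - T u j)) * f u j 0)) := by
  rw [sum_comparisonMass_mul, pair_weight hd]
  congr 1
  refine Finset.sum_congr rfl fun j _ => ?_
  rw [← sum_lt_involving u fun w => (Real.sigmoid (T u j - T w j) * f w j 1 +
      (1 - Real.sigmoid (T u j - T w j)) * f w j 0)]
  refine Finset.sum_congr rfl fun a _ => Finset.sum_congr rfl fun b _ => ?_
  simp only [Obs.left, Obs.right, Obs.col, Obs.outcome]
  by_cases hab : a < b
  · rw [if_pos hab, if_pos hab]
    -- When `u` is the right entry the outcome is reversed, and `σ(-x) = 1 - σ(x)` gives the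
    -- reversed comparison the same form of law.
    have hs : Real.sigmoid (T b j - T a j) = 1 - Real.sigmoid (T a j - T b j) := by
      rw [← Real.sigmoid_neg, neg_sub]
    by_cases ha : a = u <;> by_cases hb : b = u
    · subst ha; subst hb; exact absurd hab (lt_irrefl _)
    · subst ha; simp [hb]
    · subst hb; simp [ha, hs]; ring
    · simp [ha, hb]
  · rw [if_neg hab, if_neg hab]

theorem sum_comparisonMass_mul_involves (hd : 2 ≤ d) (u : Fin d) :
    ∑ z : Obs d, comparisonMass T z * ((if z.left = u then 1 else 0) +
      (if z.right = u then 1 else 0)) = 2 / (d : ℝ) := by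
  have h3 : (2 : ℝ) ≤ d := by exact_mod_cast hd
  have h4 : (0 : ℝ) < d - 1 := by linarith
  rw [sum_comparisonMass_mul_row T hd u fun _ _ _ => 1]
  simp
  field_simp

/-- The expectation of a function of the comparisons in the column `j`. -/
theorem sum_comparisonMass_mul_col (j : Fin d) (f : Fin d → Fin d → ℝ → ℝ) :
    ∑ z : Obs d, comparisonMass T z * (if z.col = j then f z.left z.right z.outcome else 0) =
    (1 / (d : ℝ)) * (1 / (d.choose 2 : ℝ)) * ∑ a, ∑ b, if a < b then
        Real.sigmoid (T a j - T b j) * f a b 1 +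
        (1 - Real.sigmoid (T a j - T b j)) * f a b 0 else 0 := by
  rw [sum_comparisonMass_mul]
  congr 1
  rw [Finset.sum_eq_single j]
  · simp [Obs.left, Obs.right, Obs.col, Obs.outcome]
  · intro k _ hk
    simp [Obs.col, hk]
  · simp

theorem sum_comparisonMass_mul_col_indicator (hd : 2 ≤ d) (j : Fin d) :
    ∑ z : Obs d, comparisonMass T z * (if z.col = j then 1 else 0) = 1 / (d : ℝ) := by
  have h2 := two_mul_sum_lt (d := d) (fun _ _ => 1) fun _ _ => rfl
  have h3 : (2 : ℝ) ≤ d := by exact_mod_cast hd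
  have h4 : (0 : ℝ) < d - 1 := by linarith
  simp only [Finset.sum_const, Finset.card_univ, Fintype.card_fin, nsmul_eq_mul, mul_one] at h2
  rw [sum_comparisonMass_mul_col T j fun _ _ _ => 1, pair_weight hd]
  simp only [mul_one, add_sub_cancel]
  rw [show ∑ a : Fin d, ∑ b : Fin d, (if a < b then (1 : ℝ) else 0) = (d * d - d) / 2 by linarith]
  field_simp

end Mass

/-! ### The row step -/

/-- An entrywise perturbation of size `t` changes the quadratic form by at most `t (∑ |v k|)² ≤ r t
‖v‖²`; the loss in `r` is harmless since the rank is fixed. -/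
theorem quadForm_lower {r : ℕ} {G μ : Fin r → Fin r → ℝ} {m a t : ℝ} (hm : 0 ≤ m)
    (hG : ∀ k l, |G k l - m * μ k l| ≤ t) (v : Fin r → ℝ)
    (hμ : a * l2 v ^ 2 ≤ ∑ k, ∑ l, μ k l * (v k * v l)) :
    (m * a - r * t) * l2 v ^ 2 ≤ ∑ k, ∑ l, G k l * (v k * v l) := by
  have h1 : ∀ k l, m * (μ k l * (v k * v l)) - t * (|v k| * |v l|) ≤ G k l * (v k * v l) := by
    intro k l
    have h2 := abs_mul (G k l - m * μ k l) (v k * v l)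
    have h3 := neg_abs_le ((G k l - m * μ k l) * (v k * v l))
    have h4 := mul_le_mul_of_nonneg_right (hG k l) (abs_nonneg (v k * v l))
    rw [abs_mul (v k)] at h2 h4
    nlinarith
  have h5 : ∑ k, ∑ l, (m * (μ k l * (v k * v l)) - t * (|v k| * |v l|)) =
      m * ∑ k, ∑ l, μ k l * (v k * v l) - t * (∑ k, |v k|) ^ 2 := by
    simp_rw [Finset.sum_sub_distrib, ← Finset.mul_sum]
    rw [sq, Finset.sum_mul]
  have h6 := Finset.sum_le_sum fun k (_ : k ∈ Finset.univ) =>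
    Finset.sum_le_sum fun l (_ : l ∈ Finset.univ) => h1 k l
  rw [h5] at h6
  by_cases hr : r = 0
  · subst hr; simp [l2_sq]
  have ht : 0 ≤ t := (abs_nonneg _).trans
    (hG ⟨0, Nat.pos_of_ne_zero hr⟩ ⟨0, Nat.pos_of_ne_zero hr⟩)
  have h7 : (∑ k, |v k|) ^ 2 ≤ r * l2 v ^ 2 := by
    have h8 := pow_le_pow_left₀ (Finset.sum_nonneg fun _ _ => abs_nonneg _)
      (sum_abs_le_sqrt_card_mul v) 2
    rwa [mul_pow, Real.sq_sqrt (Nat.cast_nonneg _), Fintype.card_fin] at h8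
  nlinarith [mul_le_mul_of_nonneg_left h7 ht, mul_le_mul_of_nonneg_left hμ hm]

section Row
variable {d r : ℕ}

/-- The contribution of one comparison to the score of the row `u`. -/
noncomputable def rowTerm (B : Matrix (Fin d) (Fin r) ℝ) (T₀ : Matrix (Fin d) (Fin d) ℝ) (u : Fin d)
    (θ : Fin r → ℝ) (z : Obs d) : Fin r → ℝ :=
  (if z.left = u then
      (z.outcome - Real.sigmoid (B z.col ⬝ᵥ θ - T₀ z.right z.col)) • B z.col else 0) +
  (if z.right = u then
      ((1 - z.outcome) - Real.sigmoid (B z.col ⬝ᵥ θ - T₀ z.left z.col)) • B z.col else 0)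

theorem rowScore_eq_sum_rowTerm {n : ℕ} (B : Matrix (Fin d) (Fin r) ℝ)
    (T₀ : Matrix (Fin d) (Fin d) ℝ) (φ : Fin n → Fin 3) (z : Fin n → Obs d) (u : Fin d)
    (θ : Fin r → ℝ) :
    rowScore B T₀ φ z u θ = ∑ i : {i // φ i = 1}, rowTerm B T₀ u θ (z i) := by
  rw [rowScore, ← Finset.sum_subtype_eq_sum_filter, Finset.subtype_univ]
  rfl

/-- The covariates of the row score. -/
def rowCov (B : Matrix (Fin d) (Fin r) ℝ) (u : Fin d) (p : Obs d × Bool) : Fin r → ℝ :=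
  if (if p.2 then p.1.left else p.1.right) = u then B p.1.col else 0

/-- Every comparison gets two slots, one for each side on which `u` may stand. A slot where `u` is
absent has covariate zero and does not contribute, so the random set of comparisons of `u` is
replaced by a fixed index type. -/
theorem sum_rowTerm_eq_score {ι : Type*} [Fintype ι] (B : Matrix (Fin d) (Fin r) ℝ)
    (T₀ : Matrix (Fin d) (Fin d) ℝ) (u : Fin d) (y : ι → Obs d) (θ : Fin r → ℝ) :
    ∑ i, rowTerm B T₀ u θ (y i) =
      score (fun p : ι × Bool => rowCov B u (y p.1, p.2))
        (fun p => if p.2 then (y p.1).outcome else 1 - (y p.1).outcome)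
        (fun p => T₀ (if p.2 then (y p.1).right else (y p.1).left) (y p.1).col) θ := by
  rw [score, Fintype.sum_prod_type]
  refine Finset.sum_congr rfl fun i _ => ?_
  rw [Fintype.sum_bool]
  simp only [rowTerm, rowCov, if_true, Bool.false_eq_true, if_false]
  congr 1 <;> split_ifs <;> simp

theorem sum_rowCov_dotProduct_sq {ι : Type*} [Fintype ι] (B : Matrix (Fin d) (Fin r) ℝ)
    (u : Fin d) (y : ι → Obs d) (v : Fin r → ℝ) :
    ∑ p : ι × Bool, (rowCov B u (y p.1, p.2) ⬝ᵥ v) ^ 2 =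
      ∑ k, ∑ l, (∑ i, ((if (y i).left = u then B (y i).col k * B (y i).col l else 0) +
        (if (y i).right = u then B (y i).col k * B (y i).col l else 0))) * (v k * v l) := by
  have hsq : ∀ j, (B j ⬝ᵥ v) ^ 2 = ∑ k, ∑ l, B j k * B j l * (v k * v l) := by
    intro j
    rw [sq, dotProduct, Finset.sum_mul_sum]
    exact Finset.sum_congr rfl fun k _ => Finset.sum_congr rfl fun l _ => by ring
  simp_rw [Finset.sum_mul]
  have hswap : ∀ g : Fin r → Fin r → ι → ℝ, ∑ k, ∑ l, ∑ i, g k l i = ∑ i, ∑ k, ∑ l, g k l i := by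
    intro g
    rw [Finset.sum_comm' (t' := Finset.univ) (s' := fun _ => Finset.univ) (by simp)]
    simp_rw [fun l => Finset.sum_comm (s := (Finset.univ : Finset (Fin r)))
      (t := (Finset.univ : Finset ι)) (f := fun k i => g k l i)]
    rw [Finset.sum_comm]
    exact Finset.sum_congr rfl fun i _ => Finset.sum_comm
  rw [hswap, Fintype.sum_prod_type]
  refine Finset.sum_congr rfl fun i _ => ?_
  rw [Fintype.sum_bool]
  simp only [rowCov, if_true, Bool.false_eq_true, if_false, add_mul, Finset.sum_add_distrib]
  congr 1 <;> split_ifs <;> simp [hsq]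

/-- Moments of a function that vanishes unless the comparison involves the row `u`. -/
theorem row_moments (T : Matrix (Fin d) (Fin d) ℝ) (hd : 2 ≤ d) (u : Fin d) {X : Obs d → ℝ}
    {b : ℝ} (hX : ∀ z : Obs d, |X z| ≤ b * ((if z.left = u then 1 else 0) +
      (if z.right = u then 1 else 0))) :
    (∀ z, comparisonMass T z ≠ 0 → |X z| ≤ b) ∧
      ∑ z, comparisonMass T z * X z ^ 2 ≤ b ^ 2 * (2 / d) := by
  have hb : 0 ≤ b := by
    have := (abs_nonneg _).trans (hX (u, u, u, true))
    simp [Obs.left, Obs.right] at this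
    linarith
  -- The two rows of a comparison differ, so at most one indicator is one; otherwise the bound would
  -- be `2 * b`.
  have h01 : ∀ z : Obs d, z.left < z.right →
      ((if z.left = u then (1 : ℝ) else 0) + (if z.right = u then 1 else 0) = 0 ∨
      (if z.left = u then (1 : ℝ) else 0) + (if z.right = u then 1 else 0) = 1) := by
    intro z hz
    by_cases h1 : z.left = u <;> by_cases h2 : z.right = u
    · rw [h1, h2] at hz; exact absurd hz (lt_irrefl _)
    all_goals simp [h1, h2]
  constructor
  · intro z hz
    have h := hX z
    rcases h01 z (left_lt_right_of_comparisonMass_ne_zero hz) with h1 | h1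
    · rw [h1] at h; linarith
    · rw [h1] at h; linarith
  · rw [← sum_comparisonMass_mul_involves T hd u, Finset.mul_sum]
    simp_rw [mul_left_comm (b ^ 2)]
    refine sum_comparisonMass_mul_mono T fun z hz => ?_
    have h := pow_le_pow_left₀ (abs_nonneg _) (hX z) 2
    rw [sq_abs] at h
    rcases h01 z hz with h1 | h1
    · rw [h1] at h ⊢; simpa using h
    · rw [h1] at h ⊢; simpa using h

theorem abs_outcome_sub_sigmoid_le (z : Obs d) (x : ℝ) :
    |z.outcome - Real.sigmoid x| ≤ 1 ∧ |1 - z.outcome - Real.sigmoid x| ≤ 1 := by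
  have h0 := Real.sigmoid_pos x
  have h1 := Real.sigmoid_lt_one x
  unfold Obs.outcome
  constructor <;> split_ifs <;> rw [abs_le] <;> constructor <;> linarith

theorem abs_rowTerm_le (B : Matrix (Fin d) (Fin r) ℝ) (T₀ : Matrix (Fin d) (Fin d) ℝ) (u : Fin d)
    (θ : Fin r → ℝ) {b : ℝ} (hB : ∀ j, l2 (B j) ≤ b) (z : Obs d) (k : Fin r) :
    |rowTerm B T₀ u θ z k| ≤ b * ((if z.left = u then 1 else 0) +
      (if z.right = u then 1 else 0)) := by
  have hk : |B z.col k| ≤ b := (abs_le_l2 _ _).trans (hB _)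
  rw [rowTerm, mul_add]
  refine (abs_add_le _ _).trans (add_le_add ?_ ?_)
  · split_ifs
    · rw [Pi.smul_apply, smul_eq_mul, abs_mul, mul_one]
      exact (mul_le_of_le_one_left (abs_nonneg _) (abs_outcome_sub_sigmoid_le _ _).1).trans hk
    · simp
  · split_ifs
    · rw [Pi.smul_apply, smul_eq_mul, abs_mul, mul_one]
      exact (mul_le_of_le_one_left (abs_nonneg _) (abs_outcome_sub_sigmoid_le _ _).2).trans hk
    · simp

theorem mul_transpose_apply (Θ A : Matrix (Fin d) (Fin r) ℝ) (u j : Fin d) :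
    (Θ * A.transpose) u j = A j ⬝ᵥ Θ u := by
  rw [dotProduct_comm]; rfl

theorem abs_sum_sub_le_sum_abs {ι : Type*} [Fintype ι] (h : ι → ℝ) (u : ι) :
    |∑ w, h w - h u| ≤ ∑ w, |h w| := by
  classical
  have e : ∑ w, h w - h u = ∑ w ∈ Finset.univ.erase u, h w := by
    rw [← Finset.add_sum_erase _ _ (Finset.mem_univ u)]; ring
  rw [e]
  exact (Finset.abs_sum_le_sum_abs _ _).trans
    (Finset.sum_le_sum_of_subset_of_nonneg (Finset.erase_subset _ _) fun _ _ _ => abs_nonneg _)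

/-- The bias of the score of a row. -/
theorem abs_mean_rowTerm_le (hd : 2 ≤ d) {Θ A B : Matrix (Fin d) (Fin r) ℝ}
    {T₀ : Matrix (Fin d) (Fin d) ℝ} {β γ C₁ C₂ η : ℝ} (hβ : 0 ≤ β) (hγ : 0 ≤ γ) (hη : 0 ≤ η)
    (hC₂ : 0 ≤ C₂)
    (hB : ∀ j, l2 (B j) ≤ β / Real.sqrt d) (hΘ : ∀ i, l2 (Θ i) ≤ γ * Real.sqrt d)
    (hE : frobNorm (T₀ - Θ * A.transpose) ≤ C₁ * d * η)
    (hAB : ∑ j, l2 (B j - A j) ^ 2 ≤ (C₂ * η) ^ 2) (u : Fin d) (k : Fin r) :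
    |∑ z, comparisonMass (Θ * A.transpose) z * rowTerm B T₀ u (Θ u) z k| ≤
      4 / d * (β / Real.sqrt d) * ((C₁ + γ * C₂) * η) := by
  have h2 : (2 : ℝ) ≤ d := by exact_mod_cast hd
  have hd0 : (0 : ℝ) < d := by linarith
  have hsd : 0 < Real.sqrt d := Real.sqrt_pos.2 hd0
  have hsd2 : Real.sqrt d * Real.sqrt d = d := Real.mul_self_sqrt hd0.le
  have hd1 : (0 : ℝ) < d - 1 := by linarith
  set T := Θ * A.transpose with hT
  set f : Fin d → Fin d → ℝ → ℝ := fun w j y =>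
    (y - Real.sigmoid (B j ⬝ᵥ Θ u - T₀ w j)) * B j k with hf
  have e1 : ∀ z : Obs d, rowTerm B T₀ u (Θ u) z k =
      (if z.left = u then f z.right z.col z.outcome else 0) +
      (if z.right = u then f z.left z.col (1 - z.outcome) else 0) := by
    intro z
    rw [rowTerm, Pi.add_apply]
    congr 1 <;> split_ifs <;> simp [hf]
  simp_rw [e1]
  rw [sum_comparisonMass_mul_row T hd u f]
  set h : Fin d → Fin d → ℝ := fun j w =>
    Real.sigmoid (T u j - T w j) * f w j 1 + (1 - Real.sigmoid (T u j - T w j)) * f w j 0 with hh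
  -- The conditional mean residual is a difference of two values of `σ`, whose arguments differ by
  -- the initializer error at the opponent and by the error of the right factor paired with `Θ u`.
  have e2 : ∀ j w, |h j w| ≤
      β / Real.sqrt d * (γ * Real.sqrt d * l2 (B j - A j) + |(T₀ - T) w j|) := by
    intro j w
    have e3 : h j w = (Real.sigmoid (T u j - T w j) - Real.sigmoid (B j ⬝ᵥ Θ u - T₀ w j)) * B j k := by
      simp only [hh, hf]; ring
    rw [e3, abs_mul, mul_comm]
    refine mul_le_mul ((abs_le_l2 _ _).trans (hB j)) ?_ (abs_nonneg _) (by positivity)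
    refine (abs_sigmoid_sub_le _ _).trans ?_
    have e4 : T u j - T w j - (B j ⬝ᵥ Θ u - T₀ w j) = (T₀ - T) w j - (B j - A j) ⬝ᵥ Θ u := by
      rw [sub_dotProduct, hT, mul_transpose_apply Θ A u j, Matrix.sub_apply]; ring
    rw [e4]
    refine (abs_sub _ _).trans ?_
    have e5 := abs_dotProduct_le (B j - A j) (Θ u)
    have e6 := mul_le_mul_of_nonneg_left (hΘ u) (l2_nonneg (B j - A j))
    linarith
  have hS1 : ∑ j, l2 (B j - A j) ≤ Real.sqrt d * (C₂ * η) := by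
    have e := sum_abs_le_sqrt_card_mul fun j => l2 (B j - A j)
    simp only [abs_of_nonneg (l2_nonneg _), Fintype.card_fin] at e
    refine e.trans (mul_le_mul_of_nonneg_left ?_ hsd.le)
    refine le_of_sq_le_sq ?_ (by positivity)
    rw [l2_sq]; exact hAB
  -- Cauchy-Schwarz over all `d²` entries: only the Frobenius error of the initializer is needed.
  have hS2 : ∑ j, ∑ w, |(T₀ - T) w j| ≤ d * (C₁ * d * η) := by
    rw [Finset.sum_comm]
    have e : ∀ w, ∑ j, |(T₀ - T) w j| ≤ Real.sqrt d * l2 ((T₀ - T) w) := by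
      intro w
      have := sum_abs_le_sqrt_card_mul ((T₀ - T) w)
      rwa [Fintype.card_fin] at this
    refine (Finset.sum_le_sum fun w _ => e w).trans ?_
    rw [← Finset.mul_sum]
    have e' := sum_abs_le_sqrt_card_mul fun w => l2 ((T₀ - T) w)
    simp only [abs_of_nonneg (l2_nonneg _), Fintype.card_fin] at e'
    have e'' : l2 (fun w => l2 ((T₀ - T) w)) = frobNorm (T₀ - T) := by
      refine (sq_eq_sq₀ (l2_nonneg _) (frobNorm_nonneg _)).1 ?_
      rw [l2_sq, frobNorm_sq]
    rw [e''] at e'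
    calc _ ≤ Real.sqrt d * (Real.sqrt d * frobNorm (T₀ - T)) := by gcongr
      _ = d * frobNorm (T₀ - T) := by rw [← mul_assoc, hsd2]
      _ ≤ _ := by gcongr
  have hS : |∑ j, (∑ w, h j w - h j u)| ≤
      β / Real.sqrt d * (d ^ 2 * ((C₁ + γ * C₂) * η)) := by
    calc |∑ j, (∑ w, h j w - h j u)| ≤ ∑ j, ∑ w, |h j w| :=
          (Finset.abs_sum_le_sum_abs _ _).trans
            (Finset.sum_le_sum fun j _ => abs_sum_sub_le_sum_abs _ _)
      _ ≤ ∑ j, ∑ w, β / Real.sqrt d * (γ * Real.sqrt d * l2 (B j - A j) + |(T₀ - T) w j|) :=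
          Finset.sum_le_sum fun j _ => Finset.sum_le_sum fun w _ => e2 j w
      _ = β / Real.sqrt d * (d * (γ * Real.sqrt d) * ∑ j, l2 (B j - A j) +
          ∑ j, ∑ w, |(T₀ - T) w j|) := by
          simp_rw [← Finset.mul_sum, Finset.sum_add_distrib]
          congr 2
          simp only [Finset.sum_const, Finset.card_univ, Fintype.card_fin, nsmul_eq_mul]
          rw [Finset.mul_sum]
          exact Finset.sum_congr rfl fun j _ => by ring
      _ ≤ β / Real.sqrt d * (d * (γ * Real.sqrt d) * (Real.sqrt d * (C₂ * η)) +
          d * (C₁ * d * η)) := by gcongr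
      _ = _ := by
          congr 1
          rw [show d * (γ * Real.sqrt d) * (Real.sqrt d * (C₂ * η)) =
            d * γ * (Real.sqrt d * Real.sqrt d) * (C₂ * η) by ring, hsd2]
          ring
  have hC : 0 ≤ β / Real.sqrt d * ((C₁ + γ * C₂) * η) := by
    have := (abs_nonneg _).trans hS
    have h3 : β / Real.sqrt d * (d ^ 2 * ((C₁ + γ * C₂) * η)) =
      d ^ 2 * (β / Real.sqrt d * ((C₁ + γ * C₂) * η)) := by ring
    rw [h3] at this
    exact nonneg_of_mul_nonneg_right this (by positivity)
  rw [abs_mul, abs_of_nonneg (by positivity : 0 ≤ 2 / ((d : ℝ) ^ 2 * (d - 1)))]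
  refine (mul_le_mul_of_nonneg_left hS (by positivity)).trans ?_
  have e7 : 2 / ((d : ℝ) ^ 2 * (d - 1)) * (β / Real.sqrt d * (d ^ 2 * ((C₁ + γ * C₂) * η))) =
      2 / (d - 1) * (β / Real.sqrt d * ((C₁ + γ * C₂) * η)) := by field_simp
  rw [e7, mul_assoc]
  refine mul_le_mul_of_nonneg_right ?_ hC
  rw [div_le_div_iff₀ hd1 hd0]; linarith

/-- The expected Gram matrix of a row. -/
theorem mean_rowGram (T : Matrix (Fin d) (Fin d) ℝ) (hd : 2 ≤ d)
    (B : Matrix (Fin d) (Fin r) ℝ) (u : Fin d) (k l : Fin r) :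
    ∑ z : Obs d, comparisonMass T z * ((if z.left = u then B z.col k * B z.col l else 0) +
      (if z.right = u then B z.col k * B z.col l else 0)) =
    2 / (d : ℝ) ^ 2 * ∑ j, B j k * B j l := by
  have h2 : (2 : ℝ) ≤ d := by exact_mod_cast hd
  have hd1 : (0 : ℝ) < d - 1 := by linarith
  rw [sum_comparisonMass_mul_row T hd u fun _ j _ => B j k * B j l]
  have e : ∀ p x : ℝ, p * x + (1 - p) * x = x := fun p x => by ring
  simp_rw [e]
  simp only [Finset.sum_const, Finset.card_univ, Fintype.card_fin, nsmul_eq_mul]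
  have e2 : ∀ x : ℝ, d * x - x = (d - 1) * x := fun x => by ring
  simp_rw [e2, ← Finset.mul_sum]
  field_simp

theorem l2_mulVec_sq_eq_quadForm {m : ℕ} (B : Matrix (Fin m) (Fin r) ℝ) (v : Fin r → ℝ) :
    l2 (B.mulVec v) ^ 2 = ∑ k, ∑ l, (∑ j, B j k * B j l) * (v k * v l) := by
  have hsq : ∀ j, (B.mulVec v) j ^ 2 = ∑ k, ∑ l, B j k * B j l * (v k * v l) := by
    intro j
    rw [Matrix.mulVec, sq, dotProduct, Finset.sum_mul_sum]
    exact Finset.sum_congr rfl fun k _ => Finset.sum_congr rfl fun l _ => by ring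
  simp_rw [l2_sq, hsq, Finset.sum_mul]
  rw [Finset.sum_comm]
  exact Finset.sum_congr rfl fun k _ => Finset.sum_comm

/-- With high probability every row score has a unique root, close to the row of the signal. -/
theorem row_step (hr : 1 ≤ r) (hd : 2 ≤ d) {ι : Type*} [Fintype ι] [DecidableEq ι]
    {Θ A B : Matrix (Fin d) (Fin r) ℝ} {T₀ : Matrix (Fin d) (Fin d) ℝ}
    {β γ C₀ C₁ C₂ D η n L q : ℝ} (hβ : 0 < β) (hγ : 0 ≤ γ) (hη : 0 < η) (hη1 : η ≤ 1)
    (hC₁ : 0 ≤ C₁) (hC₂ : 0 ≤ C₂) (hq : 0 < q) (hn0 : 0 < n) (hL : n * η ^ 2 = d * L)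
    (hn : (Fintype.card ι : ℝ) ≤ n) (hn' : n / 6 ≤ Fintype.card ι)
    (hB : ∀ j, l2 (B j) ≤ β / Real.sqrt d) (hΘ : ∀ i, l2 (Θ i) ≤ γ * Real.sqrt d)
    (hT₀ : ∀ i j, |T₀ i j| ≤ C₀)
    (hE : frobNorm (T₀ - Θ * A.transpose) ≤ C₁ * d * η)
    (hAB : ∑ j, l2 (B j - A j) ^ 2 ≤ (C₂ * η) ^ 2)
    (hlow : ∀ x, 1 / 2 * l2 x ≤ l2 (B.mulVec x))
    (hsmall : r * β ^ 2 * q * η ≤ 1 / 24)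
    (hD : 25 * (r * β * (4 * (C₁ + γ * C₂) + q)) ≤
      Real.sigmoid (-(β * γ + C₀ + 1)) ^ 2 * D)
    (hDη : β * D * η ≤ 1) :
    wprob (prodWeight (comparisonMass (Θ * A.transpose))) {y : ι → Obs d | ¬ ∀ u, ∃ θ,
        ∑ i, rowTerm B T₀ u θ (y i) = 0 ∧
        (∀ θ', ∑ i, rowTerm B T₀ u θ' (y i) = 0 → θ' = θ) ∧
        l2 (θ - Θ u) ≤ Real.sqrt d * (D * η)} ≤
      4 * r ^ 2 * d * Real.exp (-((q - 2) * L)) := by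
  have h2 : (2 : ℝ) ≤ d := by exact_mod_cast hd
  have hd0 : (0 : ℝ) < d := by linarith
  have hr1 : (1 : ℝ) ≤ r := by exact_mod_cast hr
  have hsd : 0 < Real.sqrt d := Real.sqrt_pos.2 hd0
  have hsd2 : Real.sqrt d * Real.sqrt d = d := Real.mul_self_sqrt hd0.le
  set T := Θ * A.transpose with hT
  set w := comparisonMass T with hw
  have hw0 : ∀ z, 0 ≤ w z := comparisonMass_nonneg T
  have hw1 : ∑ z, w z = 1 := sum_comparisonMass T hd
  set b := β / Real.sqrt d with hb
  have hb0 : 0 < b := by positivity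
  have hb2 : b ^ 2 = β ^ 2 / d := by rw [hb, div_pow, Real.sq_sqrt hd0.le]
  set e := Real.exp (-((q - 2) * L)) with he
  let G : Fin d → Fin r → Fin r → Obs d → ℝ := fun u k l z =>
    (if z.left = u then B z.col k * B z.col l else 0) +
      (if z.right = u then B z.col k * B z.col l else 0)
  let F1 : Fin d × Fin r → Set (ι → Obs d) := fun p => {y | b * (q * (n / d) * η) <
    |∑ i, rowTerm B T₀ p.1 (Θ p.1) (y i) p.2 -
      Fintype.card ι * ∑ z, w z * rowTerm B T₀ p.1 (Θ p.1) z p.2|}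
  let F2 : Fin d × Fin r × Fin r → Set (ι → Obs d) := fun p => {y | b ^ 2 * (q * (n / d) * η) <
    |∑ i, G p.1 p.2.1 p.2.2 (y i) - Fintype.card ι * ∑ z, w z * G p.1 p.2.1 p.2.2 z|}
  have hF1 : ∀ p, wprob (prodWeight w) (F1 p) ≤ 2 * e := by
    intro p
    have hm := row_moments T hd p.1 fun z => abs_rowTerm_le B T₀ p.1 (Θ p.1) hB z p.2
    exact wprob_abs_deviation_le hw0 hw1 (fun z => rowTerm B T₀ p.1 (Θ p.1) z p.2) hb0 hd0
      hη.le hη1 hL hn hm.1 hm.2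
  have hF2 : ∀ p, wprob (prodWeight w) (F2 p) ≤ 2 * e := by
    intro p
    have hG : ∀ z : Obs d, |G p.1 p.2.1 p.2.2 z| ≤ b ^ 2 *
        ((if z.left = p.1 then 1 else 0) + (if z.right = p.1 then 1 else 0)) := by
      intro z
      have h3 : |B z.col p.2.1 * B z.col p.2.2| ≤ b ^ 2 := by
        rw [abs_mul, sq]
        exact mul_le_mul ((abs_le_l2 _ _).trans (hB _)) ((abs_le_l2 _ _).trans (hB _))
          (abs_nonneg _) hb0.le
      rw [mul_add]
      refine (abs_add_le _ _).trans (add_le_add ?_ ?_)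
      · split_ifs
        · rwa [mul_one]
        · simp
      · split_ifs
        · rwa [mul_one]
        · simp
    have hm := row_moments T hd p.1 hG
    exact wprob_abs_deviation_le hw0 hw1 (G p.1 p.2.1 p.2.2) (by positivity) hd0
      hη.le hη1 hL hn hm.1 hm.2
  have hpw := prodWeight_nonneg (ι := ι) hw0
  -- There are `d r` score events and `d r²` Gram events, each of probability at most `2 e`.
  have hbad : wprob (prodWeight w) ((⋃ p, F1 p) ∪ ⋃ p, F2 p) ≤ 4 * r ^ 2 * d * e := by
    refine (wprob_union_le hpw _ _).trans ((add_le_add (wprob_iUnion_le hpw F1 hF1)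
      (wprob_iUnion_le hpw F2 hF2)).trans ?_)
    simp only [Fintype.card_prod, Fintype.card_fin, Nat.cast_mul]
    have he0 : 0 < e := Real.exp_pos _
    have h3 : (r : ℝ) ≤ r ^ 2 := by nlinarith
    have h4 : 0 ≤ (d : ℝ) * e := by positivity
    nlinarith [mul_le_mul_of_nonneg_right h3 h4]
  refine (wprob_mono hpw ?_).trans hbad
  intro y hy
  by_contra hgood
  refine hy fun u => ?_
  simp only [Set.mem_union, Set.mem_iUnion, not_or, not_exists] at hgood
  obtain ⟨hg1, hg2⟩ := hgood
  have hg1' : ∀ k, |∑ i, rowTerm B T₀ u (Θ u) (y i) k -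
      Fintype.card ι * ∑ z, w z * rowTerm B T₀ u (Θ u) z k| ≤ b * (q * (n / d) * η) :=
    fun k => not_lt.1 (hg1 (u, k))
  have hg2' : ∀ k l, |∑ i, G u k l (y i) - Fintype.card ι * (2 / (d : ℝ) ^ 2 * ∑ j, B j k * B j l)| ≤
      b ^ 2 * (q * (n / d) * η) := by
    intro k l
    have h3 : |∑ i, G u k l (y i) - Fintype.card ι * ∑ z, w z * G u k l z| ≤
      b ^ 2 * (q * (n / d) * η) := not_lt.1 (hg2 (u, k, l))
    rwa [show ∑ z, w z * G u k l z = _ from mean_rowGram T hd B u k l] at h3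
  -- The mean Gram matrix contributes `(n / 6) (1 / (2 d²)) = n / (12 d²)`, and `hsmall` lets the
  -- deviation consume at most half of it.
  have hgram : ∀ v, n / (24 * d ^ 2) * l2 v ^ 2 ≤
      ∑ p : ι × Bool, (rowCov B u (y p.1, p.2) ⬝ᵥ v) ^ 2 := by
    intro v
    rw [sum_rowCov_dotProduct_sq]
    have h3 : 1 / (2 * (d : ℝ) ^ 2) * l2 v ^ 2 ≤
        ∑ k, ∑ l, (2 / (d : ℝ) ^ 2 * ∑ j, B j k * B j l) * (v k * v l) := by
      have e3 : ∑ k, ∑ l, (2 / (d : ℝ) ^ 2 * ∑ j, B j k * B j l) * (v k * v l) =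
          2 / (d : ℝ) ^ 2 * l2 (B.mulVec v) ^ 2 := by
        rw [l2_mulVec_sq_eq_quadForm, Finset.mul_sum]
        refine Finset.sum_congr rfl fun k _ => ?_
        rw [Finset.mul_sum]
        exact Finset.sum_congr rfl fun l _ => by ring
      rw [e3]
      have e4 := pow_le_pow_left₀ (mul_nonneg (by norm_num) (l2_nonneg v)) (hlow v) 2
      calc _ = 2 / (d : ℝ) ^ 2 * (1 / 2 * l2 v) ^ 2 := by field_simp
        _ ≤ _ := by gcongr
    refine le_trans (mul_le_mul_of_nonneg_right ?_ (sq_nonneg _))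
      (quadForm_lower (Nat.cast_nonneg _) hg2' v h3)
    have e5 : r * (b ^ 2 * (q * (n / d) * η)) = n / d ^ 2 * (r * β ^ 2 * q * η) := by
      rw [hb2]; field_simp
    have e6 : n / d ^ 2 * (r * β ^ 2 * q * η) ≤ n / d ^ 2 * (1 / 24) := by gcongr
    have e7 : n / 6 * (1 / (2 * (d : ℝ) ^ 2)) ≤ Fintype.card ι * (1 / (2 * (d : ℝ) ^ 2)) := by
      gcongr
    have e8 : n / (24 * (d : ℝ) ^ 2) = n / 6 * (1 / (2 * (d : ℝ) ^ 2)) - n / d ^ 2 * (1 / 24) := by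
      field_simp; norm_num
    rw [e5, e8]
    linarith
  have hcov : ∀ p : ι × Bool, l2 (rowCov B u (y p.1, p.2)) ≤ b := by
    intro p
    rw [rowCov]
    split_ifs
    all_goals first | exact hB _ | (rw [l2_zero]; exact hb0.le)
  have hscore : l2 (∑ i, rowTerm B T₀ u (Θ u) (y i)) ≤
      r * (n / d * b * (4 * (C₁ + γ * C₂) + q) * η) := by
    have h3 : ∀ k, |(∑ i, rowTerm B T₀ u (Θ u) (y i)) k| ≤
        n / d * b * (4 * (C₁ + γ * C₂) + q) * η := by
      intro k
      rw [Finset.sum_apply]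
      have h4 := hg1' k
      have h5 := abs_mean_rowTerm_le hd hβ.le hγ hη.le hC₂ hB hΘ hE hAB u k
      have h6 := mul_le_mul hn h5 (abs_nonneg _) hn0.le
      rw [← abs_of_nonneg (Nat.cast_nonneg (α := ℝ) (Fintype.card ι)), ← abs_mul] at h6
      have h7 := abs_sub_abs_le_abs_sub (∑ i, rowTerm B T₀ u (Θ u) (y i) k)
        (Fintype.card ι * ∑ z, w z * rowTerm B T₀ u (Θ u) z k)
      calc _ ≤ n * (4 / d * b * ((C₁ + γ * C₂) * η)) + b * (q * (n / d) * η) := by linarith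
        _ = _ := by ring
    simpa using l2_le_card_mul h3
  have hpos : 0 < 4 * (C₁ + γ * C₂) + q := by positivity
  have hD0 : 0 < D := by
    have h3 : 0 < 25 * (r * β * (4 * (C₁ + γ * C₂) + q)) := by positivity
    exact pos_of_mul_pos_right (h3.trans_le hD) (sq_nonneg _)
  simp_rw [sum_rowTerm_eq_score] at hscore ⊢
  -- At the reference row the linear predictor is at most `(β / √d) (γ √d)` and the offset at most
  -- `C₀`. The curvature constant requires 24 where `hD` supplies 25, which makes the inequality
  -- strict.
  refine exists_score_root _ _ _ (M := β * γ + C₀) (κ := n / (24 * d ^ 2)) (by positivity) ?_ ?_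
    (by positivity) hgram ?_
  · intro p
    refine (abs_sub _ _).trans (add_le_add ((abs_dotProduct_le _ _).trans ?_) (hT₀ _ _))
    calc _ ≤ b * (γ * Real.sqrt d) := mul_le_mul (hcov p) (hΘ u) (l2_nonneg _) hb0.le
      _ = β * γ := by rw [hb]; field_simp
  · intro p
    calc _ ≤ b * (Real.sqrt d * (D * η)) := by
          have := hcov p
          gcongr
      _ = β * D * η := by rw [hb]; field_simp
      _ ≤ 1 := hDη
  · refine hscore.trans_lt ?_
    set m := Real.sigmoid (-(β * γ + C₀ + 1)) ^ 2
    have e3 : m * (n / (24 * d ^ 2)) * (Real.sqrt d * (D * η)) =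
        n * Real.sqrt d * η / (24 * d ^ 2) * (m * D) := by ring
    have e4 : r * (n / d * b * (4 * (C₁ + γ * C₂) + q) * η) =
        n * Real.sqrt d * η / (24 * d ^ 2) * (24 * (r * β * (4 * (C₁ + γ * C₂) + q))) := by
      rw [hb]; field_simp; rw [sq, hsd2]
    rw [e3, e4]
    refine mul_lt_mul_of_pos_left (lt_of_lt_of_le ?_ hD) (by positivity)
    have : 0 < r * β * (4 * (C₁ + γ * C₂) + q) := by positivity
    linarith

end Row

/-! ### The column step -/

section Col
variable {d r : ℕ}

/-- The contribution of one comparison to the score of the column `j`. -/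
noncomputable def colTerm (Θ : Matrix (Fin d) (Fin r) ℝ) (j : Fin d) (a : Fin r → ℝ) (z : Obs d) :
    Fin r → ℝ :=
  if z.col = j then
    (z.outcome - Real.sigmoid ((Θ z.left - Θ z.right) ⬝ᵥ a)) • (Θ z.left - Θ z.right) else 0

theorem colScore_eq_sum_colTerm {n : ℕ} (Θ : Matrix (Fin d) (Fin r) ℝ)
    (φ : Fin n → Fin 3) (z : Fin n → Obs d) (j : Fin d) (a : Fin r → ℝ) :
    colScore Θ φ z j a = ∑ i : {i // φ i = 2}, colTerm Θ j a (z i) := by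
  rw [colScore, ← Finset.filter_filter, Finset.sum_filter, ← Finset.sum_subtype_eq_sum_filter,
    Finset.subtype_univ]
  rfl

/-- The covariates of the column score. -/
def colCov (Θ : Matrix (Fin d) (Fin r) ℝ) (j : Fin d) (z : Obs d) : Fin r → ℝ :=
  if z.col = j then Θ z.left - Θ z.right else 0

theorem sum_colTerm_eq_score {ι : Type*} [Fintype ι] (Θ : Matrix (Fin d) (Fin r) ℝ) (j : Fin d)
    (y : ι → Obs d) (a : Fin r → ℝ) :
    ∑ i, colTerm Θ j a (y i) =
      score (fun i => colCov Θ j (y i)) (fun i => (y i).outcome) (fun _ => 0) a := by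
  rw [score]
  refine Finset.sum_congr rfl fun i _ => ?_
  rw [colTerm, colCov]
  split_ifs <;> simp

theorem sum_colCov_dotProduct_sq {ι : Type*} [Fintype ι] (Θ : Matrix (Fin d) (Fin r) ℝ)
    (j : Fin d) (y : ι → Obs d) (v : Fin r → ℝ) :
    ∑ i, (colCov Θ j (y i) ⬝ᵥ v) ^ 2 =
      ∑ k, ∑ l, (∑ i, colCov Θ j (y i) k * colCov Θ j (y i) l) * (v k * v l) := by
  have hsq : ∀ x : Fin r → ℝ, (x ⬝ᵥ v) ^ 2 = ∑ k, ∑ l, x k * x l * (v k * v l) := by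
    intro x
    rw [sq, dotProduct, Finset.sum_mul_sum]
    exact Finset.sum_congr rfl fun k _ => Finset.sum_congr rfl fun l _ => by ring
  simp_rw [hsq, Finset.sum_mul]
  rw [Finset.sum_comm]
  exact Finset.sum_congr rfl fun k _ => Finset.sum_comm

/-- Moments of a function that vanishes unless the comparison is in the column `j`. -/
theorem col_moments (T : Matrix (Fin d) (Fin d) ℝ) (hd : 2 ≤ d) (j : Fin d) {X : Obs d → ℝ}
    {b : ℝ} (hX : ∀ z : Obs d, |X z| ≤ b * (if z.col = j then 1 else 0)) :
    (∀ z, comparisonMass T z ≠ 0 → |X z| ≤ b) ∧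
      ∑ z, comparisonMass T z * X z ^ 2 ≤ b ^ 2 * (2 / d) := by
  have hb : 0 ≤ b := by
    have := (abs_nonneg _).trans (hX (j, j, j, true))
    simpa [Obs.col] using this
  constructor
  · intro z _
    have h := hX z
    split_ifs at h <;> linarith
  · have h1 : ∑ z, comparisonMass T z * X z ^ 2 ≤ b ^ 2 * (1 / d) := by
      rw [← sum_comparisonMass_mul_col_indicator T hd j, Finset.mul_sum]
      simp_rw [mul_left_comm (b ^ 2)]
      refine sum_comparisonMass_mul_mono T fun z hz => ?_
      have h := pow_le_pow_left₀ (abs_nonneg _) (hX z) 2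
      rw [sq_abs] at h
      split_ifs at h ⊢ <;> simpa using h
    refine h1.trans ?_
    gcongr
    norm_num

theorem pair_weight_mul_count (hd : 2 ≤ d) :
    (1 / (d : ℝ)) * (1 / (d.choose 2 : ℝ)) * ∑ a : Fin d, ∑ b : Fin d,
      (if a < b then (1 : ℝ) else 0) = 1 / d := by
  have h := sum_comparisonMass_mul_col_indicator (0 : Matrix (Fin d) (Fin d) ℝ) hd ⟨0, by omega⟩
  rw [sum_comparisonMass_mul_col _ _ fun _ _ _ => 1] at h
  simpa using h

theorem l2_row_sub_le {Θ : Matrix (Fin d) (Fin r) ℝ} {b : ℝ} (h : ∀ i, l2 (Θ i) ≤ b)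
    (i k : Fin d) : l2 (Θ i - Θ k) ≤ 2 * b :=
  (l2_sub_le _ _).trans (by linarith [h i, h k])

/-- The bias of the score of a column. -/
theorem abs_mean_colTerm_le (hd : 2 ≤ d) {Θ A X : Matrix (Fin d) (Fin r) ℝ} {b ρ s : ℝ}
    (hρ : ∀ j, l2 (A j) ≤ ρ) (hX : ∀ i, l2 (X i) ≤ b) (hs : ∀ i, l2 (X i - Θ i) ≤ s)
    (j : Fin d) (k : Fin r) :
    |∑ z, comparisonMass (Θ * A.transpose) z * colTerm X j (A j) z k| ≤
      1 / d * (2 * s * ρ * (2 * b)) := by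
  set T := Θ * A.transpose with hT
  set f : Fin d → Fin d → ℝ → ℝ := fun u v y =>
    (y - Real.sigmoid ((X u - X v) ⬝ᵥ A j)) * (X u - X v) k with hf
  have e1 : ∀ z : Obs d, colTerm X j (A j) z k =
      if z.col = j then f z.left z.right z.outcome else 0 := by
    intro z
    rw [colTerm]
    split_ifs <;> simp [hf]
  simp_rw [e1]
  have e2 : ∀ u v, |Real.sigmoid (T u j - T v j) * f u v 1 +
      (1 - Real.sigmoid (T u j - T v j)) * f u v 0| ≤ 2 * s * ρ * (2 * b) := by
    intro u v
    have e3 : Real.sigmoid (T u j - T v j) * f u v 1 +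
        (1 - Real.sigmoid (T u j - T v j)) * f u v 0 =
        (Real.sigmoid (T u j - T v j) - Real.sigmoid ((X u - X v) ⬝ᵥ A j)) * (X u - X v) k := by
      simp only [hf]; ring
    rw [e3, abs_mul]
    have hb0 : 0 ≤ s := (l2_nonneg _).trans (hs u)
    have hρ0 : 0 ≤ ρ := (l2_nonneg _).trans (hρ j)
    refine mul_le_mul ?_ ((abs_le_l2 _ _).trans (l2_row_sub_le hX u v)) (abs_nonneg _)
      (by positivity)
    refine (abs_sigmoid_sub_le _ _).trans ?_
    -- At the row of `A` the predictor errs only through the covariates. Their error is already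
    -- uniform over rows, so no averaging is needed for this bias.
    have e4 : T u j - T v j - (X u - X v) ⬝ᵥ A j = -(((X u - Θ u) - (X v - Θ v)) ⬝ᵥ A j) := by
      rw [hT, mul_transpose_apply, mul_transpose_apply, dotProduct_comm (A j), dotProduct_comm (A j)]
      simp only [sub_dotProduct]; ring
    rw [e4, abs_neg]
    refine (abs_dotProduct_le _ _).trans (mul_le_mul ?_ (hρ j) (l2_nonneg _) (by positivity))
    exact (l2_sub_le _ _).trans (by linarith [hs u, hs v])
  have e5 := congrArg (· * (2 * s * ρ * (2 * b))) (pair_weight_mul_count hd)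
  simp only [mul_assoc ((1 / (d : ℝ)) * (1 / (d.choose 2 : ℝ)))] at e5
  rw [sum_comparisonMass_mul_col T j f, abs_mul,
    abs_of_nonneg (by positivity : 0 ≤ (1 / (d : ℝ)) * (1 / (d.choose 2 : ℝ))), ← e5]
  refine mul_le_mul_of_nonneg_left ?_ (by positivity)
  rw [Finset.sum_mul]
  refine (Finset.abs_sum_le_sum_abs _ _).trans (Finset.sum_le_sum fun u _ => ?_)
  rw [Finset.sum_mul]
  refine (Finset.abs_sum_le_sum_abs _ _).trans (Finset.sum_le_sum fun v _ => ?_)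
  split_ifs
  · rw [one_mul]; exact e2 u v
  · simp

/-- The expected Gram matrix of a column. -/
theorem mean_colGram (T : Matrix (Fin d) (Fin d) ℝ) (hd : 2 ≤ d)
    {X : Matrix (Fin d) (Fin r) ℝ} (hX : ∀ k, ∑ i, X i k = 0) (j : Fin d) (k l : Fin r) :
    ∑ z : Obs d, comparisonMass T z * (colCov X j z k * colCov X j z l) =
    2 / ((d : ℝ) * (d - 1)) * ∑ i, X i k * X i l := by
  have h2 : (2 : ℝ) ≤ d := by exact_mod_cast hd
  have hd0 : (0 : ℝ) < d := by linarith
  have hd1 : (0 : ℝ) < d - 1 := by linarith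
  have e1 : ∀ z : Obs d, colCov X j z k * colCov X j z l =
      if z.col = j then (X z.left - X z.right) k * (X z.left - X z.right) l else 0 := by
    intro z
    rw [colCov]
    split_ifs <;> simp
  simp_rw [e1]
  rw [sum_comparisonMass_mul_col T j fun u v _ => (X u - X v) k * (X u - X v) l, pair_weight hd]
  have e : ∀ p x : ℝ, p * x + (1 - p) * x = x := fun p x => by ring
  simp_rw [e]
  have h3 := two_mul_sum_lt (fun u v => (X u - X v) k * (X u - X v) l) fun u v => by
    simp only [Pi.sub_apply]; ring
  -- Centering kills the cross terms, so the Gram matrix of the differences is a multiple of that of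
  -- the rows themselves.
  have h4 : ∑ u, ∑ v, (X u - X v) k * (X u - X v) l = 2 * (d * ∑ i, X i k * X i l) := by
    have h5 : ∀ u v, (X u - X v) k * (X u - X v) l =
        X u k * X u l + X v k * X v l - X u k * X v l - X u l * X v k := by
      intro u v; simp only [Pi.sub_apply]; ring
    simp_rw [h5, Finset.sum_sub_distrib, Finset.sum_add_distrib, ← Finset.mul_sum, hX]
    simp only [mul_zero, Finset.sum_const_zero, sub_zero, Finset.sum_const, Finset.card_univ,
      Fintype.card_fin, nsmul_eq_mul]
    simp_rw [mul_left_comm _ (d : ℝ), ← Finset.mul_sum]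
    ring
  rw [h4] at h3
  simp only [sub_self, Pi.zero_apply, mul_zero, Finset.sum_const_zero, sub_zero] at h3
  rw [mul_left_cancel₀ two_ne_zero h3]
  field_simp

/-- With high probability every column score has a root, and all its roots are close to the row of
the right factor of the signal. -/
theorem col_step (hr : 1 ≤ r) (hd : 2 ≤ d) {ι : Type*} [Fintype ι] [DecidableEq ι]
    {Θ A X : Matrix (Fin d) (Fin r) ℝ}
    {β g c D₂ D η n L q : ℝ} (hβ : 0 < β) (hg : 0 < g) (hc : 0 < c) (hD₂ : 0 ≤ D₂)
    (hη : 0 < η) (hη1 : η ≤ 1) (hq : 0 < q) (hn0 : 0 < n) (hL : n * η ^ 2 = d * L)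
    (hn : (Fintype.card ι : ℝ) ≤ n) (hn' : n / 6 ≤ Fintype.card ι)
    (hA : ∀ j, l2 (A j) ≤ β / Real.sqrt d) (hX : ∀ i, l2 (X i) ≤ g * Real.sqrt d)
    (hXΘ : ∀ i, l2 (X i - Θ i) ≤ Real.sqrt d * (D₂ * η)) (hcent : ∀ k, ∑ i, X i k = 0)
    (hlow : ∀ x, c / 2 * d * l2 x ≤ l2 (X.mulVec x))
    (hsmall : r * (4 * g ^ 2) * q * η ≤ c ^ 2 / 24)
    (hD : 50 * (r * g * (2 * β * D₂ + q)) ≤ Real.sigmoid (-(2 * g * β + 1)) ^ 2 * (c ^ 2 * D))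
    (hDη : 2 * g * D * η ≤ 1) :
    wprob (prodWeight (comparisonMass (Θ * A.transpose))) {y : ι → Obs d | ¬ ∀ j, ∃ a,
        ∑ i, colTerm X j a (y i) = 0 ∧
        (∀ a', ∑ i, colTerm X j a' (y i) = 0 → a' = a) ∧
        l2 (a - A j) ≤ D * η / Real.sqrt d} ≤
      4 * r ^ 2 * d * Real.exp (-((q - 2) * L)) := by
  have h2 : (2 : ℝ) ≤ d := by exact_mod_cast hd
  have hd0 : (0 : ℝ) < d := by linarith
  have hd1 : (0 : ℝ) < d - 1 := by linarith
  have hr1 : (1 : ℝ) ≤ r := by exact_mod_cast hr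
  have hsd : 0 < Real.sqrt d := Real.sqrt_pos.2 hd0
  have hsd2 : Real.sqrt d * Real.sqrt d = d := Real.mul_self_sqrt hd0.le
  set T := Θ * A.transpose with hT
  set w := comparisonMass T with hw
  have hw0 : ∀ z, 0 ≤ w z := comparisonMass_nonneg T
  have hw1 : ∑ z, w z = 1 := sum_comparisonMass T hd
  set b := 2 * (g * Real.sqrt d) with hb
  have hb0 : 0 < b := by positivity
  have hb2 : b ^ 2 = 4 * g ^ 2 * d := by rw [hb, mul_pow, mul_pow, Real.sq_sqrt hd0.le]; ring
  set e := Real.exp (-((q - 2) * L)) with he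
  have hcov : ∀ j z, l2 (colCov X j z) ≤ b := by
    intro j z
    rw [colCov]
    split_ifs
    · exact l2_row_sub_le hX _ _
    · rw [l2_zero]; exact hb0.le
  let G : Fin d → Fin r → Fin r → Obs d → ℝ := fun j k l z => colCov X j z k * colCov X j z l
  let F1 : Fin d × Fin r → Set (ι → Obs d) := fun p => {y | b * (q * (n / d) * η) <
    |∑ i, colTerm X p.1 (A p.1) (y i) p.2 -
      Fintype.card ι * ∑ z, w z * colTerm X p.1 (A p.1) z p.2|}
  let F2 : Fin d × Fin r × Fin r → Set (ι → Obs d) := fun p => {y | b ^ 2 * (q * (n / d) * η) <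
    |∑ i, G p.1 p.2.1 p.2.2 (y i) - Fintype.card ι * ∑ z, w z * G p.1 p.2.1 p.2.2 z|}
  have hF1 : ∀ p, wprob (prodWeight w) (F1 p) ≤ 2 * e := by
    intro p
    have hm := col_moments T hd p.1 (b := b) (X := fun z => colTerm X p.1 (A p.1) z p.2) fun z => by
      simp only [colTerm]
      split_ifs
      · rw [Pi.smul_apply, smul_eq_mul, abs_mul, mul_one]
        exact (mul_le_of_le_one_left (abs_nonneg _) (abs_outcome_sub_sigmoid_le _ _).1).trans
          ((abs_le_l2 _ _).trans (l2_row_sub_le hX _ _))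
      · simp
    exact wprob_abs_deviation_le hw0 hw1 (fun z => colTerm X p.1 (A p.1) z p.2) hb0 hd0
      hη.le hη1 hL hn hm.1 hm.2
  have hF2 : ∀ p, wprob (prodWeight w) (F2 p) ≤ 2 * e := by
    intro p
    have hm := col_moments T hd p.1 (b := b ^ 2) (X := G p.1 p.2.1 p.2.2) fun z => by
      by_cases hz : z.col = p.1
      · rw [if_pos hz, mul_one, abs_mul, sq]
        exact mul_le_mul ((abs_le_l2 _ _).trans (hcov _ _)) ((abs_le_l2 _ _).trans (hcov _ _))
          (abs_nonneg _) hb0.le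
      · simp [G, colCov, hz]
    exact wprob_abs_deviation_le hw0 hw1 (G p.1 p.2.1 p.2.2) (by positivity) hd0
      hη.le hη1 hL hn hm.1 hm.2
  have hpw := prodWeight_nonneg (ι := ι) hw0
  have hbad : wprob (prodWeight w) ((⋃ p, F1 p) ∪ ⋃ p, F2 p) ≤ 4 * r ^ 2 * d * e := by
    refine (wprob_union_le hpw _ _).trans ((add_le_add (wprob_iUnion_le hpw F1 hF1)
      (wprob_iUnion_le hpw F2 hF2)).trans ?_)
    simp only [Fintype.card_prod, Fintype.card_fin, Nat.cast_mul]
    have he0 : 0 < e := Real.exp_pos _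
    have h3 : (r : ℝ) ≤ r ^ 2 := by nlinarith
    have h4 : 0 ≤ (d : ℝ) * e := by positivity
    nlinarith [mul_le_mul_of_nonneg_right h3 h4]
  refine (wprob_mono hpw ?_).trans hbad
  intro y hy
  by_contra hgood
  refine hy fun j => ?_
  simp only [Set.mem_union, Set.mem_iUnion, not_or, not_exists] at hgood
  obtain ⟨hg1, hg2⟩ := hgood
  have hg1' : ∀ k, |∑ i, colTerm X j (A j) (y i) k -
      Fintype.card ι * ∑ z, w z * colTerm X j (A j) z k| ≤ b * (q * (n / d) * η) :=
    fun k => not_lt.1 (hg1 (j, k))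
  have hg2' : ∀ k l, |∑ i, colCov X j (y i) k * colCov X j (y i) l -
      Fintype.card ι * (2 / ((d : ℝ) * (d - 1)) * ∑ i, X i k * X i l)| ≤
      b ^ 2 * (q * (n / d) * η) := by
    intro k l
    have h3 : |∑ i, G j k l (y i) - Fintype.card ι * ∑ z, w z * G j k l z| ≤
      b ^ 2 * (q * (n / d) * η) := not_lt.1 (hg2 (j, k, l))
    rwa [show ∑ z, w z * G j k l z = _ from mean_colGram T hd hcent j k l] at h3
  -- The mean gives `(n / 6) (c² / 2)`, of which the deviation consumes at most half, by `hsmall`.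
  have hgram : ∀ v, n * c ^ 2 / 24 * l2 v ^ 2 ≤ ∑ i, (colCov X j (y i) ⬝ᵥ v) ^ 2 := by
    intro v
    rw [sum_colCov_dotProduct_sq]
    have h3 : c ^ 2 / 2 * l2 v ^ 2 ≤
        ∑ k, ∑ l, (2 / ((d : ℝ) * (d - 1)) * ∑ i, X i k * X i l) * (v k * v l) := by
      have e3 : ∑ k, ∑ l, (2 / ((d : ℝ) * (d - 1)) * ∑ i, X i k * X i l) * (v k * v l) =
          2 / ((d : ℝ) * (d - 1)) * l2 (X.mulVec v) ^ 2 := by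
        rw [l2_mulVec_sq_eq_quadForm, Finset.mul_sum]
        refine Finset.sum_congr rfl fun k _ => ?_
        rw [Finset.mul_sum]
        exact Finset.sum_congr rfl fun l _ => by ring
      rw [e3]
      have e4 := pow_le_pow_left₀ (by have := l2_nonneg v; positivity) (hlow v) 2
      calc _ = 2 / ((d : ℝ) * d) * (c / 2 * d * l2 v) ^ 2 := by field_simp
        _ ≤ 2 / ((d : ℝ) * (d - 1)) * (c / 2 * d * l2 v) ^ 2 := by
          gcongr
          linarith
        _ ≤ _ := by gcongr
    refine le_trans (mul_le_mul_of_nonneg_right ?_ (sq_nonneg _))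
      (quadForm_lower (Nat.cast_nonneg _) hg2' v h3)
    have e5 : r * (b ^ 2 * (q * (n / d) * η)) = n * (r * (4 * g ^ 2) * q * η) := by
      rw [hb2]; field_simp
    have e6 : n * (r * (4 * g ^ 2) * q * η) ≤ n * (c ^ 2 / 24) := by gcongr
    have e7 : n / 6 * (c ^ 2 / 2) ≤ Fintype.card ι * (c ^ 2 / 2) := by gcongr
    rw [e5]
    linarith
  have hscore : l2 (∑ i, colTerm X j (A j) (y i)) ≤
      r * (n / d * b * (2 * β * D₂ + q) * η) := by
    have h3 : ∀ k, |(∑ i, colTerm X j (A j) (y i)) k| ≤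
        n / d * b * (2 * β * D₂ + q) * η := by
      intro k
      rw [Finset.sum_apply]
      have h4 := hg1' k
      have h5 := abs_mean_colTerm_le hd hA hX hXΘ j k
      have h6 := mul_le_mul hn h5 (abs_nonneg _) hn0.le
      rw [← abs_of_nonneg (Nat.cast_nonneg (α := ℝ) (Fintype.card ι)), ← abs_mul] at h6
      have h7 := abs_sub_abs_le_abs_sub (∑ i, colTerm X j (A j) (y i) k)
        (Fintype.card ι * ∑ z, w z * colTerm X j (A j) z k)
      calc _ ≤ n * (1 / d * (2 * (Real.sqrt d * (D₂ * η)) * (β / Real.sqrt d) * b)) +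
            b * (q * (n / d) * η) := by linarith
        _ = _ := by field_simp
    simpa using l2_le_card_mul h3
  have hD0 : 0 < D := by
    have h3 : 0 < 50 * (r * g * (2 * β * D₂ + q)) := by positivity
    exact pos_of_mul_pos_right (pos_of_mul_pos_right (h3.trans_le hD) (sq_nonneg _)) (sq_nonneg _)
  simp_rw [sum_colTerm_eq_score] at hscore ⊢
  refine exists_score_root _ _ _ (M := 2 * g * β) (κ := n * c ^ 2 / 24) (by positivity) ?_ ?_
    (by positivity) hgram ?_
  · intro i
    rw [sub_zero]
    refine (abs_dotProduct_le _ _).trans ?_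
    calc _ ≤ b * (β / Real.sqrt d) := mul_le_mul (hcov _ _) (hA j) (l2_nonneg _) hb0.le
      _ = 2 * g * β := by rw [hb]; field_simp
  · intro i
    calc _ ≤ b * (D * η / Real.sqrt d) := by
          have := hcov j (y i)
          gcongr
      _ = 2 * g * D * η := by rw [hb]; field_simp
      _ ≤ 1 := hDη
  · refine hscore.trans_lt ?_
    set m := Real.sigmoid (-(2 * g * β + 1)) ^ 2
    have e3 : m * (n * c ^ 2 / 24) * (D * η / Real.sqrt d) =
        n * η / (24 * Real.sqrt d) * (m * (c ^ 2 * D)) := by ring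
    have e4 : r * (n / d * b * (2 * β * D₂ + q) * η) =
        n * η / (24 * Real.sqrt d) * (48 * (r * g * (2 * β * D₂ + q))) := by
      rw [hb]
      nth_rewrite 1 [← hsd2]
      field_simp
      ring
    rw [e3, e4]
    refine mul_lt_mul_of_pos_left (lt_of_lt_of_le ?_ hD) (by positivity)
    have : 0 < r * g * (2 * β * D₂ + q) := by positivity
    linarith

end Col

/-! ### The procedure for fixed folds -/

theorem recenter_apply {d r : ℕ} (Θ : Matrix (Fin d) (Fin r) ℝ) (i : Fin d) (k : Fin r) :
    recenter Θ i k = Θ i k - (d : ℝ)⁻¹ * ∑ l, Θ l k := by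
  rw [recenter, Matrix.sub_mul, Matrix.one_mul, Matrix.sub_apply, Matrix.smul_mul,
    Matrix.smul_apply, Matrix.mul_apply, smul_eq_mul]
  simp

theorem sum_recenter {d r : ℕ} (hd : d ≠ 0) (Θ : Matrix (Fin d) (Fin r) ℝ) (k : Fin r) :
    ∑ i, recenter Θ i k = 0 := by
  simp only [recenter_apply, Finset.sum_sub_distrib, Finset.sum_const, Finset.card_univ,
    Fintype.card_fin, nsmul_eq_mul]
  have : (d : ℝ) ≠ 0 := Nat.cast_ne_zero.2 hd
  field_simp
  ring

theorem l2_sum_le {ι κ : Type*} [Fintype ι] [Fintype κ] (f : κ → ι → ℝ) :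
    l2 (∑ k, f k) ≤ ∑ k, l2 (f k) := by
  simp only [l2_eq_norm, WithLp.toLp_sum]
  exact norm_sum_le _ _

/-- Since `Θ` is centered, recentering `X` subtracts the average of the rows of `X - Θ`, which is
itself at most `s`. -/
theorem l2_recenter_sub_le {d r : ℕ} {X Θ : Matrix (Fin d) (Fin r) ℝ} {s : ℝ} (hd : d ≠ 0)
    (hΘ : ∀ k, ∑ i, Θ i k = 0) (h : ∀ i, l2 (X i - Θ i) ≤ s) (i : Fin d) :
    l2 (recenter X i - Θ i) ≤ 2 * s := by
  have hd0 : (0 : ℝ) < d := Nat.cast_pos.2 (Nat.pos_of_ne_zero hd)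
  have e : recenter X i - Θ i = (X i - Θ i) - (d : ℝ)⁻¹ • ∑ l, (X l - Θ l) := by
    ext k
    simp only [Pi.sub_apply, Pi.smul_apply, Finset.sum_apply, smul_eq_mul, recenter_apply,
      Finset.sum_sub_distrib, hΘ]
    ring
  have h2 : l2 (∑ l, (X l - Θ l)) ≤ d * s :=
    (l2_sum_le _).trans ((Finset.sum_le_sum fun l _ => h l).trans (by simp))
  rw [e]
  refine (l2_sub_le _ _).trans ?_
  rw [l2_smul, abs_of_nonneg (by positivity)]
  have h3 := mul_le_mul_of_nonneg_left h2 (inv_nonneg.2 hd0.le)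
  rw [inv_mul_cancel_left₀ hd0.ne'] at h3
  linarith [h i]

theorem IsBalanced.card_bounds {n : ℕ} {φ : Fin n → Fin 3} (h : IsBalanced φ) (hn : 4 ≤ n)
    (a : Fin 3) : (n : ℝ) / 6 ≤ Fintype.card {i // φ i = a} ∧
      (Fintype.card {i // φ i = a} : ℝ) ≤ n := by
  rw [Fintype.card_subtype]
  have h1 := Finset.card_eq_sum_card_fiberwise (s := (Finset.univ : Finset (Fin n)))
    (t := (Finset.univ : Finset (Fin 3))) (f := φ) (fun _ _ => Finset.mem_coe.2 (Finset.mem_univ _))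
  rw [Finset.card_univ, Fintype.card_fin, Fin.sum_univ_three] at h1
  have h2 := h 0 a
  have h3 := h 1 a
  have h4 := h 2 a
  constructor
  · have : n ≤ 6 * (Finset.univ.filter fun i => φ i = a).card := by omega
    have : (n : ℝ) ≤ 6 * (Finset.univ.filter fun i => φ i = a).card := by exact_mod_cast this
    linarith
  · have : (Finset.univ.filter fun i => φ i = a).card ≤ n := by
      simpa using Finset.card_filter_le (Finset.univ : Finset (Fin n)) fun i => φ i = a
    exact_mod_cast this

theorem half_le_log {d : ℕ} (hd : 2 ≤ d) : 1 / 2 ≤ Real.log d := by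
  have h1 := Real.log_two_gt_d9
  have h2 : Real.log 2 ≤ Real.log d := Real.log_le_log (by norm_num) (by exact_mod_cast hd)
  linarith

/-- The value `q = 4 + 16 r²` is tuned here: `q - 2` leaves two powers of `d`, one of which pays for
the union over rows or columns, and `exp (16 r² log d) ≥ 8 r²` absorbs the factor in `r`. Two steps
with failure `1 / (2 d)` add up to `1 / d`. -/
theorem failure_bound {d r : ℕ} (hd : 2 ≤ d) :
    4 * (r : ℝ) ^ 2 * d * Real.exp (-((4 + 16 * (r : ℝ) ^ 2 - 2) * Real.log d)) ≤
      1 / (2 * d) := by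
  have hd0 : (0 : ℝ) < d := by positivity
  have hL := half_le_log hd
  have e1 : Real.exp ((4 + 16 * (r : ℝ) ^ 2 - 2) * Real.log d) =
      d * d * Real.exp (16 * (r : ℝ) ^ 2 * Real.log d) := by
    rw [show (4 + 16 * (r : ℝ) ^ 2 - 2) * Real.log d =
      Real.log d + Real.log d + 16 * (r : ℝ) ^ 2 * Real.log d by ring, Real.exp_add, Real.exp_add,
      Real.exp_log hd0]
  have e2 : 8 * (r : ℝ) ^ 2 ≤ Real.exp (16 * (r : ℝ) ^ 2 * Real.log d) := by
    have := Real.add_one_le_exp (16 * (r : ℝ) ^ 2 * Real.log d)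
    nlinarith [mul_le_mul_of_nonneg_left hL (by positivity : 0 ≤ 16 * (r : ℝ) ^ 2)]
  rw [Real.exp_neg, e1, ← div_eq_mul_inv, div_le_div_iff₀ (by positivity) (by positivity)]
  nlinarith [mul_le_mul_of_nonneg_left e2 (by positivity : 0 ≤ (d : ℝ) * d)]

section Fixed
variable {d r : ℕ}

/-- `θ` is the unique root of the score of the row `u` and is within `s` of the row of `Θ`. -/
def IsRowFit {ι : Type*} [Fintype ι] (B : Matrix (Fin d) (Fin r) ℝ) (T₀ : Matrix (Fin d) (Fin d) ℝ)
    (y : ι → Obs d) (Θ : Matrix (Fin d) (Fin r) ℝ) (s : ℝ) (u : Fin d) (θ : Fin r → ℝ) : Prop :=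
  ∑ i, rowTerm B T₀ u θ (y i) = 0 ∧ (∀ θ', ∑ i, rowTerm B T₀ u θ' (y i) = 0 → θ' = θ) ∧
    l2 (θ - Θ u) ≤ s

/-- `a` is the unique root of the score of the column `j` and is within `s` of the row of `A`. -/
def IsColFit {ι : Type*} [Fintype ι] (X : Matrix (Fin d) (Fin r) ℝ) (y : ι → Obs d)
    (A : Matrix (Fin d) (Fin r) ℝ) (s : ℝ) (j : Fin d) (a : Fin r → ℝ) : Prop :=
  ∑ i, colTerm X j a (y i) = 0 ∧ (∀ a', ∑ i, colTerm X j a' (y i) = 0 → a' = a) ∧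
    l2 (a - A j) ≤ s

theorem firstFold_congr {n : ℕ} {φ : Fin n → Fin 3} {z z' : Fin n → Obs d}
    (h : ∀ i, φ i = 0 → z i = z' i) : firstFold φ z = firstFold φ z' := by
  funext i
  unfold firstFold
  split_ifs with hi
  · rw [h i hi]
  · rfl

theorem abs_product_sub_le {x θ a b : Fin r → ℝ} {s t ρ γ : ℝ} (hs : l2 (x - θ) ≤ s)
    (ht : l2 (a - b) ≤ t) (hb : l2 b ≤ ρ) (hθ : l2 θ ≤ γ) :
    |x ⬝ᵥ a - θ ⬝ᵥ b| ≤ s * (ρ + t) + γ * t := by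
  have e : x ⬝ᵥ a - θ ⬝ᵥ b = (x - θ) ⬝ᵥ a + θ ⬝ᵥ (a - b) := by
    rw [sub_dotProduct, dotProduct_sub]; ring
  have ha : l2 a ≤ ρ + t := by
    have := l2_add_le b (a - b)
    rw [add_sub_cancel] at this
    linarith
  rw [e]
  refine (abs_add_le _ _).trans (add_le_add ?_ ?_)
  · exact (abs_dotProduct_le _ _).trans
      (mul_le_mul hs ha (l2_nonneg _) ((l2_nonneg _).trans hs))
  · exact (abs_dotProduct_le _ _).trans
      (mul_le_mul hθ ht (l2_nonneg _) ((l2_nonneg _).trans hθ))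

/-- Rotation reduces any output to the fixed singular vectors `V`. Uniqueness of the roots then
identifies its factors with the fitted ones, so bounds for the fits bind every output. -/
theorem refinement_error_of_fits {n : ℕ} {ρ : ℝ} {T₀ T₁ : Matrix (Fin d) (Fin d) ℝ}
    {V Θ A X : Matrix (Fin d) (Fin r) ℝ} {φ : Fin n → Fin 3} {z : Fin n → Obs d}
    {s₁ s t γ ρ' : ℝ}
    (hV : ∀ V' : Matrix (Fin d) (Fin r) ℝ, IsRightFactor T₀ V' → ∃ Q : Matrix (Fin r) (Fin r) ℝ,
      Q.transpose * Q = 1 ∧ Q * Q.transpose = 1 ∧ V = V' * Q)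
    (hX : ∀ u, IsRowFit (projRows ρ V) T₀ (fun i : {i // φ i = 1} => z i) Θ s₁ u (X u))
    (hA : ∀ j, ∃ a, IsColFit (recenter X) (fun i : {i // φ i = 2} => z i) A t j a)
    (hXs : ∀ u, l2 (recenter X u - Θ u) ≤ s) (hρ : ∀ j, l2 (A j) ≤ ρ') (hγ : ∀ u, l2 (Θ u) ≤ γ)
    (hT₁ : IsRefinement r ρ T₀ φ z T₁) (i j : Fin d) :
    |T₁ i j - (Θ * A.transpose) i j| ≤ s * (ρ' + t) + γ * t := by
  obtain ⟨X', A', hX', hA', rfl⟩ := hT₁.exists_of_rotation hV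
  have e1 : X' = X := by
    ext u k
    have := hX' u
    rw [rowScore_eq_sum_rowTerm] at this
    rw [(hX u).2.1 _ this]
  subst e1
  obtain ⟨a, ha⟩ := hA j
  have e2 : A' j = a := by
    have := hA' j
    rw [colScore_eq_sum_colTerm] at this
    exact ha.2.1 _ this
  have h1 : l2 (A' j - A j) ≤ t := by rw [e2]; exact ha.2.2
  exact abs_product_sub_le (hXs i) h1 (hρ j) (hγ i)

/-- The constants of the row and column steps, chosen in the order of their dependencies, together
with a bound on the noise level below which all smallness conditions hold. -/
theorem exists_step_constants (hr : 1 ≤ r) {cσ β γ C₀ C₁ C₂ q : ℝ} (hcσ : 0 < cσ) (hβ : 0 < β)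
    (hγ : 0 < γ) (hC₁ : 0 ≤ C₁) (hC₂ : 0 ≤ C₂) (hq : 0 < q) :
    ∃ D₁ D₃ η₀ : ℝ, 0 < D₁ ∧ 0 < D₃ ∧ 0 < η₀ ∧ η₀ ≤ 1 / 2 ∧
      25 * (r * β * (4 * (C₁ + γ * C₂) + q)) ≤ Real.sigmoid (-(β * γ + C₀ + 1)) ^ 2 * D₁ ∧
      50 * (r * (γ + 1) * (2 * β * (2 * D₁) + q)) ≤
        Real.sigmoid (-(2 * (γ + 1) * β + 1)) ^ 2 * (cσ ^ 2 * D₃) ∧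
      ∀ η, 0 < η → η ≤ η₀ → C₂ * η ≤ 1 / 4 ∧ r * β ^ 2 * q * η ≤ 1 / 24 ∧ β * D₁ * η ≤ 1 ∧
        2 * D₁ * η ≤ 1 ∧ 2 * D₁ * η ≤ cσ / 2 ∧ r * (4 * (γ + 1) ^ 2) * q * η ≤ cσ ^ 2 / 24 ∧
        2 * (γ + 1) * D₃ * η ≤ 1 := by
  have hr0 : (0 : ℝ) < r := by exact_mod_cast hr
  set m₁ := Real.sigmoid (-(β * γ + C₀ + 1)) ^ 2 with hm₁
  set m₃ := Real.sigmoid (-(2 * (γ + 1) * β + 1)) ^ 2 with hm₃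
  have hm₁0 : 0 < m₁ := pow_pos (Real.sigmoid_pos _) 2
  have hm₃0 : 0 < m₃ := pow_pos (Real.sigmoid_pos _) 2
  set D₁ := 25 * (r * β * (4 * (C₁ + γ * C₂) + q)) / m₁ with hD₁
  have hD₁0 : 0 < D₁ := by positivity
  set D₃ := 50 * (r * (γ + 1) * (2 * β * (2 * D₁) + q)) / (m₃ * cσ ^ 2) with hD₃
  have hD₃0 : 0 < D₃ := by positivity
  -- Each smallness condition reads `x * η ≤ 1` for a nonnegative summand `x` of `K`, so `η ≤ 1 / K`
  -- meets all of them; the summand 2 gives `η₀ ≤ 1 / 2`.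
  set K := 2 + 4 * C₂ + 24 * (r * β ^ 2 * q) + β * D₁ + 2 * D₁ + 4 * D₁ / cσ +
    24 * (r * (4 * (γ + 1) ^ 2) * q) / cσ ^ 2 + 2 * (γ + 1) * D₃ with hK
  have hK0 : 0 < K := by positivity
  have p1 : 0 ≤ 4 * C₂ := by positivity
  have p2 : 0 ≤ 24 * (r * β ^ 2 * q) := by positivity
  have p3 : 0 ≤ β * D₁ := by positivity
  have p4 : 0 ≤ 4 * D₁ / cσ := by positivity
  have p5 : 0 ≤ 24 * (r * (4 * (γ + 1) ^ 2) * q) / cσ ^ 2 := by positivity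
  have p6 : 0 ≤ 2 * (γ + 1) * D₃ := by positivity
  refine ⟨D₁, D₃, 1 / K, hD₁0, hD₃0, by positivity, ?_, ?_, ?_, ?_⟩
  · exact one_div_le_one_div_of_le (by norm_num) (by linarith)
  · rw [hD₁]; exact le_of_eq (by field_simp)
  · rw [hD₃]; exact le_of_eq (by field_simp)
  · intro η hη hηK
    have hKη : K * η ≤ 1 := by
      rw [le_div_iff₀ hK0] at hηK; linarith
    have key : ∀ x, x ≤ K → x * η ≤ 1 := fun x hx =>
      (mul_le_mul_of_nonneg_right hx hη.le).trans hKη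
    refine ⟨?_, ?_, key _ (by linarith), key _ (by linarith), ?_, ?_, key _ (by linarith)⟩
    · linarith [key (4 * C₂) (by linarith)]
    · linarith [key (24 * (r * β ^ 2 * q)) (by linarith)]
    · have := key (4 * D₁ / cσ) (by linarith)
      rw [div_mul_eq_mul_div, div_le_one hcσ] at this
      linarith
    · have := key (24 * (r * (4 * (γ + 1) ^ 2) * q) / cσ ^ 2) (by linarith)
      rw [div_mul_eq_mul_div, div_le_one (by positivity)] at this
      linarith

set_option maxHeartbeats 2000000 in
/-- For fixed folds, the conditional probability of failure given a good initializer is at most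
`1 / d`. -/
theorem exists_fixed_folds_bound (hr : 1 ≤ r) {cσ Cσ CA CΘ α C₀ Cinit : ℝ} (hcσ : 0 < cσ)
    (hCA : 0 < CA) :
    ∃ η₀ C : ℝ, 0 < η₀ ∧ 0 < C ∧ ∀ (d n : ℕ), 2 ≤ d → ∀ η, 0 < η → η ≤ η₀ →
      n * η ^ 2 = d * Real.log d → ∀ Θ A : Matrix (Fin d) (Fin r) ℝ,
      IsSignal cσ Cσ CA CΘ α Θ A → ∀ φ : Fin n → Fin 3, IsBalanced φ →
      ∀ init : (Fin n → Option (Obs d)) → Matrix (Fin d) (Fin d) ℝ,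
      wprob (prodWeight (comparisonMass (Θ * A.transpose)))
        ({z | IsGoodInit C₀ Cinit n (Θ * A.transpose) (init (firstFold φ z))} ∩
          {z | ¬ ((∃ T₁, IsRefinement r (CA / Real.sqrt d) (init (firstFold φ z)) φ z T₁) ∧
            ∀ T₁, IsRefinement r (CA / Real.sqrt d) (init (firstFold φ z)) φ z T₁ →
              ∀ i j, |T₁ i j - (Θ * A.transpose) i j| ≤ C * η)}) ≤
      1 / d * wprob (prodWeight (comparisonMass (Θ * A.transpose)))
        {z | IsGoodInit C₀ Cinit n (Θ * A.transpose) (init (firstFold φ z))} := by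
  classical
  -- The factor 2 is the growth of the left factor under alignment; the maxima with 1 make the
  -- constants positive without sign assumptions on the data of the theorem.
  set γ := 2 * max CΘ 1 with hγ
  set Ci := max Cinit 1 with hCi
  set C₁ := 2 * Ci with hC₁
  set C₂ := 2 * C₁ / cσ with hC₂
  set q := 4 + 16 * (r : ℝ) ^ 2 with hq
  have hγ0 : 0 < γ := by have := le_max_right CΘ 1; linarith
  have hCi0 : 0 < Ci := by have := le_max_right Cinit 1; linarith
  have hC₁0 : 0 ≤ C₁ := by positivity
  have hC₂0 : 0 ≤ C₂ := by positivity
  have hq0 : 0 < q := by positivity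
  obtain ⟨D₁, D₃, η₀, hD₁, hD₃, hη₀, hη₀2, hc1, hc3, hsm⟩ :=
    exists_step_constants (C₀ := C₀) hr hcσ hCA hγ0 hC₁0 hC₂0 hq0
  refine ⟨η₀, 2 * D₁ * (CA + D₃) + γ * D₃, hη₀, by positivity, ?_⟩
  intro d n hd η hη hηη₀ hL Θ A hS φ hφ init
  obtain ⟨hs1, hs2, hs3, hs4, hs5, hs6, hs7⟩ := hsm η hη hηη₀
  have h2 : (2 : ℝ) ≤ d := by exact_mod_cast hd
  have hd0 : (0 : ℝ) < d := by linarith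
  have hdn : d ≠ 0 := by omega
  have hsd : 0 < Real.sqrt d := Real.sqrt_pos.2 hd0
  have hlog := half_le_log hd
  have hη1 : η ≤ 1 := by linarith
  have hn4 : 4 ≤ n := by
    have h3 : (1 : ℝ) ≤ d * Real.log d := by nlinarith
    rw [← hL] at h3
    have h4 : η ^ 2 ≤ 1 / 4 := by nlinarith
    have h5 : (4 : ℝ) ≤ n := by
      have : (0 : ℝ) ≤ n := Nat.cast_nonneg n
      nlinarith
    exact_mod_cast h5
  have hn0 : (0 : ℝ) < n := by
    have : (4 : ℝ) ≤ n := by exact_mod_cast hn4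
    linarith
  -- As `n η² = d log d` and `log d ≥ 1 / 2`, the initial error scale is at most `2 d η`; this
  -- accounts for the 2 in `C₁`.
  have hsqrt : Real.sqrt ((d : ℝ) ^ 3 / n) ≤ 2 * d * η := by
    refine Real.sqrt_le_iff.2 ⟨by positivity, ?_⟩
    rw [div_le_iff₀ hn0]
    have : (2 * d * η) ^ 2 * n = 4 * (d : ℝ) ^ 2 * (n * η ^ 2) := by ring
    rw [this, hL]
    nlinarith [pow_pos hd0 3]
  set T := Θ * A.transpose with hT
  set w := comparisonMass T with hw
  have hw0 : ∀ z, 0 ≤ w z := comparisonMass_nonneg T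
  have hw1 : ∑ z, w z = 1 := sum_comparisonMass T hd
  have hpw := prodWeight_nonneg (ι := Fin n) hw0
  set ρ := CA / Real.sqrt d with hρ
  have hρ0 : 0 < ρ := by positivity
  have hrd : r ≤ d := le_of_orthonormal_columns hS.orthonormal
  have hΘlow : ∀ x, cσ * d * l2 x ≤ l2 (Θ.mulVec x) :=
    mul_l2_le_of_singVal hS.orthonormal (by positivity) hS.singVal_lower
  have hfrob : ∀ T₀, IsGoodInit C₀ Cinit n T T₀ → frobNorm (T₀ - T) ≤ C₁ * d * η := by
    intro T₀ h
    refine h.2.trans ?_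
    calc Cinit * Real.sqrt ((d : ℝ) ^ 3 / n) ≤ Ci * Real.sqrt ((d : ℝ) ^ 3 / n) :=
          mul_le_mul_of_nonneg_right (le_max_left _ _) (Real.sqrt_nonneg _)
      _ ≤ Ci * (2 * d * η) := mul_le_mul_of_nonneg_left hsqrt hCi0.le
      _ = _ := by ring
  have hε : ∀ T₀, IsGoodInit C₀ Cinit n T T₀ →
      2 * frobNorm (T₀ - Θ * A.transpose) ≤ C₂ * η * (cσ * d) := by
    intro T₀ h
    have := hfrob T₀ h
    calc _ ≤ 2 * (C₁ * d * η) := by linarith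
      _ = _ := by rw [hC₂]; field_simp
  -- The aligned factors are chosen as functions of the matrix `T₀` alone, so on the sample they
  -- depend only on the first fold. The zero matrices for a bad initializer are placeholders.
  have halign : ∀ T₀ : Matrix (Fin d) (Fin d) ℝ, ∃ V Θ' A' : Matrix (Fin d) (Fin r) ℝ,
      IsGoodInit C₀ Cinit n T T₀ → IsRightFactor T₀ V ∧ Θ' * A'.transpose = T ∧
      (∀ j, l2 (A' j) ≤ ρ) ∧ (∀ i, l2 (Θ' i) ≤ γ * Real.sqrt d) ∧
      (∀ x, cσ * d * l2 x ≤ l2 (Θ'.mulVec x)) ∧ (∀ k, ∑ i, Θ' i k = 0) ∧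
      ∑ j, l2 (projRows ρ V j - A' j) ^ 2 ≤ (C₂ * η) ^ 2 ∧
      ∀ x, 1 / 2 * l2 x ≤ l2 ((projRows ρ V).mulVec x) := by
    intro T₀
    by_cases hG : IsGoodInit C₀ Cinit n T T₀
    · obtain ⟨V, hV⟩ := exists_isRightFactor hrd T₀
      obtain ⟨Θ', A', h1, h2, h3, h4, h5, h6, h7⟩ := exists_aligned_factors hr hS.orthonormal
        (c := cσ * d) (ε := C₂ * η) (ρ := ρ) (γ := max CΘ 1 * Real.sqrt d) (by positivity) hΘlow
        (hε T₀ hG) hs1 hV hS.incoherent_right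
        (fun i => (hS.incoherent_left i).trans
          (mul_le_mul_of_nonneg_right (le_max_left _ _) hsd.le))
        (sum_col_eq_zero_of_centered hS.orthonormal hS.centered)
      exact ⟨V, Θ', A', fun _ => ⟨hV, h1, h2, fun i => (h3 i).trans (le_of_eq (by rw [hγ]; ring)),
        h4, h5, h6, h7⟩⟩
    · exact ⟨0, 0, 0, fun h => absurd h hG⟩
  choose V Θ' A' hal using halign
  let T₀ : (Fin n → Obs d) → Matrix (Fin d) (Fin d) ℝ := fun z => init (firstFold φ z)
  let G : Set (Fin n → Obs d) := {z | IsGoodInit C₀ Cinit n T (T₀ z)}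
  let RF : (Fin n → Obs d) → Fin d → (Fin r → ℝ) → Prop := fun z u θ =>
    IsRowFit (projRows ρ (V (T₀ z))) (T₀ z) (fun i : {i // φ i = 1} => z i) (Θ' (T₀ z))
      (Real.sqrt d * (D₁ * η)) u θ
  let CF : (Fin n → Obs d) → Matrix (Fin d) (Fin r) ℝ → Fin d → (Fin r → ℝ) → Prop :=
    fun z X j a => IsColFit (recenter X) (fun i : {i // φ i = 2} => z i) (A' (T₀ z))
      (D₃ * η / Real.sqrt d) j a
  let B₂ : Set (Fin n → Obs d) := {z | ¬ ∀ u, ∃ θ, RF z u θ}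
  let B₃ : Set (Fin n → Obs d) :=
    {z | ¬ ∃ X : Matrix (Fin d) (Fin r) ℝ, (∀ u, RF z u (X u)) ∧ ∀ j, ∃ a, CF z X j a}
  have hT₀ : ∀ z z' : Fin n → Obs d, (∀ i, φ i = 0 → z i = z' i) → T₀ z = T₀ z' :=
    fun z z' h => congrArg init (firstFold_congr h)
  have hnear : ∀ z ∈ G, ∀ X : Matrix (Fin d) (Fin r) ℝ, (∀ u, RF z u (X u)) → ∀ u,
      l2 (recenter X u - Θ' (T₀ z) u) ≤ Real.sqrt d * (2 * D₁ * η) := by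
    intro z hz X hX u
    obtain ⟨-, -, -, -, -, hcent, -, -⟩ := hal (T₀ z) hz
    refine (l2_recenter_sub_le hdn hcent (fun i => (hX i).2.2) u).trans (le_of_eq ?_)
    ring
  -- Everything outside the second fold is frozen; the initializer and its aligned factors are then
  -- constants, and `row_step` applies to the fresh comparisons.
  have hP₂ : wprob (prodWeight w) (G ∩ B₂) ≤ 1 / (2 * d) * wprob (prodWeight w) G := by
    refine wprob_inter_le_of_glue hw0 hw1 (fun i => φ i = 1) G B₂ ?_ ?_
    · intro z z' h hz
      have := hT₀ z z' fun i hi => h i (by rw [hi]; decide)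
      simpa only [G, Set.mem_ofPred_eq, this] using hz
    · intro z hz
      obtain ⟨hV, hprod, hA', hΘ', hlow, hcent, hdist, hBlow⟩ := hal (T₀ z) hz
      obtain ⟨hc, hc'⟩ := hφ.card_bounds hn4 1
      have h := row_step hr hd (ι := {i // φ i = 1}) (Θ := Θ' (T₀ z)) (A := A' (T₀ z))
        (B := projRows ρ (V (T₀ z))) (T₀ := T₀ z) (D := D₁) hCA hγ0.le hη hη1 hC₁0 hC₂0 hq0 hn0 hL
        hc' hc (l2_projRows_le hρ0.le _) hΘ' hz.1 (by rw [hprod]; exact hfrob _ hz) hdist hBlow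
        hs2 hc1 hs3
      rw [hprod] at h
      refine le_trans (wprob_mono (prodWeight_nonneg hw0) ?_) (h.trans (failure_bound hd))
      intro y hy
      have e1 : T₀ (glue (fun i => φ i = 1) z y) = T₀ z :=
        hT₀ _ _ fun i hi => dif_neg (show ¬ φ i = 1 by rw [hi]; decide)
      have e2 : ∀ i : {i // φ i = 1}, glue (fun i => φ i = 1) z y i = y i := fun i => by
        simp [glue, i.2]
      simpa only [B₂, RF, IsRowFit, Set.mem_ofPred_eq, e1, e2] using hy
  -- Now the third fold is resampled. The event `G ∩ B₂ᶜ` and the row fits depend only on the first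
  -- two folds, so the covariates are fixed.
  have hP₃ : wprob (prodWeight w) ((G ∩ B₂ᶜ) ∩ B₃) ≤
      1 / (2 * d) * wprob (prodWeight w) (G ∩ B₂ᶜ) := by
    have hRF : ∀ z z' : Fin n → Obs d, (∀ i, ¬ φ i = 2 → z i = z' i) → RF z = RF z' := by
      intro z z' h
      have e1 := hT₀ z z' fun i hi => h i (by rw [hi]; decide)
      have e2 : (fun i : {i // φ i = 1} => z i) = fun i : {i // φ i = 1} => z' i := by
        funext i; exact h i (by rw [i.2]; decide)
      simp only [RF, e1, e2]
    refine wprob_inter_le_of_glue hw0 hw1 (fun i => φ i = 2) (G ∩ B₂ᶜ) B₃ ?_ ?_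
    · intro z z' h hz
      have e1 := hT₀ z z' fun i hi => h i (by rw [hi]; decide)
      have e2 := hRF z z' h
      refine ⟨?_, ?_⟩
      · have := hz.1
        simpa only [G, Set.mem_ofPred_eq, e1] using this
      · have := hz.2
        simpa only [B₂, Set.mem_compl_iff, Set.mem_ofPred_eq, e2] using this
    · intro z hz
      obtain ⟨hV, hprod, hA', hΘ', hlow, hcent, hdist, hBlow⟩ := hal (T₀ z) hz.1
      obtain ⟨hc, hc'⟩ := hφ.card_bounds hn4 2
      have hrows : ∀ u, ∃ θ, RF z u θ := not_not.1 hz.2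
      choose X₀ hX₀ using hrows
      let X : Matrix (Fin d) (Fin r) ℝ := X₀
      have hX : ∀ u, RF z u (X u) := hX₀
      have hnr := hnear z hz.1 X hX
      have h := col_step hr hd (ι := {i // φ i = 2}) (Θ := Θ' (T₀ z)) (A := A' (T₀ z))
        (X := recenter X) (g := γ + 1) (c := cσ) (D₂ := 2 * D₁) (D := D₃) hCA (by positivity) hcσ
        (by positivity) hη hη1 hq0 hn0 hL hc' hc hA' (fun i => by
          have h3 := l2_add_le (Θ' (T₀ z) i) (recenter X i - Θ' (T₀ z) i)
          rw [add_sub_cancel] at h3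
          nlinarith [hnr i, hΘ' i]) hnr (sum_recenter hdn X) (fun x => by
          have h3 := l2_sub_le ((recenter X).mulVec x) ((recenter X - Θ' (T₀ z)).mulVec x)
          rw [← Matrix.sub_mulVec, sub_sub_cancel] at h3
          have h4 := l2_mulVec_le_frobNorm (recenter X - Θ' (T₀ z)) x
          -- Rowwise closeness bounds the perturbation by `d * (cσ / 2)`, which leaves half of the
          -- lower bound `cσ * d` of the left factor.
          have h5 : frobNorm (recenter X - Θ' (T₀ z)) ≤ d * (cσ / 2) := by
            refine le_of_sq_le_sq ?_ (by positivity)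
            rw [frobNorm_sq]
            have h6 : ∀ i, l2 ((recenter X - Θ' (T₀ z)) i) ^ 2 ≤ d * (cσ / 2) ^ 2 := by
              intro i
              refine (pow_le_pow_left₀ (l2_nonneg _) ((hnr i).trans
                (mul_le_mul_of_nonneg_left hs5 hsd.le)) 2).trans (le_of_eq ?_)
              rw [mul_pow, Real.sq_sqrt hd0.le]
            refine (Finset.sum_le_sum fun i _ => h6 i).trans (le_of_eq ?_)
            simp only [Finset.sum_const, Finset.card_univ, Fintype.card_fin, nsmul_eq_mul]
            ring
          have h7 := mul_le_mul_of_nonneg_right h5 (l2_nonneg x)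
          have h8 := hlow x
          linarith) hs6 hc3 hs7
      rw [hprod] at h
      refine le_trans (wprob_mono (prodWeight_nonneg hw0) ?_) (h.trans (failure_bound hd))
      intro y hy hgood
      refine hy ⟨X, ?_, ?_⟩
      · rw [hRF (glue (fun i => φ i = 2) z y) z fun i hi => dif_neg hi]
        exact hX
      · have e1 : T₀ (glue (fun i => φ i = 2) z y) = T₀ z :=
          hT₀ _ _ fun i hi => dif_neg (show ¬ φ i = 2 by rw [hi]; decide)
        have e2 : ∀ i : {i // φ i = 2}, glue (fun i => φ i = 2) z y i = y i := fun i => by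
          simp [glue, i.2]
        simpa only [CF, IsColFit, e1, e2] using hgood
  have hsub : G ∩ {z | ¬ ((∃ T₁, IsRefinement r ρ (T₀ z) φ z T₁) ∧
      ∀ T₁, IsRefinement r ρ (T₀ z) φ z T₁ →
        ∀ i j, |T₁ i j - T i j| ≤ (2 * D₁ * (CA + D₃) + γ * D₃) * η)} ⊆
      (G ∩ B₂) ∪ ((G ∩ B₂ᶜ) ∩ B₃) := by
    rintro z ⟨hz, hbad⟩
    by_contra hcon
    simp only [Set.mem_union, Set.mem_inter_iff, Set.mem_compl_iff, not_or, not_and] at hcon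
    have hnB₂ := hcon.1 hz
    have hnB₃ := hcon.2 ⟨hz, hnB₂⟩
    obtain ⟨X, hX, hCF⟩ := not_not.1 hnB₃
    obtain ⟨hV, hprod, hA', hΘ', hlow, hcent, hdist, hBlow⟩ := hal (T₀ z) hz
    refine hbad ⟨?_, fun T₁ hT₁ i j => ?_⟩
    · choose a ha using hCF
      refine ⟨recenter X * (Matrix.of a).transpose, V (T₀ z), X, Matrix.of a, hV, ?_, ?_, rfl⟩
      · intro u
        rw [rowScore_eq_sum_rowTerm]
        exact (hX u).1
      · intro j
        rw [colScore_eq_sum_colTerm]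
        exact (ha j).1
    · have h := refinement_error_of_fits (T₁ := T₁)
        (fun V' hV' => hV'.exists_rotation hr hS.orthonormal (by positivity) hΘlow (hε _ hz) hs1 hV)
        hX hCF (hnear z hz X hX) hA' hΘ' hT₁ i j
      rw [hprod] at h
      refine h.trans ?_
      have e1 : Real.sqrt d * (2 * D₁ * η) * (ρ + D₃ * η / Real.sqrt d) +
          γ * Real.sqrt d * (D₃ * η / Real.sqrt d) =
          (2 * D₁ * (CA + D₃ * η) + γ * D₃) * η := by
        rw [hρ]; field_simp
      rw [e1]
      have : D₃ * η ≤ D₃ := mul_le_of_le_one_right hD₃.le hη1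
      gcongr
  refine (wprob_mono hpw hsub).trans ((wprob_union_le hpw _ _).trans
    ((add_le_add hP₂ hP₃).trans ?_))
  have h5 : wprob (prodWeight w) (G ∩ B₂ᶜ) ≤ wprob (prodWeight w) G :=
    wprob_mono hpw Set.inter_subset_left
  have h6 : 1 / (2 * (d : ℝ)) * wprob (prodWeight w) (G ∩ B₂ᶜ) ≤
      1 / (2 * d) * wprob (prodWeight w) G := mul_le_mul_of_nonneg_left h5 (by positivity)
  have h7 : 1 / (d : ℝ) = 1 / (2 * d) + 1 / (2 * d) := by field_simp; norm_num
  rw [h7, add_mul]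
  exact add_le_add le_rfl h6

end Fixed

/-! ### From the sample to finite sums -/

theorem measureReal_sample_eq {Ω : Type*} [MeasurableSpace Ω] {P : Measure Ω}
    [IsProbabilityMeasure P] {d n : ℕ} {T : Matrix (Fin d) (Fin d) ℝ} {Z : Fin n → Ω → Obs d}
    (hZ : IsComparisonSample P T Z) (z : Fin n → Obs d) :
    P.real {ω | (fun i => Z i ω) = z} = prodWeight (comparisonMass T) z := by
  have h1 := hZ.indep.measure_inter_preimage_eq_mul Finset.univ
    (sets := fun i => {z i}) (fun i _ => measurableSet_singleton (z i))
  have h2 : {ω | (fun i => Z i ω) = z} = ⋂ i ∈ Finset.univ, Z i ⁻¹' {z i} := by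
    ext ω
    simp [funext_iff]
  rw [measureReal_def, h2, h1, ENNReal.toReal_prod]
  exact Finset.prod_congr rfl fun i _ => hZ.law i (z i)

/-- Folds and sample are jointly discrete and independent, so the event splits over the values of
both. Finiteness makes every family `F` admissible, with no measurability condition on the
initializer. -/
theorem measureReal_folds_sample_eq {Ω : Type*} [MeasurableSpace Ω] {P : Measure Ω}
    [IsProbabilityMeasure P] {d n : ℕ} {T : Matrix (Fin d) (Fin d) ℝ} {Z : Fin n → Ω → Obs d}
    (hZ : IsComparisonSample P T Z) {φ : Ω → Fin n → Fin 3} (hφ : Measurable φ)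
    (hind : IndepFun φ (fun ω i => Z i ω) P) (F : (Fin n → Fin 3) → Set (Fin n → Obs d)) :
    P.real {ω | (fun i => Z i ω) ∈ F (φ ω)} =
      ∑ f, P.real {ω | φ ω = f} * wprob (prodWeight (comparisonMass T)) (F f) := by
  classical
  have hZm : Measurable fun ω i => Z i ω := measurable_pi_lambda _ hZ.measurable
  let Y : Ω → (Fin n → Fin 3) × (Fin n → Obs d) := fun ω => (φ ω, fun i => Z i ω)
  have hY : Measurable Y := hφ.prodMk hZm
  let S : Finset ((Fin n → Fin 3) × (Fin n → Obs d)) :=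
    Finset.univ.filter fun p => p.2 ∈ F p.1
  have h1 : {ω | (fun i => Z i ω) ∈ F (φ ω)} = Y ⁻¹' S := by
    ext ω; simp [S, Y]
  have h2 : ∀ f z, P.real (Y ⁻¹' {(f, z)}) =
      P.real {ω | φ ω = f} * prodWeight (comparisonMass T) z := by
    intro f z
    have h3 : Y ⁻¹' {(f, z)} = φ ⁻¹' {f} ∩ (fun ω i => Z i ω) ⁻¹' {z} := by
      ext ω; simp [Y]
    rw [h3, measureReal_def, hind.measure_inter_preimage_eq_mul _ _ (measurableSet_singleton f)
      (measurableSet_singleton z), ENNReal.toReal_mul, ← measureReal_sample_eq hZ z]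
    rfl
  rw [h1, ← sum_measureReal_preimage_singleton S fun p _ => hY (measurableSet_singleton p),
    Finset.sum_filter, Fintype.sum_prod_type]
  refine Finset.sum_congr rfl fun f _ => ?_
  rw [wprob, Finset.mul_sum]
  refine Finset.sum_congr rfl fun z _ => ?_
  by_cases hz : z ∈ F f
  · simp [hz, h2]
  · simp [hz]

/-- A nonpositive radius would force all rows of `A` to vanish, against unit columns. -/
theorem IsSignal.radius_pos {d r : ℕ} {cσ Cσ CA CΘ α : ℝ} {Θ A : Matrix (Fin d) (Fin r) ℝ}
    (hr : 1 ≤ r) (h : IsSignal cσ Cσ CA CΘ α Θ A) : 0 < CA := by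
  by_contra hCA
  have h0 : ∀ j, A j = 0 := fun j => by
    refine l2_eq_zero.1 (le_antisymm ((h.incoherent_right j).trans ?_) (l2_nonneg _))
    exact div_nonpos_of_nonpos_of_nonneg (not_lt.1 hCA) (Real.sqrt_nonneg _)
  have h1 := l2_transpose_apply_of_orthonormal h.orthonormal ⟨0, hr⟩
  have h2 : A.transpose ⟨0, hr⟩ = 0 := by
    ext j; exact congrFun (h0 j) _
  rw [h2, l2_zero] at h1
  exact zero_ne_one h1

end PairwiseRefinement

/-! ### The main theorem: choice of the noise level and averaging over the folds. -/

theorem theoremF (r : ℕ) (hr : 1 ≤ r) (cσ Cσ CA CΘ α C₀ Cinit : ℝ) (hcσ : 0 < cσ) :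
    ∃ c Cn C K : ℝ, 0 < c ∧ 0 < Cn ∧ 0 < C ∧ 0 < K ∧
      ∀ (d n : ℕ), 2 ≤ d → Cn * d * Real.log d ^ K ≤ (n : ℝ) →
      ∀ Θ A : Matrix (Fin d) (Fin r) ℝ, PairwiseRefinement.IsSignal cσ Cσ CA CΘ α Θ A →
      ∀ (Ω : Type*) [MeasurableSpace Ω] (P : Measure Ω) [IsProbabilityMeasure P]
        (Z : Fin n → Ω → PairwiseRefinement.Obs d),
        PairwiseRefinement.IsComparisonSample P (Θ * A.transpose) Z →
      ∀ φ : Ω → Fin n → Fin 3, Measurable φ → (∀ ω, PairwiseRefinement.IsBalanced (φ ω)) →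
        IndepFun φ (fun ω i => Z i ω) P →
      ∀ init : (Fin n → Option (PairwiseRefinement.Obs d)) → Matrix (Fin d) (Fin d) ℝ,
        (1 - (d : ℝ) ^ (-c)) *
          P.real {ω | PairwiseRefinement.IsGoodInit C₀ Cinit n (Θ * A.transpose)
            (init (PairwiseRefinement.firstFold (φ ω) fun i => Z i ω))} ≤
        P.real {ω |
          PairwiseRefinement.IsGoodInit C₀ Cinit n (Θ * A.transpose)
            (init (PairwiseRefinement.firstFold (φ ω) fun i => Z i ω)) ∧
          (∃ T₁, PairwiseRefinement.IsRefinement r (CA / Real.sqrt d)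
            (init (PairwiseRefinement.firstFold (φ ω) fun i => Z i ω))
            (φ ω) (fun i => Z i ω) T₁) ∧
          ∀ T₁, PairwiseRefinement.IsRefinement r (CA / Real.sqrt d)
            (init (PairwiseRefinement.firstFold (φ ω) fun i => Z i ω))
            (φ ω) (fun i => Z i ω) T₁ →
            ∀ i j, |T₁ i j - (Θ * A.transpose) i j| ≤
              C * Real.sqrt ((d : ℝ) / n) * Real.log d ^ K} := by
  rcases le_or_gt CA 0 with hCA | hCA
  · refine ⟨1, 1, 1, 1, one_pos, one_pos, one_pos, one_pos, ?_⟩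
    intro d n _ _ Θ A hS
    exact absurd (hS.radius_pos hr) hCA.not_gt
  obtain ⟨η₀, C, hη₀, hC, hmain⟩ := PairwiseRefinement.exists_fixed_folds_bound (Cσ := Cσ)
    (CΘ := CΘ) (α := α) (C₀ := C₀) (Cinit := Cinit) hr hcσ hCA
  -- The sample size condition with `Cn = 1 / η₀ ^ 2` says exactly that `η ≤ η₀`. The factor 2 in
  -- the error constant comes from `√(log d) ≤ 2 log d`, valid because `log d ≥ 1 / 2`.
  refine ⟨1, 1 / η₀ ^ 2, 2 * C, 1, one_pos, by positivity, by positivity, one_pos, ?_⟩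
  intro d n hd hn Θ A hS Ω _ P _ Z hZ φ hφ hbal hind init
  rw [Real.rpow_one] at hn
  simp only [Real.rpow_one]
  have h2 : (2 : ℝ) ≤ d := by exact_mod_cast hd
  have hd0 : (0 : ℝ) < d := by linarith
  have hL := PairwiseRefinement.half_le_log hd
  have hL0 : 0 < Real.log d := by linarith
  have hdL : 0 < d * Real.log d := by positivity
  have hn0 : (0 : ℝ) < n := lt_of_lt_of_le (by positivity) hn
  set η := Real.sqrt (d * Real.log d / n) with hη
  have hη0 : 0 < η := Real.sqrt_pos.2 (by positivity)
  have hη2 : n * η ^ 2 = d * Real.log d := by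
    rw [hη, Real.sq_sqrt (by positivity)]; field_simp
  have hηη₀ : η ≤ η₀ := by
    refine Real.sqrt_le_iff.2 ⟨hη₀.le, ?_⟩
    rw [div_le_iff₀ hn0]
    rw [mul_assoc, one_div_mul_eq_div, div_le_iff₀ (by positivity)] at hn
    linarith
  have hηC : C * η ≤ 2 * C * Real.sqrt (d / n) * Real.log d := by
    have h3 : η = Real.sqrt (d / n) * Real.sqrt (Real.log d) := by
      rw [← Real.sqrt_mul (by positivity), hη]; congr 1; ring
    have h4 : Real.sqrt (Real.log d) ≤ 2 * Real.log d :=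
      Real.sqrt_le_iff.2 ⟨by positivity, by nlinarith⟩
    rw [h3]
    calc _ ≤ C * (Real.sqrt (d / n) * (2 * Real.log d)) := by gcongr
      _ = _ := by ring
  set T := Θ * A.transpose with hT
  have hw0 := PairwiseRefinement.prodWeight_nonneg (ι := Fin n)
    (PairwiseRefinement.comparisonMass_nonneg T)
  let G : (Fin n → Fin 3) → Set (Fin n → PairwiseRefinement.Obs d) := fun f =>
    {z | PairwiseRefinement.IsGoodInit C₀ Cinit n T (init (PairwiseRefinement.firstFold f z))}
  let S : (Fin n → Fin 3) → Set (Fin n → PairwiseRefinement.Obs d) := fun f =>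
    {z | (∃ T₁, PairwiseRefinement.IsRefinement r (CA / Real.sqrt d)
        (init (PairwiseRefinement.firstFold f z)) f z T₁) ∧
      ∀ T₁, PairwiseRefinement.IsRefinement r (CA / Real.sqrt d)
        (init (PairwiseRefinement.firstFold f z)) f z T₁ →
          ∀ i j, |T₁ i j - T i j| ≤ 2 * C * Real.sqrt (d / n) * Real.log d}
  have key : ∀ f, PairwiseRefinement.IsBalanced f →
      (1 - 1 / (d : ℝ)) *
        PairwiseRefinement.wprob (PairwiseRefinement.prodWeight
          (PairwiseRefinement.comparisonMass T)) (G f) ≤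
      PairwiseRefinement.wprob (PairwiseRefinement.prodWeight
        (PairwiseRefinement.comparisonMass T)) (G f ∩ S f) := by
    intro f hf
    have h3 := hmain d n hd η hη0 hηη₀ hη2 Θ A hS f hf init
    have h4 := (PairwiseRefinement.wprob_mono hw0 (S := G f) (T := (G f ∩ S f) ∪ (G f ∩
      {z | ¬ ((∃ T₁, PairwiseRefinement.IsRefinement r (CA / Real.sqrt d)
          (init (PairwiseRefinement.firstFold f z)) f z T₁) ∧
        ∀ T₁, PairwiseRefinement.IsRefinement r (CA / Real.sqrt d)
          (init (PairwiseRefinement.firstFold f z)) f z T₁ →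
            ∀ i j, |T₁ i j - T i j| ≤ C * η)})) (fun z hz => by
          by_cases h : (∃ T₁, PairwiseRefinement.IsRefinement r (CA / Real.sqrt d)
            (init (PairwiseRefinement.firstFold f z)) f z T₁) ∧
            ∀ T₁, PairwiseRefinement.IsRefinement r (CA / Real.sqrt d)
              (init (PairwiseRefinement.firstFold f z)) f z T₁ →
                ∀ i j, |T₁ i j - T i j| ≤ C * η
          · exact Or.inl ⟨hz, h.1, fun T₁ hT₁ i j => (h.2 T₁ hT₁ i j).trans hηC⟩
          · exact Or.inr ⟨hz, h⟩)).trans (PairwiseRefinement.wprob_union_le hw0 _ _)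
    have h5 : PairwiseRefinement.wprob (PairwiseRefinement.prodWeight
        (PairwiseRefinement.comparisonMass T)) (G f) ≤ _ := h4.trans (add_le_add le_rfl h3)
    rw [sub_mul, one_mul]
    exact sub_le_iff_le_add.2 h5
  have e1 := PairwiseRefinement.measureReal_folds_sample_eq hZ hφ hind G
  have e2 := PairwiseRefinement.measureReal_folds_sample_eq hZ hφ hind fun f => G f ∩ S f
  change _ * P.real {ω | (fun i => Z i ω) ∈ G (φ ω)} ≤
    P.real {ω | (fun i => Z i ω) ∈ G (φ ω) ∩ S (φ ω)}
  rw [e1, e2, Finset.mul_sum, Real.rpow_neg_one, ← one_div]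
  refine Finset.sum_le_sum fun f _ => ?_
  rw [mul_left_comm]
  -- Partitions that `φ` never takes, in particular all unbalanced ones, have weight zero.
  rcases Set.eq_empty_or_nonempty {ω | φ ω = f} with h | ⟨ω, hω⟩
  · simp [h]
  · have hω : φ ω = f := hω
    exact mul_le_mul_of_nonneg_left (key f (hω ▸ hbal ω)) measureReal_nonneg
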